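/- **Setting.** Fix a finite domain $D$, an arity $r$ and a relation $R\subseteq D^r$, identified with its indicator function $R:D^r\to\{0,1\}$. A CSP instance $C$ on $n$ variables is a finite list of constraints $(S_i,w_i)$, where $S_i$ is an ordered $r$-subset of $[n]$ (an $r$-tuple of distinct elements) and $w_i\ge 0$; for $\psi\in D^n$ put $\mathrm{sat}_C(\psi)=\sum_i w_i R(\psi_{S_i})$. For $\varepsilon\in(0,1)$, an instance $\widehat C$ on the same variables (not necessarily a sub-instance of $C$) is a $(1\pm\varepsilon)$ sparsifier of $C$ if $(1-\varepsilon)\mathrm{sat}_C(\psi)\le \mathrm{sat}_{\widehat C}(\psi)\le(1+\varepsilon)\mathrm{sat}_C(\psi)$ for all $\psi\in D^n$. A random uniform instance with $m$ constraints on $n$ variables consists of $m$ constraints of weight $1$ whose ordered $r$-subsets are independent and uniform (sampled with replacement). **Notions.** $\mathrm{Hist}^D_r$ is the set of $h\in\mathbb Z_{\ge0}^D$ with $\sum_d h_d=r$, and $\mathrm{hist}(t)_d=\#\{i: t_i=d\}$ for $t\in D^r$. The symmetrization $S=\mathrm{Sym}(R):\mathrm{Hist}^D_r\to\mathbb Z_{\ge0}$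 is $S(h)=\prod_d h_d!\cdot\sum_{t:\,\mathrm{hist}(t)=h}R(t)$, and $\mathrm{supp}\,S=\{h:S(h)\ne0\}$. * $R$ is $k$-plentiful if for all $d\in D$ and $h\in\mathrm{supp}\,S$ there is $g\in\mathrm{supp}\,S$ with $g_e\le h_e$ for all $e\ne d$ and $g_d\ge k$. It is precisely $k$-plentiful if it is $k$-plentiful and not $(k+1)$-plentiful. * $h\in\mathrm{supp}\,S$ is $(d,k)$-tight if $h_d=k$ and the only $g\in\mathrm{supp}\,S$ with $g_e\le h_e$ for all $e\neq d$ is $h$ itself. * For $d\in E\subseteq D$, $h\in\mathrm{supp}\,S$ is $(d,E)$-rigid if $h_e=0$ for all $e\in E\setminus\{d\}$, and $\sum_{e\in E}g_e=h_d$ for every $g\in\mathrm{supp}\,S$ with $g_e\le h_e$ for all $e\notin E$. * Let $R$ be precisely $k$-plentiful. $\mathrm{Sym}(R)$ is marginally uniform if for all $d\in E\subseteq D$ and every $h$ that is $(d,k)$-tight and $(d,E)$-rigid, $g\mapsto S(g\sqcup_E h)$ is constant on $\mathrm{Hist}^E_k$, where $g\sqcup_E h$ equals $g$ on $E$ and $h$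 off $E$. $R$ is marginally uniform if for all such $d,E,h$, all $s\in D^r$ with $\mathrm{hist}(s)=h$, and all $t\in D^r$ such that for each $i$ either $s_i=t_i$ or $s_i,t_i\in E$, we have $R(s)=R(t)$. "With high probability" means with probability tending to $1$ as $n\to\infty$, uniformly over all $m$ and $\varepsilon$ in the stated range. $O_R,\Omega_R,\widetilde O_R$ hide constants depending only on $R$ (with $D$ and $r$), and $\widetilde O_R(f)$ means $O_R\bigl(f\cdot(1+\log(1+f))^{O_R(1)}\bigr)$. **Theorem.** Let $R\subseteq D^r$ be precisely $k$-plentiful, and let $C$ be a random uniform instance with relation $R$, with $m$ constraints on $n$ variables. 1. Suppose $\mathrm{Sym}(R)$ is not marginally uniform. (1) For every $\varepsilon\in(0,1)$, with high probability $C$ has a $(1\pm\varepsilon)$ sparsifier with $\widetilde O_R(\min(m,n^{r-k+1}/\varepsilon^2))$ constraints. (2) There is a constant $\varepsilon_0=\varepsilon_0(R)>0$ such that for every $\varepsilon\in(0,\varepsilon_0]$, with high probability every $(1\pm\varepsilon)$ sparsifier of $C$ has $\Omega_R(\min(m,n^{r-k+1}))$ constraints. 2. Suppose $R$ is marginally uniform.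 (1) For every $\varepsilon\in(0,1)$, with high probability $C$ has a $(1\pm\varepsilon)$ sparsifier with $\widetilde O_R(\min(m,n^{r-k}/\varepsilon^3))$ constraints. (2) There is a constant $\varepsilon_0=\varepsilon_0(R)>0$ such that for every $\varepsilon\in(0,\varepsilon_0]$, with high probability every $(1\pm\varepsilon)$ sparsifier of $C$ has $\Omega_R(\min(m,n^{r-k}))$ constraints. 3. Suppose $\mathrm{Sym}(R)$ is marginally uniform but $R$ is not. (1) There is a constant $\kappa=\kappa(R)>0$ such that for every $\varepsilon\in(0,1)$ and $m\ge\kappa\, n^{r-k+1}/\varepsilon^2$, with high probability $C$ has a $(1\pm\varepsilon)$ sparsifier with $\widetilde O_R(n^{r-k}/\varepsilon^3)$ constraints. (2) There are constants $\kappa'=\kappa'(R)>0$ and $\varepsilon_0=\varepsilon_0(R)>0$ such that for every $\varepsilon\in(0,\varepsilon_0]$ and $m\le n^{r-k+1}/\kappa'$, with high probability every $(1\pm\varepsilon)$ sparsifier of $C$ has $\Omega_R(m)$ constraints. -/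

import Mathlib

open scoped Nat

namespace RandomCSP

/-! ### Histograms and symmetric valued relations -/

/-- `D`-histograms of arity `r`: vectors in `ℕ^D` whose coordinates sum to `r`. -/
def Hist (D : Type*) [Fintype D] (r : ℕ) : Type _ := {h : D → ℕ // ∑ d, h d = r}

/-- A valued relation of arity `r` over the domain `D`. -/
abbrev ValuedRel (D : Type*) (r : ℕ) : Type _ := (Fin r → D) → ℕ

/-- A symmetric valued relation of arity `r` over the domain `D`. -/
abbrev SVR (D : Type*) [Fintype D] (r : ℕ) : Type _ := Hist D r → ℕ

/-- An ordinary relation `R ⊆ D^r`, seen as a `{0,1}`-valued relation. -/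
noncomputable def ofRelation {D : Type*} {r : ℕ} (R : Set (Fin r → D)) : ValuedRel D r :=
  R.indicator (fun _ => 1)

section

variable {D : Type*} [Fintype D] {r : ℕ}

/-- The support of a symmetric valued relation. -/
def SVR.supp (S : SVR D r) : Set (Hist D r) := {h | S h ≠ 0}

/-- `S` is `k`-plentiful: for every `d` and every `h` in the support there is `g` in the support
with `g_e ≤ h_e` for all `e ≠ d` and `g_d ≥ k`. -/
def SVR.Plentiful (S : SVR D r) (k : ℕ) : Prop :=
  ∀ d : D, ∀ h ∈ S.supp, ∃ g ∈ S.supp, (∀ e, e ≠ d → g.1 e ≤ h.1 e) ∧ k ≤ g.1 d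

/-- `S` is precisely `k`-plentiful: `k`-plentiful but not `(k+1)`-plentiful. -/
def SVR.PreciselyPlentiful (S : SVR D r) (k : ℕ) : Prop :=
  S.Plentiful k ∧ ¬ S.Plentiful (k + 1)

/-- `h ∈ supp S` is `(d,k)`-tight: the only `g ∈ supp S` with `g_e ≤ h_e` for all `e ≠ d` is `h`
itself, and `h_d = k`. -/
def SVR.Tight (S : SVR D r) (d : D) (k : ℕ) (h : Hist D r) : Prop :=
  h ∈ S.supp ∧ (∀ g ∈ S.supp, (∀ e, e ≠ d → g.1 e ≤ h.1 e) → g = h) ∧ h.1 d = k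

/-- `h ∈ supp S` is `(d,E)`-rigid, for `d ∈ E ⊆ D`: `h` vanishes on `E \ {d}`, and every
`g ∈ supp S` with `g_e ≤ h_e` for all `e ∉ E` has `g(E) = h_d`. -/
def SVR.Rigid (S : SVR D r) (d : D) (E : Finset D) (h : Hist D r) : Prop :=
  h ∈ S.supp ∧ d ∈ E ∧ (∀ e ∈ E, e ≠ d → h.1 e = 0) ∧
    ∀ g ∈ S.supp, (∀ e, e ∉ E → g.1 e ≤ h.1 e) → ∑ e ∈ E, g.1 e = h.1 d

theorem SVR.Rigid.sum_eq {S : SVR D r} {d : D} {E : Finset D} {h : Hist D r}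
    (hr : S.Rigid d E h) : ∑ e ∈ E, h.1 e = h.1 d :=
  hr.2.2.2 h hr.1 fun _ _ => le_rfl

variable [DecidableEq D]

/-- The histogram of a tuple: coordinate `d` counts the occurrences of `d` in `t`. -/
def hist (t : Fin r → D) : Hist D r :=
  ⟨fun d => (Finset.univ.filter fun i => t i = d).card, by
    have h := Finset.card_eq_sum_card_fiberwise (f := t) (s := Finset.univ)
      (t := Finset.univ) (fun _ _ => Finset.mem_coe.2 (Finset.mem_univ _))
    simpa using h.symm⟩

/-- The symmetrization of `R`:
`Sym(R)(h) = (∏_d h_d!) · ∑_{t : hist(t) = h} R(t)`. -/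
noncomputable def ValuedRel.Sym (R : ValuedRel D r) : SVR D r := fun h =>
  open Classical in
  (∏ d, (h.1 d)!) * ∑ t ∈ Finset.univ.filter (fun t : Fin r → D => hist t = h), R t

/-- `R` is precisely `k`-plentiful iff its symmetrization is. -/
def ValuedRel.PreciselyPlentiful (R : ValuedRel D r) (k : ℕ) : Prop :=
  R.Sym.PreciselyPlentiful k

/-- `g ⊔_E h`: the histogram on `D` which is `g` on `E` and `h` off `E`. -/
def glue {k : ℕ} (E : Finset D) (h : Hist D r) (hE : ∑ e ∈ E, h.1 e = k) (g : Hist E k) :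
    Hist D r :=
  ⟨fun e => if he : e ∈ E then g.1 ⟨e, he⟩ else h.1 e, by
    have h1 := Finset.sum_add_sum_compl E
      (fun e => if he : e ∈ E then g.1 ⟨e, he⟩ else h.1 e)
    have h2 := Finset.sum_add_sum_compl E h.1
    have h3 : ∑ e ∈ E, (if he : e ∈ E then g.1 ⟨e, he⟩ else h.1 e) = k := by
      rw [← Finset.sum_coe_sort]
      simpa using g.2
    have h4 : ∑ e ∈ Eᶜ, (if he : e ∈ E then g.1 ⟨e, he⟩ else h.1 e) = ∑ e ∈ Eᶜ, h.1 e :=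
      Finset.sum_congr rfl fun e he => dif_neg (Finset.mem_compl.1 he)
    rw [← h1, h3, h4, ← hE, h2, h.2]⟩

/-- The marginal predicate `S_{h,E} : Hist^E_k → ℕ`, `g ↦ S(g ⊔_E h)`. -/
def SVR.marginal {k : ℕ} (S : SVR D r) (E : Finset D) (h : Hist D r)
    (hE : ∑ e ∈ E, h.1 e = k) : SVR E k :=
  fun g => S (glue E h hE g)

/-- A symmetric valued relation is uniform if it is a constant function. -/
def SVR.Uniform {k : ℕ} {E : Finset D} (S : SVR E k) : Prop := ∀ g g', S g = S g'

/-- Marginal uniformity of a (precisely `k`-plentiful) symmetric valued relation: every marginal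
predicate `S_{h,E}`, with `h` being `(d,k)`-tight and `(d,E)`-rigid, is uniform. -/
def SVR.MarginallyUniform (S : SVR D r) (k : ℕ) : Prop :=
  ∀ (d : D) (h : Hist D r) (E : Finset D) (ht : S.Tight d k h) (hr : S.Rigid d E h),
    (S.marginal E h (hr.sum_eq.trans ht.2.2)).Uniform

/-- `s ∼_E t`: the tuples take values in `E` at the same positions and agree at all others. -/
def TupleEquiv (E : Finset D) (s t : Fin r → D) : Prop :=
  ∀ i, (s i ∈ E ∧ t i ∈ E) ∨ s i = t i

/-- Marginal uniformity of a (precisely `k`-plentiful) valued relation. -/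
def ValuedRel.MarginallyUniform (R : ValuedRel D r) (k : ℕ) : Prop :=
  ∀ (d : D) (E : Finset D) (h : Hist D r), R.Sym.Tight d k h → R.Sym.Rigid d E h →
    ∀ s t : Fin r → D, hist s = h → TupleEquiv E s t → R s = R t

end

/-! ### Instances, sparsifiers and random instances -/

/-- A weighted CSP instance on `n` variables with constraints of arity `r`. The `i`th constraint
is applied to an ordered `r`-subset of the variables and has a non-negative weight. -/
structure Instance (r n : ℕ) where
  /-- the number of constraints -/
  size : ℕ
  /-- the variables that a constraint is applied to -/
  scope : Fin size → (Fin r ↪ Fin n)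
  /-- the weight of a constraint -/
  weight : Fin size → ℝ
  weight_nonneg : ∀ i, 0 ≤ weight i

variable {D : Type*} {r n : ℕ}

/-- The value of the instance `C` of `CSP(R)` on the assignment `ψ`. -/
noncomputable def sat (R : ValuedRel D r) (C : Instance r n) (ψ : Fin n → D) : ℝ :=
  ∑ i, C.weight i * (R (fun j => ψ (C.scope i j)) : ℝ)

/-- `C'` is a `(1 ± ε)` sparsifier of `C`. -/
def IsSparsifier (R : ValuedRel D r) (ε : ℝ) (C C' : Instance r n) : Prop :=
  ∀ ψ : Fin n → D, (1 - ε) * sat R C ψ ≤ sat R C' ψ ∧ sat R C' ψ ≤ (1 + ε) * sat R C ψ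

/-- `C` has a `(1 ± ε)` sparsifier with at most `s` constraints. -/
def SparsifiableTo (R : ValuedRel D r) (ε : ℝ) (s : ℝ) (C : Instance r n) : Prop :=
  ∃ C' : Instance r n, IsSparsifier R ε C C' ∧ (C'.size : ℝ) ≤ s

/-- Every `(1 ± ε)` sparsifier of `C` has at least `s` constraints. -/
def SparsifierRequires (R : ValuedRel D r) (ε : ℝ) (s : ℝ) (C : Instance r n) : Prop :=
  ∀ C' : Instance r n, IsSparsifier R ε C C' → s ≤ (C'.size : ℝ)

/-- The unweighted instance with constraints applied to `S 0, …, S (m-1)`. -/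
def Instance.ofScopes {m : ℕ} (S : Fin m → (Fin r ↪ Fin n)) : Instance r n where
  size := m
  scope := S
  weight := fun _ => 1
  weight_nonneg := fun _ => zero_le_one

/-- The probability that a random uniform instance with `m` constraints on `n` variables has the
property `P`. The `m` ordered `r`-subsets are independent and uniform (with replacement), so their
joint law is the uniform one on a finite set. -/
noncomputable def randomProb (r n m : ℕ) (P : Instance r n → Prop) : ℝ :=
  (Nat.card {S : Fin m → (Fin r ↪ Fin n) // P (Instance.ofScopes S)} : ℝ) /
    (Nat.card (Fin m → (Fin r ↪ Fin n)) : ℝ)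

/-- With high probability: the probability that a random uniform instance with `m` constraints on
`n` variables has the property `P n m ε` tends to `1` as `n → ∞`, uniformly over all `m` and `ε` in
the range described by `range`. -/
def WHP (r : ℕ) (range : ℕ → ℕ → ℝ → Prop) (P : (n : ℕ) → ℕ → ℝ → Instance r n → Prop) : Prop :=
  ∀ δ : ℝ, 0 < δ → ∃ N : ℕ, ∀ n : ℕ, N ≤ n → ∀ (m : ℕ) (ε : ℝ), range n m ε →
    1 - δ ≤ randomProb r n m (P n m ε)

/-- The bound `A · f · (1 + log (1 + f))^b`. A quantity is `Õ(f)` if it is at most this, for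
some constants `A` and `b`. -/
noncomputable def softO (A : ℝ) (b : ℕ) (f : ℝ) : ℝ := A * f * (1 + Real.log (1 + f)) ^ b

end RandomCSP

open RandomCSP

/-!
# Sparsification of random CSP instances

Scopes are embeddings `Fin r ↪ Fin n`, and `density R ψ` is the average of `R` over all scopes
under the assignment `ψ`. The complete instance has all scopes with equal weights, so its value on
`ψ` is proportional to `density R ψ`.

**Upper bounds.** Two instances that both approximate the complete instance, up to scaling, sparsify
each other (`isSparsifier_of_approximates`). So it suffices to know how long a random instance has
to be to approximate the complete instance: a longer one is sparsified by a shorter random one, and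
a shorter one by itself. If `R` is `k`-plentiful, then every nonzero density has order at least
`n ^ (k - r)`, because an improving histogram can place `k` entries on a majority color
(`one_le_density_mul`). The Chernoff bound and a union bound over all `|D| ^ n` assignments then
give the length `n ^ (r - k + 1) / ε ^ 2` (`exists_freq_not_approximates_le`). If `R` is marginally
uniform, then the union bound can be made cheaper by a factor of `n`. Assignments of large density
are treated as before. For an assignment of small density, let `E` be the set of its popular colors.
Every histogram in the support that fits into the assignment has at most `k` entries in `E`, and the
ones with exactly `k` are tight and rigid after moving these entries to the majority color
(`SmallDensity.tight_rigid_of_eq`). By marginal uniformity, the dominant part of the value depends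
only on the assignment with all of `E` collapsed to one color, which is determined by its few
variables off `E`; the other part is smaller by a factor of order `ε`
(`SmallDensity.density_minorPart_mul_le`). The union bound over collapsed assignments is
`freq_exists_collapsed_le`. If only `Sym R` is marginally uniform, then this applies to
`t ↦ Sym R (hist t)`, and the sparsifier takes all reorderings of each constraint
(`whp_sparsifiable_of_sym`).

**Lower bounds.** A tight and rigid histogram gives a tuple `s`; the positions where `s` is not in
`E` form the core of a constraint. An assignment that is `s` on a core `T` and takes values in `E`
elsewhere satisfies only constraints that contain `T` (`SVR.Rigid.containsCore`).
* A sparsifier has to contain every core that occurs in the instance, and a random instance has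
  order `min m (n ^ (r - k))` different cores (`whp_requires_of_preciselyPlentiful`).
* If `R` is not marginally uniform, then `s` can be recolored within `E` to a tuple `t` with
  `R t ≠ R s`. If `m` is sufficiently less than `n ^ (r - k + 1)`, then most constraints share at
  most `r - k` variables with any other. Around a core `T`, all of them that avoid the variables
  touched by a sparsifier can be recolored at once, which the sparsifier does not notice
  (`whp_requires_of_not_uniform`).
* If `Sym R` is not marginally uniform, then the density of an assignment around a core depends, in
  the limit, on the fractions of the variables that have the different colors of `E`. This is a
  statement about a homogeneous polynomial (`exists_limitDensity_ne`). A sparsifier with few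
  constraints touches a small fraction of the variables around some core, so it does not distinguish
  two assignments that are constant on the touched variables and have different densities. The
  random instance does, by a union bound over cores and small sets of variables
  (`whp_requires_of_sym_not_uniform_of_le`).
-/

namespace RandomCSP

set_option linter.unusedSectionVars false

/-! ### Uniform probability on finite sets -/

section Freq

variable {X : Type*}

/-- The probability that a uniformly random element of the finite type `X` satisfies `p`. -/
noncomputable def freq (p : X → Prop) : ℝ := (Nat.card {x // p x} : ℝ) / (Nat.card X : ℝ)

theorem randomProb_eq_freq (r n m : ℕ) (P : Instance r n → Prop) :
    randomProb r n m P = freq fun S : Fin m → (Fin r ↪ Fin n) => P (Instance.ofScopes S) := rfl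

variable [Fintype X]

/-- The average of a real function on a finite type. -/
noncomputable def mean (F : X → ℝ) : ℝ := (∑ x, F x) / Fintype.card X

open Classical in
theorem freq_eq_mean (p : X → Prop) : freq p = mean fun x => if p x then (1 : ℝ) else 0 := by
  rw [freq, mean, Nat.card_eq_fintype_card, Nat.card_eq_fintype_card, Fintype.card_subtype,
    Finset.sum_boole]

theorem mean_mono {F G : X → ℝ} (h : ∀ x, F x ≤ G x) : mean F ≤ mean G :=
  div_le_div_of_nonneg_right (Finset.sum_le_sum fun x _ => h x) (Nat.cast_nonneg _)

theorem mean_nonneg {F : X → ℝ} (h : ∀ x, 0 ≤ F x) : 0 ≤ mean F :=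
  div_nonneg (Finset.sum_nonneg fun x _ => h x) (Nat.cast_nonneg _)

theorem mean_mul_left (c : ℝ) (F : X → ℝ) : mean (fun x => c * F x) = c * mean F := by
  rw [mean, mean, ← Finset.mul_sum, mul_div_assoc]

theorem mean_add (F G : X → ℝ) : mean (fun x => F x + G x) = mean F + mean G := by
  rw [mean, mean, mean, Finset.sum_add_distrib, add_div]

theorem freq_mono {p q : X → Prop} (h : ∀ x, p x → q x) : freq p ≤ freq q := by
  classical
  rw [freq_eq_mean, freq_eq_mean]
  refine mean_mono fun x => ?_
  by_cases hp : p x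
  · simp [hp, h x hp]
  · simp only [hp, if_false]; split_ifs <;> norm_num

theorem freq_add_freq_not [Nonempty X] (p : X → Prop) : freq p + freq (fun x => ¬ p x) = 1 := by
  classical
  rw [freq_eq_mean, freq_eq_mean, ← mean_add, mean, div_eq_one_iff_eq (by simp)]
  rw [Finset.sum_congr rfl (g := fun _ => (1 : ℝ)) fun x _ => by by_cases hp : p x <;> simp [hp]]
  simp

theorem one_sub_le_freq [Nonempty X] {p : X → Prop} {δ : ℝ} (h : freq (fun x => ¬ p x) ≤ δ) :
    1 - δ ≤ freq p := by
  linarith [freq_add_freq_not p]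

theorem freq_of_forall [Nonempty X] {p : X → Prop} (h : ∀ x, p x) : freq p = 1 := by
  have h1 := freq_add_freq_not p
  have h2 : freq (fun x => ¬ p x) = 0 := by simp [freq, h]
  linarith

theorem exists_of_freq_not_lt_one [Nonempty X] {p : X → Prop} (h : freq (fun x => ¬ p x) < 1) :
    ∃ x, p x := by
  by_contra! hp
  rw [freq_of_forall hp] at h
  exact lt_irrefl _ h

theorem freq_le_sum {ι : Type*} (s : Finset ι) {p : X → Prop} {q : ι → X → Prop}
    (h : ∀ x, p x → ∃ i ∈ s, q i x) : freq p ≤ ∑ i ∈ s, freq (q i) := by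
  classical
  simp only [freq_eq_mean, mean]
  rw [← Finset.sum_div, Finset.sum_comm]
  refine div_le_div_of_nonneg_right (Finset.sum_le_sum fun x _ => ?_) (Nat.cast_nonneg _)
  have h0 : ∀ i ∈ s, (0 : ℝ) ≤ if q i x then (1 : ℝ) else 0 := fun i _ => by
    split_ifs <;> norm_num
  by_cases hp : p x
  · obtain ⟨i, hi, hq⟩ := h x hp
    simp only [hp, if_true]
    calc (1 : ℝ) = if q i x then (1 : ℝ) else 0 := by simp [hq]
      _ ≤ _ := Finset.single_le_sum h0 hi
  · simp only [hp, if_false]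
    exact Finset.sum_nonneg h0

theorem freq_or_le {p q q' : X → Prop} (h : ∀ x, p x → q x ∨ q' x) :
    freq p ≤ freq q + freq q' := by
  have := freq_le_sum (p := p) (q := fun b : Bool => if b then q else q') Finset.univ
    fun x hx => by
      rcases h x hx with h | h
      exacts [⟨true, by simp, by simpa using h⟩, ⟨false, by simp, by simpa using h⟩]
  simpa using this

/-- Markov's inequality. -/
theorem freq_le_of_mean_le {p : X → Prop} {G : X → ℝ} {c a : ℝ} (hG : ∀ x, 0 ≤ G x) (hc : 0 < c)
    (hp : ∀ x, p x → c ≤ G x) (ha : mean G ≤ c * a) : freq p ≤ a := by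
  classical
  refine le_of_mul_le_mul_left (le_trans ?_ ha) hc
  rw [freq_eq_mean, ← mean_mul_left]
  refine mean_mono fun x => ?_
  by_cases h : p x
  · simpa [h] using hp x h
  · simpa [h] using hG x

theorem mean_prod_eq_pow (m : ℕ) (G : X → ℝ) :
    mean (fun S : Fin m → X => ∏ i, G (S i)) = mean G ^ m := by
  rw [mean, mean, div_pow, Fintype.sum_pow]
  simp

/-- One-sided Chernoff bound for a sum of independent samples of `F`, in a form where the
deviation is measured against an upper bound `w` for the normalized second moment. -/
theorem freq_sum_gt_le [Nonempty X] {F : X → ℝ} {B w η : ℝ} (hB : 0 < B) (hF : ∀ x, |F x| ≤ B)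
    (hw : mean (fun x => F x ^ 2) ≤ B * w) (hη : 0 ≤ η) (hη1 : η ≤ 1) (m : ℕ) :
    freq (fun S : Fin m → X => m * mean F + η * (m * w) < ∑ i, F (S i)) ≤
      Real.exp (-(η ^ 2 * (m * w) / (4 * B))) := by
  set l : ℝ := η / (2 * B) with hl
  have hl0 : 0 ≤ l := by positivity
  have hlB : l * B ≤ 1 := by
    have : l * B = η / 2 := by rw [hl]; field_simp
    rw [this]; linarith
  have hone : mean (fun _ : X => (1 : ℝ)) = 1 := by
    simp [mean]
  have hmean : mean (fun x => Real.exp (l * F x)) ≤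
      Real.exp (l * mean F + l ^ 2 * (B * w)) := by
    calc mean (fun x => Real.exp (l * F x))
        ≤ mean (fun x => (1 + l * F x) + l ^ 2 * F x ^ 2) := by
          refine mean_mono fun x => ?_
          have h1 : |l * F x| ≤ 1 := by
            rw [abs_mul, abs_of_nonneg hl0]
            exact (mul_le_mul_of_nonneg_left (hF x) hl0).trans hlB
          have := (abs_le.1 (Real.abs_exp_sub_one_sub_id_le h1)).2
          nlinarith
      _ = 1 + l * mean F + l ^ 2 * mean (fun x => F x ^ 2) := by
          rw [mean_add, mean_add, hone, mean_mul_left, mean_mul_left]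
      _ ≤ (l * mean F + l ^ 2 * (B * w)) + 1 := by
          have := mul_le_mul_of_nonneg_left hw (sq_nonneg l)
          linarith
      _ ≤ _ := Real.add_one_le_exp _
  have hm0 : 0 ≤ mean (fun x => Real.exp (l * F x)) := mean_nonneg fun x => (Real.exp_pos _).le
  refine freq_le_of_mean_le (G := fun S : Fin m → X => ∏ i, Real.exp (l * F (S i)))
    (c := Real.exp (l * (m * mean F + η * (m * w))))
    (fun S => Finset.prod_nonneg fun i _ => (Real.exp_pos _).le) (Real.exp_pos _)
    (fun S hS => ?_) ?_
  · rw [← Real.exp_sum, ← Finset.mul_sum]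
    exact Real.exp_le_exp.2 (mul_le_mul_of_nonneg_left hS.le hl0)
  · rw [mean_prod_eq_pow m (fun x => Real.exp (l * F x))]
    refine (pow_le_pow_left₀ hm0 hmean m).trans (le_of_eq ?_)
    rw [← Real.exp_nat_mul, ← Real.exp_add]
    congr 1
    rw [hl]
    field_simp
    ring

/-- Two-sided Chernoff bound for a sum of independent samples of a function with values in
`[0, B]` and mean at most `w`. -/
theorem freq_abs_sum_sub_gt_le [Nonempty X] {F : X → ℝ} {B w η : ℝ} (hB : 0 < B)
    (hF0 : ∀ x, 0 ≤ F x) (hF : ∀ x, F x ≤ B)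
    (hw : mean F ≤ w) (hη : 0 ≤ η) (hη1 : η ≤ 1) (m : ℕ) :
    freq (fun S : Fin m → X => η * (m * w) < |∑ i, F (S i) - m * mean F|) ≤
      2 * Real.exp (-(η ^ 2 * (m * w) / (4 * B))) := by
  have hw2 : mean (fun x => F x ^ 2) ≤ B * w := by
    calc mean (fun x => F x ^ 2) ≤ mean (fun x => B * F x) := mean_mono fun x => by
          rw [sq]; exact mul_le_mul_of_nonneg_right (hF x) (hF0 x)
      _ = B * mean F := mean_mul_left _ _
      _ ≤ B * w := mul_le_mul_of_nonneg_left hw hB.le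
  have habs : ∀ x, |F x| ≤ B := fun x => by rw [abs_of_nonneg (hF0 x)]; exact hF x
  have h1 := freq_sum_gt_le hB habs hw2 hη hη1 m
  have h2 := freq_sum_gt_le (F := fun x => -F x) hB (fun x => by rw [abs_neg]; exact habs x)
    (by simpa using hw2) hη hη1 m
  have hneg : mean (fun x => -F x) = - mean F := by simpa using mean_mul_left (-1) F
  rw [two_mul]
  refine (freq_or_le fun S hS => ?_).trans (add_le_add h1 h2)
  rcases lt_abs.1 hS with h | h
  · left; linarith
  · right
    rw [hneg, Finset.sum_neg_distrib]
    linarith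

end Freq

/-! ### Collisions in a random sequence -/

section Collisions

variable {X : Type*}

open Classical in
/-- The number of terms of the sequence `S` among the first `a` that are related to an earlier
term. -/
noncomputable def collisions (rel : X → X → Prop) (a : ℕ) {m : ℕ} (S : Fin m → X) : ℕ :=
  (Finset.univ.filter fun j : Fin m => (j : ℕ) < a ∧ ∃ i < j, rel (S i) (S j)).card

open Classical in
theorem collisions_snoc (rel : X → X → Prop) (a : ℕ) {m : ℕ} (S : Fin m → X) (x : X) :
    collisions rel a (Fin.snoc (α := fun _ => X) S x) =
      collisions rel a S + if m < a ∧ ∃ i, rel (S i) x then 1 else 0 := by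
  simp only [collisions, Finset.card_filter]
  rw [Fin.sum_univ_castSucc]
  congr 1
  · refine Finset.sum_congr rfl fun j _ => ?_
    congr 1
    simp only [Fin.snoc_castSucc, Fin.val_castSucc, eq_iff_iff, and_congr_right_iff]
    refine fun _ => ⟨?_, ?_⟩
    · rintro ⟨i, hi, h⟩
      have him : (i : ℕ) < m := lt_trans (Fin.lt_def.1 hi) j.2
      refine ⟨⟨i, him⟩, hi, ?_⟩
      have : i = Fin.castSucc ⟨i, him⟩ := rfl
      rw [this, Fin.snoc_castSucc] at h
      exact h
    · rintro ⟨i, hi, h⟩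
      exact ⟨i.castSucc, hi, by simpa using h⟩
  · congr 1
    simp only [Fin.val_last, Fin.snoc_last, eq_iff_iff, and_congr_right_iff]
    refine fun _ => ⟨?_, ?_⟩
    · rintro ⟨i, hi, h⟩
      have him : (i : ℕ) < m := Fin.lt_def.1 hi
      refine ⟨⟨i, him⟩, ?_⟩
      have : i = Fin.castSucc ⟨i, him⟩ := rfl
      rw [this, Fin.snoc_castSucc] at h
      exact h
    · rintro ⟨i, h⟩
      exact ⟨i.castSucc, Fin.castSucc_lt_last i, by simpa using h⟩

variable [Fintype X]

open Classical in
/-- The exponential moment of the number of collisions, bounded one term at a time: for each of the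
first `a` terms, at most `a * Δ` values are related to an earlier term. -/
theorem sum_pow_collisions_le (rel : X → X → Prop) (a : ℕ) {Δ l : ℝ} (hl : 1 ≤ l) (hΔ : 0 ≤ Δ)
    (hrel : ∀ x, ((Finset.univ.filter fun y => rel x y).card : ℝ) ≤ Δ) (m : ℕ) :
    ∑ S : Fin m → X, l ^ collisions rel a S ≤
      (Fintype.card X + l * (a * Δ)) ^ min m a * (Fintype.card X : ℝ) ^ (m - a) := by
  have hl0 : 0 ≤ l := by linarith
  induction m with
  | zero => simp [collisions]
  | succ m ih =>
    rw [← (Fin.snocEquiv fun _ => X).sum_comp, Fintype.sum_prod_type, Finset.sum_comm]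
    have hstep : ∀ S : Fin m → X, ∑ x, l ^ collisions rel a (Fin.snocEquiv (fun _ => X) (x, S)) ≤
        l ^ collisions rel a S *
          (if m < a then (Fintype.card X + l * (a * Δ)) else (Fintype.card X : ℝ)) := by
      intro S
      simp only [Fin.snocEquiv, Equiv.coe_fn_mk]
      have : ∀ x, l ^ collisions rel a (Fin.snoc (α := fun _ => X) S x) =
          l ^ collisions rel a S * (if m < a ∧ ∃ i, rel (S i) x then l else 1) := by
        intro x
        rw [collisions_snoc, pow_add]
        split_ifs <;> simp
      simp only [this]
      rw [← Finset.mul_sum]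
      refine mul_le_mul_of_nonneg_left ?_ (by positivity)
      split_ifs with hm
      · calc ∑ x, (if m < a ∧ ∃ i, rel (S i) x then l else 1)
            ≤ ∑ x, (1 + ∑ i, if rel (S i) x then l else 0) := by
              refine Finset.sum_le_sum fun x _ => ?_
              have h0 : ∀ i ∈ (Finset.univ : Finset (Fin m)),
                  (0 : ℝ) ≤ if rel (S i) x then l else 0 := fun i _ => by
                split_ifs <;> simp [hl0]
              split_ifs with h
              · obtain ⟨-, i, hi⟩ := h
                have := Finset.single_le_sum h0 (Finset.mem_univ i)
                rw [if_pos hi] at this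
                linarith
              · linarith [Finset.sum_nonneg h0]
          _ = Fintype.card X + ∑ i, ∑ x, if rel (S i) x then l else 0 := by
              rw [Finset.sum_add_distrib, Finset.sum_comm]; simp
          _ ≤ Fintype.card X + ∑ _i : Fin m, l * Δ := by
              gcongr with i
              rw [← Finset.sum_filter, Finset.sum_const, nsmul_eq_mul, mul_comm]
              exact mul_le_mul_of_nonneg_left (hrel _) hl0
          _ ≤ _ := by
              rw [Finset.sum_const, Finset.card_univ, Fintype.card_fin, nsmul_eq_mul]
              have : (m : ℝ) ≤ a := by exact_mod_cast hm.le
              nlinarith [mul_nonneg hl0 hΔ]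
      · simp [hm]
    refine (Finset.sum_le_sum fun S _ => hstep S).trans ?_
    rw [← Finset.sum_mul]
    have hc : (0 : ℝ) ≤ if m < a then (Fintype.card X + l * (a * Δ)) else (Fintype.card X : ℝ) := by
      split_ifs <;> positivity
    refine (mul_le_mul_of_nonneg_right ih hc).trans (le_of_eq ?_)
    split_ifs with hm
    · rw [min_eq_left hm.le, min_eq_left (Nat.succ_le_of_lt hm), Nat.sub_eq_zero_of_le hm.le,
        Nat.sub_eq_zero_of_le (Nat.succ_le_of_lt hm), pow_succ]
      ring
    · rw [not_lt] at hm
      rw [min_eq_right hm, min_eq_right (hm.trans (Nat.le_succ m)), Nat.succ_sub hm, pow_succ]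
      ring

/-- If every element is related to at most a `δ` fraction of all elements, where `32 a δ ≤ 1`, then
it is unlikely that a quarter of the first `a` terms of a random sequence are related to earlier
terms. -/
theorem freq_collisions_ge_le [Nonempty X] (rel : X → X → Prop) {a m : ℕ} (ham : a ≤ m)
    (ha : 0 < a) {δ : ℝ} (hδ : 0 < δ) (haδ : 32 * (a * δ) ≤ 1)
    (hrel : ∀ x, freq (fun y => rel x y) ≤ δ) :
    freq (fun S : Fin m → X => a ≤ 4 * collisions rel a S) ≤ 128 * δ := by
  classical
  set N : ℝ := (Fintype.card X : ℝ) with hN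
  have hN0 : 0 < N := by rw [hN]; exact_mod_cast Fintype.card_pos
  have ha0 : (0 : ℝ) < a := by exact_mod_cast ha
  set l : ℝ := 1 / (a * δ) with hl
  have had : 0 < a * δ := by positivity
  have hl1 : 1 ≤ l := by rw [hl, le_div_iff₀ had]; linarith
  set b := (a + 3) / 4 with hb
  have hb1 : 1 ≤ b := by omega
  have hab : a ≤ 4 * b := by omega
  have hsum := sum_pow_collisions_le rel a (Δ := δ * N) hl1 (by positivity) (fun x => by
    have := hrel x
    rw [freq_eq_mean, mean, Finset.sum_boole, div_le_iff₀ hN0] at this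
    exact this) m
  have hmean : mean (fun S : Fin m → X => l ^ collisions rel a S) ≤ 2 ^ a := by
    rw [mean, Fintype.card_fun, Fintype.card_fin]
    push_cast
    rw [← hN]
    rw [div_le_iff₀ (by positivity)]
    refine hsum.trans (le_of_eq ?_)
    rw [min_eq_right ham, ← hN]
    have h1 : l * (a * (δ * N)) = N := by rw [hl]; field_simp
    rw [h1, ← two_mul, mul_pow, mul_assoc, ← pow_add, Nat.add_sub_cancel' ham]
  refine freq_le_of_mean_le (G := fun S : Fin m → X => l ^ collisions rel a S) (c := l ^ b)
    (fun S => by positivity) (by positivity) (fun S hS => ?_) ?_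
  · exact pow_le_pow_right₀ hl1 (by omega)
  · refine hmean.trans ?_
    have h16 : (2 : ℝ) ^ a ≤ 16 ^ b := by
      calc (2 : ℝ) ^ a ≤ 2 ^ (4 * b) := pow_le_pow_right₀ (by norm_num) hab
        _ = 16 ^ b := by rw [pow_mul]; norm_num
    have hy : (16 * (a * δ)) ^ b ≤ 128 * δ := by
      obtain ⟨c, hc⟩ : ∃ c, b = c + 1 := ⟨b - 1, by omega⟩
      have h2 : (16 * (a * δ)) ^ c ≤ (1 / 2) ^ c :=
        pow_le_pow_left₀ (by positivity) (by linarith) c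
      have h3 : (c : ℝ) + 1 ≤ 2 ^ c := by
        have : c + 1 ≤ 2 ^ c := Nat.lt_two_pow_self
        exact_mod_cast this
      have h4 : (a : ℝ) ≤ 4 * (c + 1) := by
        have : a ≤ 4 * (c + 1) := by omega
        exact_mod_cast this
      have h5 : ((1 : ℝ) / 2) ^ c * 2 ^ c = 1 := by rw [← mul_pow]; norm_num
      have h6 : (0 : ℝ) ≤ (1 / 2) ^ c := by positivity
      rw [hc, pow_succ]
      calc (16 * (a * δ)) ^ c * (16 * (a * δ)) ≤ (1 / 2) ^ c * (16 * (a * δ)) :=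
            mul_le_mul_of_nonneg_right h2 (by positivity)
        _ ≤ (1 / 2) ^ c * (16 * ((4 * 2 ^ c) * δ)) := by
            gcongr
            linarith
        _ = 64 * δ * ((1 / 2) ^ c * 2 ^ c) := by ring
        _ ≤ _ := by rw [h5]; linarith
    calc (2 : ℝ) ^ a ≤ 16 ^ b := h16
      _ = l ^ b * (16 * (a * δ)) ^ b := by
          rw [← mul_pow]; congr 1; rw [hl]; field_simp
      _ ≤ _ := mul_le_mul_of_nonneg_left hy (by positivity)

end Collisions

/-! ### Counting scopes by the colors that an assignment gives them -/

section Counting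

variable {D : Type*} [Fintype D] [DecidableEq D] {r n : ℕ}

/-- The number of variables that the assignment `ψ` gives the value `e`. -/
def colorCount (ψ : Fin n → D) (e : D) : ℕ := (Finset.univ.filter fun v => ψ v = e).card

/-- The number of ordered `r`-subsets of the variables, weighted by `P`, that `ψ` satisfies. -/
noncomputable def total (P : ValuedRel D r) (ψ : Fin n → D) : ℕ :=
  ∑ S : Fin r ↪ Fin n, P fun j => ψ (S j)

/-- The average value of a random constraint under the assignment `ψ`. -/
noncomputable def density (P : ValuedRel D r) (ψ : Fin n → D) : ℝ :=
  mean fun S : Fin r ↪ Fin n => (P (fun j => ψ (S j)) : ℝ)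

theorem density_eq (P : ValuedRel D r) (ψ : Fin n → D) :
    density P ψ = (total P ψ : ℝ) / n.descFactorial r := by
  simp [density, mean, total, Fintype.card_embedding_eq]

theorem density_nonneg (P : ValuedRel D r) (ψ : Fin n → D) : 0 ≤ density P ψ :=
  mean_nonneg fun _ => Nat.cast_nonneg _

theorem sum_colorCount (ψ : Fin n → D) : ∑ e, colorCount ψ e = n := by
  have h := Finset.card_eq_sum_card_fiberwise (f := ψ) (s := Finset.univ)
      (t := Finset.univ) (fun _ _ => Finset.mem_coe.2 (Finset.mem_univ _))
  simpa [colorCount] using h.symm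

theorem colorCount_le (ψ : Fin n → D) (e : D) : colorCount ψ e ≤ n := by
  simpa [colorCount] using Finset.card_filter_le (Finset.univ : Finset (Fin n)) (fun v => ψ v = e)

theorem hist_comp_le (ψ : Fin n → D) (S : Fin r ↪ Fin n) (e : D) :
    (hist fun j => ψ (S j)).1 e ≤ colorCount ψ e := by
  simp only [hist, colorCount]
  refine Finset.card_le_card_of_injOn S ?_ S.injective.injOn
  intro i hi
  simpa using hi

theorem exists_majority [Nonempty D] (ψ : Fin n → D) :
    ∃ d, n ≤ Fintype.card D * colorCount ψ d := by
  by_contra! h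
  have h1 := sum_colorCount ψ
  have h2 : ∑ e : D, Fintype.card D * colorCount ψ e < ∑ _e : D, n :=
    Finset.sum_lt_sum_of_nonempty Finset.univ_nonempty fun e _ => h e
  rw [← Finset.mul_sum, h1, Finset.sum_const, Finset.card_univ, smul_eq_mul] at h2
  exact lt_irrefl _ h2

/-- A scope with color pattern `t` consists of one embedding for each color class. -/
def scopeEquiv (ψ : Fin n → D) (t : Fin r → D) :
    {S : Fin r ↪ Fin n // ∀ j, ψ (S j) = t j} ≃ ∀ e, ({i // t i = e} ↪ {v // ψ v = e}) where
  toFun S e := ⟨fun i => ⟨S.1 i.1, by rw [S.2, i.2]⟩, fun i j h => by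
    simpa [Subtype.ext_iff] using h⟩
  invFun f := ⟨⟨fun i => (f (t i) ⟨i, rfl⟩).1, fun i j h => by
      have key : ∀ e (hj : t j = e), (f (t j) ⟨j, rfl⟩).1 = (f e ⟨j, hj⟩).1 := by
        rintro _ rfl; rfl
      have e : t j = t i := by
        rw [← (f (t i) ⟨i, rfl⟩).2, ← (f (t j) ⟨j, rfl⟩).2]
        exact congrArg ψ h.symm
      have h' : (f (t i) ⟨i, rfl⟩).1 = (f (t i) ⟨j, e⟩).1 := h.trans (key _ e)
      have := (f (t i)).injective (Subtype.ext h')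
      simpa using this⟩, fun i => (f (t i) ⟨i, rfl⟩).2⟩
  left_inv S := by ext; rfl
  right_inv f := by
    funext e
    ext ⟨i, hi⟩
    subst hi
    rfl

theorem card_scopes (ψ : Fin n → D) (t : Fin r → D) :
    (Finset.univ.filter fun S : Fin r ↪ Fin n => (fun j => ψ (S j)) = t).card =
      ∏ e, (colorCount ψ e).descFactorial ((hist t).1 e) := by
  have h1 : (Finset.univ.filter fun S : Fin r ↪ Fin n => (fun j => ψ (S j)) = t).card =
      Fintype.card {S : Fin r ↪ Fin n // ∀ j, ψ (S j) = t j} := by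
    rw [Fintype.card_subtype]
    congr 1
    ext S
    simp [funext_iff]
  rw [h1, Fintype.card_congr (scopeEquiv ψ t), Fintype.card_pi]
  refine Finset.prod_congr rfl fun e _ => ?_
  rw [Fintype.card_embedding_eq, Fintype.card_subtype, Fintype.card_subtype]
  rfl

theorem total_eq_sum (P : ValuedRel D r) (ψ : Fin n → D) :
    total P ψ = ∑ t, P t * ∏ e, (colorCount ψ e).descFactorial ((hist t).1 e) := by
  rw [total, ← Finset.sum_fiberwise (Finset.univ : Finset (Fin r ↪ Fin n))
    (fun S => (fun j => ψ (S j) : Fin r → D))]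
  refine Finset.sum_congr rfl fun t _ => ?_
  rw [← card_scopes, mul_comm, ← smul_eq_mul, ← Finset.sum_const]
  refine Finset.sum_congr rfl fun S hS => ?_
  rw [(Finset.mem_filter.1 hS).2]

theorem pow_le_mul_descFactorial {c g : ℕ} (h : g ≤ c) : c ^ g ≤ g ^ g * c.descFactorial g := by
  rcases Nat.eq_zero_or_pos g with rfl | hg
  · simp
  obtain ⟨a, rfl⟩ := Nat.exists_eq_add_of_le h
  calc (g + a) ^ g ≤ (g * (g + a + 1 - g)) ^ g := by
        refine Nat.pow_le_pow_left ?_ g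
        rw [show g + a + 1 - g = a + 1 by omega]
        nlinarith
    _ = g ^ g * (g + a + 1 - g) ^ g := mul_pow _ _ _
    _ ≤ _ := Nat.mul_le_mul_left _ (Nat.pow_sub_le_descFactorial _ _)

theorem hist_le (h : Hist D r) (e : D) : h.1 e ≤ r := by
  have := Finset.single_le_sum (f := h.1) (fun _ _ => Nat.zero_le _) (Finset.mem_univ e)
  rwa [h.2] at this

/-- A histogram in the support that fits into the color classes of `ψ` bounds `total P ψ` from
below. -/
theorem prod_pow_le_total (P : ValuedRel D r) (ψ : Fin n → D) {t : Fin r → D} (ht : P t ≠ 0)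
    (hc : ∀ e, (hist t).1 e ≤ colorCount ψ e) :
    ∏ e, colorCount ψ e ^ (hist t).1 e ≤ r ^ r * total P ψ := by
  calc ∏ e, colorCount ψ e ^ (hist t).1 e
      ≤ ∏ e, r ^ (hist t).1 e * (colorCount ψ e).descFactorial ((hist t).1 e) := by
        refine Finset.prod_le_prod' fun e _ => (pow_le_mul_descFactorial (hc e)).trans ?_
        exact Nat.mul_le_mul_right _ (Nat.pow_le_pow_left (hist_le _ e) _)
    _ = r ^ r * (1 * ∏ e, (colorCount ψ e).descFactorial ((hist t).1 e)) := by
        rw [Finset.prod_mul_distrib, Finset.prod_pow_eq_pow_sum, (hist t).2, one_mul]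
    _ ≤ r ^ r * total P ψ := by
        refine Nat.mul_le_mul_left _ ?_
        rw [total_eq_sum]
        refine le_trans (Nat.mul_le_mul_right _ (Nat.one_le_iff_ne_zero.2 ht)) ?_
        exact Finset.single_le_sum
          (f := fun t => P t * ∏ e, (colorCount ψ e).descFactorial ((hist t).1 e))
          (fun _ _ => Nat.zero_le _) (Finset.mem_univ t)

/-- The version of `prod_pow_le_total` in which one color `d` is a majority color. -/
theorem majority_pow_mul_le_total (P : ValuedRel D r) (ψ : Fin n → D) {d : D}
    (hd : n ≤ Fintype.card D * colorCount ψ d) {t : Fin r → D} (ht : P t ≠ 0)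
    (hc : ∀ e, (hist t).1 e ≤ colorCount ψ e) :
    n ^ (hist t).1 d * ∏ e ∈ Finset.univ.erase d, colorCount ψ e ^ (hist t).1 e ≤
      (Fintype.card D * r) ^ r * total P ψ := by
  have hD : 0 < Fintype.card D := Fintype.card_pos_iff.2 ⟨d⟩
  calc n ^ (hist t).1 d * ∏ e ∈ Finset.univ.erase d, colorCount ψ e ^ (hist t).1 e
      ≤ (Fintype.card D ^ r * colorCount ψ d ^ (hist t).1 d) *
          ∏ e ∈ Finset.univ.erase d, colorCount ψ e ^ (hist t).1 e := by
        refine Nat.mul_le_mul_right _ ((Nat.pow_le_pow_left hd _).trans ?_)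
        rw [mul_pow]
        exact Nat.mul_le_mul_right _ (Nat.pow_le_pow_right hD (hist_le _ d))
    _ = Fintype.card D ^ r * ∏ e, colorCount ψ e ^ (hist t).1 e := by
        rw [mul_assoc, Finset.mul_prod_erase Finset.univ
          (fun e => colorCount ψ e ^ (hist t).1 e) (Finset.mem_univ d)]
    _ ≤ Fintype.card D ^ r * (r ^ r * total P ψ) :=
        Nat.mul_le_mul_left _ (prod_pow_le_total P ψ ht hc)
    _ = _ := by rw [mul_pow, mul_assoc]

end Counting

/-! ### Histograms and symmetrizations -/

section Symmetrization

variable {D : Type*} [Fintype D] [DecidableEq D] {r : ℕ}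

theorem card_fiber_eq_hist (t : Fin r → D) (d : D) :
    Fintype.card {i // t i = d} = (hist t).1 d := by
  rw [Fintype.card_subtype]; rfl

theorem exists_hist_eq (h : Hist D r) : ∃ t : Fin r → D, hist t = h := by
  have hcard : Fintype.card (Fin r) = Fintype.card (Σ d, Fin (h.1 d)) := by
    simp [h.2]
  let e := Fintype.equivOfCardEq hcard
  refine ⟨fun i => (e i).1, Subtype.ext (funext fun d => ?_)⟩
  rw [← card_fiber_eq_hist, ← Fintype.card_fin (h.1 d)]
  refine Fintype.card_congr ((e.subtypeEquiv (q := fun x => x.1 = d) fun i => Iff.rfl).trans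
    (Equiv.sigmaSubtype d))

theorem exists_perm_of_hist_eq {t u : Fin r → D} (h : hist u = hist t) :
    ∃ τ : Equiv.Perm (Fin r), t ∘ τ = u := by
  have hc : ∀ d, Nonempty ({i // u i = d} ≃ {i // t i = d}) := fun d => by
    rw [← Fintype.card_eq, card_fiber_eq_hist, card_fiber_eq_hist, h]
  exact ⟨Equiv.ofFiberEquiv fun d => (hc d).some, funext fun i => Equiv.ofFiberEquiv_map _ i⟩

theorem hist_comp_perm (t : Fin r → D) (σ : Equiv.Perm (Fin r)) : hist (t ∘ σ) = hist t := by
  refine Subtype.ext (funext fun d => ?_)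
  rw [← card_fiber_eq_hist, ← card_fiber_eq_hist]
  exact Fintype.card_congr (σ.subtypeEquiv fun i => Iff.rfl)

open Classical in
theorem card_perm_comp_eq (t u : Fin r → D) :
    (Finset.univ.filter fun σ : Equiv.Perm (Fin r) => t ∘ σ = u).card =
      if hist u = hist t then ∏ d, ((hist t).1 d)! else 0 := by
  split_ifs with h
  · obtain ⟨τ, rfl⟩ := exists_perm_of_hist_eq h
    have h1 := DomMulAct.stabilizer_card t
    simp only [card_fiber_eq_hist] at h1
    rw [← h1, Fintype.card_subtype]
    refine Finset.card_bij' (fun σ _ => σ * τ⁻¹) (fun σ _ => σ * τ) ?_ ?_ ?_ ?_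
    · intro σ hσ
      simp only [Finset.mem_filter, Finset.mem_univ, true_and] at hσ ⊢
      rw [Equiv.Perm.coe_mul, ← Function.comp_assoc, hσ, Function.comp_assoc,
        ← Equiv.Perm.coe_mul, mul_inv_cancel]
      rfl
    · intro σ hσ
      simp only [Finset.mem_filter, Finset.mem_univ, true_and] at hσ ⊢
      rw [Equiv.Perm.coe_mul, ← Function.comp_assoc, hσ]
    · intro σ _; simp
    · intro σ _; simp
  · rw [Finset.card_eq_zero, Finset.filter_eq_empty_iff]
    rintro σ - rfl
    exact h (hist_comp_perm t σ)

/-- The symmetrization sums the relation over all orders of a tuple. -/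
theorem sum_perm_eq_sym (R : ValuedRel D r) (t : Fin r → D) :
    ∑ σ : Equiv.Perm (Fin r), R (t ∘ σ) = R.Sym (hist t) := by
  classical
  rw [← Finset.sum_fiberwise (Finset.univ : Finset (Equiv.Perm (Fin r))) (fun σ => t ∘ σ)]
  have : ∀ u : Fin r → D,
      ∑ σ ∈ Finset.univ.filter (fun σ : Equiv.Perm (Fin r) => t ∘ σ = u), R (t ∘ σ) =
      if hist u = hist t then (∏ d, ((hist t).1 d)!) * R u else 0 := fun u => by
    rw [Finset.sum_congr rfl (g := fun _ => R u) fun σ hσ => by rw [(Finset.mem_filter.1 hσ).2],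
      Finset.sum_const, card_perm_comp_eq]
    split_ifs <;> simp
  simp only [this]
  rw [← Finset.sum_filter, ← Finset.mul_sum, ValuedRel.Sym]

/-- The valued relation `P` has the symmetric valued relation `S` as its support, up to reordering
of tuples. -/
def HasSupport (P : ValuedRel D r) (S : SVR D r) : Prop :=
  ∀ h, S h ≠ 0 ↔ ∃ t, hist t = h ∧ P t ≠ 0

theorem hasSupport_sym (R : ValuedRel D r) : HasSupport R R.Sym := by
  intro h
  have h0 : ∏ d, (h.1 d)! ≠ 0 := Finset.prod_ne_zero_iff.2 fun d _ => Nat.factorial_ne_zero _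
  simp [ValuedRel.Sym, h0, Finset.sum_eq_zero_iff]

theorem hasSupport_comp_hist (S : SVR D r) : HasSupport (fun t => S (hist t)) S := by
  intro h
  refine ⟨fun hS => ?_, ?_⟩
  · obtain ⟨t, rfl⟩ := exists_hist_eq h
    exact ⟨t, rfl, hS⟩
  · rintro ⟨t, rfl, ht⟩
    exact ht

/-- Marginal uniformity of the valued relation `P`, where tightness and rigidity refer to the
symmetric valued relation `S`. -/
def TupleUniform (P : ValuedRel D r) (S : SVR D r) (k : ℕ) : Prop :=
  ∀ (d : D) (E : Finset D) (h : Hist D r), S.Tight d k h → S.Rigid d E h →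
    ∀ s t : Fin r → D, hist s = h → TupleEquiv E s t → P s = P t

theorem TupleEquiv.hist_eq {E : Finset D} {s t : Fin r → D} (h : TupleEquiv E s t) {e : D}
    (he : e ∉ E) : (hist t).1 e = (hist s).1 e := by
  simp only [hist]
  congr 1
  ext i
  simp only [Finset.mem_filter, Finset.mem_univ, true_and]
  rcases h i with ⟨h1, h2⟩ | h
  · exact ⟨fun h => absurd (h ▸ h2) he, fun h => absurd (h ▸ h1) he⟩
  · rw [h]

theorem hist_sum_add_compl (h : Hist D r) (E : Finset D) :
    ∑ e ∈ E, h.1 e + ∑ e ∈ Eᶜ, h.1 e = r := by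
  rw [Finset.sum_add_sum_compl, h.2]

theorem exists_glue_eq {k : ℕ} {E : Finset D} {h H : Hist D r} (hE : ∑ e ∈ E, h.1 e = k)
    (hH : ∀ e, e ∉ E → H.1 e = h.1 e) : ∃ g : Hist E k, glue E h hE g = H := by
  have h1 := hist_sum_add_compl h E
  have h2 := hist_sum_add_compl H E
  have h3 : ∑ e ∈ Eᶜ, H.1 e = ∑ e ∈ Eᶜ, h.1 e :=
    Finset.sum_congr rfl fun e he => hH e (Finset.mem_compl.1 he)
  refine ⟨⟨fun e => H.1 e, ?_⟩, Subtype.ext (funext fun e => ?_)⟩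
  · rw [Finset.sum_coe_sort E (fun e => H.1 e)]; omega
  · by_cases he : e ∈ E
    · simp [glue, he]
    · simp [glue, he, hH e he]

theorem glue_apply_of_notMem {k : ℕ} {E : Finset D} {h : Hist D r} (hE : ∑ e ∈ E, h.1 e = k)
    (g : Hist E k) {e : D} (he : e ∉ E) : (glue E h hE g).1 e = h.1 e := by
  simp [glue, he]

/-- Marginal uniformity of a symmetric valued relation, without `glue`. -/
theorem marginallyUniform_iff (S : SVR D r) (k : ℕ) :
    S.MarginallyUniform k ↔ ∀ (d : D) (h : Hist D r) (E : Finset D), S.Tight d k h →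
      S.Rigid d E h → ∀ H : Hist D r, (∀ e, e ∉ E → H.1 e = h.1 e) → S H = S h := by
  refine ⟨fun hS d h E ht hr H hH => ?_, fun hS d h E ht hr g g' => ?_⟩
  · obtain ⟨g, rfl⟩ := exists_glue_eq (hr.sum_eq.trans ht.2.2) hH
    obtain ⟨g', hg'⟩ := exists_glue_eq (H := h) (hr.sum_eq.trans ht.2.2) fun _ _ => rfl
    have := hS d h E ht hr g g'
    simp only [SVR.marginal, hg'] at this
    exact this
  · simp only [SVR.marginal]
    rw [hS d h E ht hr _ fun e he => glue_apply_of_notMem _ g he,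
      hS d h E ht hr _ fun e he => glue_apply_of_notMem _ g' he]

theorem tupleUniform_comp_hist {S : SVR D r} {k : ℕ} (hS : S.MarginallyUniform k) :
    TupleUniform (fun t => S (hist t)) S k := by
  rw [marginallyUniform_iff] at hS
  rintro d E h ht hr s t rfl hst
  exact (hS d _ E ht hr _ fun e he => hst.hist_eq he).symm

/-- A marginally uniform relation has a marginally uniform symmetrization: a histogram `H` that
agrees with `h` off `E` can be realized by recoloring the `E`-valued entries of a tuple. -/
theorem sym_marginallyUniform {R : ValuedRel D r} {k : ℕ} (hR : R.MarginallyUniform k) :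
    R.Sym.MarginallyUniform k := by
  rw [marginallyUniform_iff]
  intro d h E ht hr H hH
  obtain ⟨s, rfl⟩ := exists_hist_eq h
  obtain ⟨t, rfl⟩ := exists_hist_eq H
  have hc : ∀ o : Option {e // e ∉ E},
      Nonempty ({i // (if hi : t i ∈ E then none else some ⟨t i, hi⟩) = o} ≃
        {i // (if hi : s i ∈ E then none else some (⟨s i, hi⟩ : {e // e ∉ E})) = o}) := by
    have hcard : ∀ u : Fin r → D, ∀ e : {e // e ∉ E},
        Fintype.card {i // (if hi : u i ∈ E then none else some (⟨u i, hi⟩ : {e // e ∉ E})) =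
          some e} = (hist u).1 e := by
      intro u e
      rw [← card_fiber_eq_hist]
      refine Fintype.card_congr (Equiv.subtypeEquivRight fun i => ?_)
      split_ifs with hi
      · simp only [false_iff]
        exact fun h => e.2 (h ▸ hi)
      · simp [Subtype.ext_iff]
    have hcard0 : ∀ u : Fin r → D,
        Fintype.card {i // (if hi : u i ∈ E then none else some (⟨u i, hi⟩ : {e // e ∉ E})) =
          none} = ∑ e ∈ E, (hist u).1 e := by
      intro u
      rw [Fintype.card_subtype]
      have : (Finset.univ.filter fun i =>
          (if hi : u i ∈ E then none else some (⟨u i, hi⟩ : {e // e ∉ E})) = none) =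
          Finset.univ.filter fun i => u i ∈ E := by
        ext i; by_cases hi : u i ∈ E <;> simp [hi]
      rw [this, Finset.card_eq_sum_card_fiberwise (f := u) (t := E) (fun i hi => by simpa using hi)]
      refine Finset.sum_congr rfl fun e he => ?_
      simp only [hist]
      congr 1
      ext i
      simp only [Finset.mem_filter, Finset.mem_univ, true_and, and_iff_right_iff_imp]
      rintro rfl
      exact he
    intro o
    rw [← Fintype.card_eq]
    cases o with
    | none =>
      rw [hcard0, hcard0]
      have h1 := hist_sum_add_compl (hist s) E
      have h2 := hist_sum_add_compl (hist t) E
      have h3 : ∑ e ∈ Eᶜ, (hist t).1 e = ∑ e ∈ Eᶜ, (hist s).1 e :=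
        Finset.sum_congr rfl fun e he => hH e (Finset.mem_compl.1 he)
      omega
    | some e => rw [hcard, hcard]; exact hH e e.2
  let off : (Fin r → D) → Fin r → Option {e // e ∉ E} := fun u i =>
    if hi : u i ∈ E then none else some ⟨u i, hi⟩
  let τ : Equiv.Perm (Fin r) := Equiv.ofFiberEquiv (f := off t) (g := off s) fun o => (hc o).some
  have hτ : ∀ i, off s (τ i) = off t i := fun i => Equiv.ofFiberEquiv_map _ i
  have hτ' : TupleEquiv E (s ∘ τ) t := by
    intro i
    have := hτ i
    simp only [off] at this
    by_cases h1 : s (τ i) ∈ E <;> by_cases h2 : t i ∈ E <;> simp [h1, h2] at this ⊢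
    exact this
  rw [← sum_perm_eq_sym, ← hist_comp_perm s τ, ← sum_perm_eq_sym]
  refine Finset.sum_congr rfl fun σ _ => ?_
  refine (hR d E (hist s) ht hr _ _ ?_ fun i => ?_).symm
  · rw [hist_comp_perm, hist_comp_perm]
  · exact hτ' (σ i)

/-- A histogram in the support that violates `(k+1)`-plentifulness can be improved to a tight
one. -/
theorem exists_tight {S : SVR D r} {k : ℕ} (hS : S.PreciselyPlentiful k) :
    ∃ d h, S.Tight d k h := by
  obtain ⟨hk, hk1⟩ := hS
  simp only [SVR.Plentiful, not_forall, not_exists, not_and, not_le] at hk1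
  obtain ⟨d, h, hh, hmax⟩ := hk1
  obtain ⟨g, hg, hgh, hgd⟩ := hk d h hh
  have hgk : g.1 d = k := le_antisymm (Nat.lt_succ_iff.1 (hmax g hg hgh)) hgd
  refine ⟨d, g, hg, fun g' hg' hle => ?_, hgk⟩
  have h1 := hmax g' hg' fun e he => (hle e he).trans (hgh e he)
  have h2 : ∑ e ∈ Finset.univ.erase d, g'.1 e ≤ ∑ e ∈ Finset.univ.erase d, g.1 e :=
    Finset.sum_le_sum fun e he => hle e (Finset.ne_of_mem_erase he)
  have h3 := Finset.add_sum_erase Finset.univ g'.1 (Finset.mem_univ d)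
  have h4 := Finset.add_sum_erase Finset.univ g.1 (Finset.mem_univ d)
  rw [g'.2] at h3
  rw [g.2] at h4
  have h5 : ∑ e ∈ Finset.univ.erase d, g'.1 e = ∑ e ∈ Finset.univ.erase d, g.1 e := by omega
  have h6 := (Finset.sum_eq_sum_iff_of_le fun e he => hle e (Finset.ne_of_mem_erase he)).1 h5
  refine Subtype.ext (funext fun e => ?_)
  by_cases he : e = d
  · subst he; omega
  · exact h6 e (Finset.mem_erase.2 ⟨he, Finset.mem_univ e⟩)

theorem SVR.PreciselyPlentiful.le {S : SVR D r} {k : ℕ} (hS : S.PreciselyPlentiful k) : k ≤ r := by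
  obtain ⟨d, h, ht⟩ := exists_tight hS
  rw [← ht.2.2]
  exact hist_le h d

theorem SVR.Tight.rigid_singleton {S : SVR D r} {d : D} {k : ℕ} {h : Hist D r}
    (ht : S.Tight d k h) : S.Rigid d {d} h := by
  refine ⟨ht.1, Finset.mem_singleton_self d, fun e he hne => absurd (Finset.mem_singleton.1 he) hne,
    fun g hg hle => ?_⟩
  rw [Finset.sum_singleton, ht.2.1 g hg fun e he => hle e (by simpa using he)]

end Symmetrization

/-! ### Approximation by the complete instance -/

section Approximation

variable {D : Type*} [Fintype D] [DecidableEq D] {r n : ℕ}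

/-- Up to a factor `1 ± ε`, the instance `C` has on every assignment the value of the complete
instance with total weight `w`. -/
def Approximates (P : ValuedRel D r) (ε w : ℝ) (C : Instance r n) : Prop :=
  ∀ ψ : Fin n → D, |sat P C ψ - w * density P ψ| ≤ ε * (w * density P ψ)

theorem isSparsifier_of_approximates {P : ValuedRel D r} {ε w : ℝ} {C C' : Instance r n}
    (hε : 0 < ε) (hε1 : ε ≤ 1) (hw : 0 ≤ w) (hC : Approximates P (ε / 3) w C)
    (hC' : Approximates P (ε / 3) w C') : IsSparsifier P ε C C' := by
  intro ψ
  have h0 : 0 ≤ w * density P ψ := mul_nonneg hw (density_nonneg P ψ)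
  obtain ⟨h1, h2⟩ := abs_le.1 (hC ψ)
  obtain ⟨h3, h4⟩ := abs_le.1 (hC' ψ)
  set y := w * density P ψ
  have h5 : 0 ≤ ε * y := by positivity
  have h6 : ε * (ε * y) ≤ ε * y := mul_le_of_le_one_left h5 hε1
  constructor <;> nlinarith

/-- The instance `C` with all weights multiplied by `a`. -/
def Instance.scale (C : Instance r n) (a : ℝ) (ha : 0 ≤ a) : Instance r n where
  size := C.size
  scope := C.scope
  weight := fun i => a * C.weight i
  weight_nonneg := fun i => mul_nonneg ha (C.weight_nonneg i)

theorem sat_scale (P : ValuedRel D r) (C : Instance r n) {a : ℝ} (ha : 0 ≤ a) (ψ : Fin n → D) :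
    sat P (C.scale a ha) ψ = a * sat P C ψ := by
  simp only [sat, Instance.scale, Finset.mul_sum, mul_assoc]
  rfl

theorem Approximates.scale {P : ValuedRel D r} {ε w : ℝ} {C : Instance r n}
    (h : Approximates P ε w C) {a : ℝ} (ha : 0 ≤ a) :
    Approximates P ε (a * w) (C.scale a ha) := by
  intro ψ
  rw [sat_scale, mul_assoc, ← mul_sub, abs_mul, abs_of_nonneg ha, mul_left_comm]
  exact mul_le_mul_of_nonneg_left (h ψ) ha

theorem sat_ofScopes (P : ValuedRel D r) {m : ℕ} (S : Fin m → (Fin r ↪ Fin n)) (ψ : Fin n → D) :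
    sat P (Instance.ofScopes S) ψ = ∑ i, (P (fun j => ψ (S i j)) : ℝ) := by
  simp only [sat, Instance.ofScopes, one_mul]
  rfl

theorem exists_ne_zero_of_density_ne_zero {P : ValuedRel D r} {ψ : Fin n → D}
    (h : density P ψ ≠ 0) : ∃ S : Fin r ↪ Fin n, P (fun j => ψ (S j)) ≠ 0 := by
  by_contra! h0
  exact h (by simp [density, mean, h0])

theorem sat_ofScopes_of_density_eq_zero {P : ValuedRel D r} {ψ : Fin n → D} (hrn : r ≤ n)
    (h : density P ψ = 0) {m : ℕ} (S : Fin m → (Fin r ↪ Fin n)) :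
    sat P (Instance.ofScopes S) ψ = 0 := by
  rw [density_eq, div_eq_zero_iff] at h
  have h1 : total P ψ = 0 := by
    rcases h with h | h
    · exact_mod_cast h
    · exact absurd (by exact_mod_cast h) (Nat.descFactorial_pos.2 hrn).ne'
  rw [total, Finset.sum_eq_zero_iff] at h1
  rw [sat_ofScopes]
  exact Finset.sum_eq_zero fun i _ => by rw [h1 _ (Finset.mem_univ _), Nat.cast_zero]

/-- An upper bound for the values of `P`. -/
noncomputable def valueBound (P : ValuedRel D r) : ℝ := 1 + ∑ t, (P t : ℝ)

theorem one_le_valueBound (P : ValuedRel D r) : 1 ≤ valueBound P := by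
  have : (0 : ℝ) ≤ ∑ t, (P t : ℝ) := Finset.sum_nonneg fun _ _ => Nat.cast_nonneg _
  rw [valueBound]; linarith

theorem le_valueBound (P : ValuedRel D r) (t : Fin r → D) : (P t : ℝ) ≤ valueBound P := by
  have := Finset.single_le_sum (f := fun t => (P t : ℝ)) (fun _ _ => Nat.cast_nonneg _)
    (Finset.mem_univ t)
  rw [valueBound]; linarith

theorem total_le_density_mul (P : ValuedRel D r) (ψ : Fin n → D) (hrn : r ≤ n) :
    (total P ψ : ℝ) ≤ density P ψ * n ^ r := by
  have h : (0 : ℝ) < n.descFactorial r := by exact_mod_cast Nat.descFactorial_pos.2 hrn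
  have h2 : (n.descFactorial r : ℝ) ≤ n ^ r := by exact_mod_cast Nat.descFactorial_le_pow n r
  calc (total P ψ : ℝ) = density P ψ * n.descFactorial r := by
        rw [density_eq]; field_simp
    _ ≤ _ := mul_le_mul_of_nonneg_left h2 (density_nonneg P ψ)

/-- The constant in the lower bounds for nonzero densities. -/
def supportConst (D : Type*) [Fintype D] (r : ℕ) : ℕ := (Fintype.card D * r) ^ r

theorem one_le_supportConst [Nonempty D] : 1 ≤ supportConst D r := by
  rcases Nat.eq_zero_or_pos r with rfl | hr
  · simp [supportConst]
  · exact Nat.one_le_pow _ _ (Nat.mul_pos Fintype.card_pos hr)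

/-- A histogram in the support that fits into the color classes of `ψ`, except possibly for the
majority color `d`, bounds the density of `ψ` from below. -/
theorem pow_mul_prod_le {P : ValuedRel D r} {S : SVR D r} (hPS : HasSupport P S)
    {ψ : Fin n → D} {d : D} (hn : Fintype.card D * r ≤ n)
    (hd : n ≤ Fintype.card D * colorCount ψ d) {g : Hist D r} (hg : g ∈ S.supp)
    (hle : ∀ e, e ≠ d → g.1 e ≤ colorCount ψ e) :
    n ^ g.1 d * ∏ e ∈ Finset.univ.erase d, colorCount ψ e ^ g.1 e ≤
      supportConst D r * total P ψ := by
  obtain ⟨t, rfl, ht⟩ := (hPS g).1 hg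
  refine majority_pow_mul_le_total P ψ hd ht fun e => ?_
  by_cases he : e = d
  · subst he
    exact (hist_le _ _).trans
      (Nat.le_of_mul_le_mul_left (hn.trans hd) (Fintype.card_pos_iff.2 ⟨e⟩))
  · exact hle e he

theorem card_mul_le_imp {D : Type*} [Fintype D] [Nonempty D] {r n : ℕ}
    (hn : Fintype.card D * r ≤ n) : r ≤ n :=
  (Nat.le_mul_of_pos_left r Fintype.card_pos).trans hn

theorem one_le_prod_pow {ψ : Fin n → D} {g : Hist D r} {s : Finset D}
    (hle : ∀ e ∈ s, g.1 e ≤ colorCount ψ e) : 1 ≤ ∏ e ∈ s, colorCount ψ e ^ g.1 e := by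
  refine Nat.one_le_iff_ne_zero.2 (Finset.prod_ne_zero_iff.2 fun e he => ?_)
  have := hle e he
  rcases Nat.eq_zero_or_pos (g.1 e) with h | h
  · simp [h]
  · exact pow_ne_zero _ (by omega)

/-- For a `k`-plentiful relation, nonzero densities have order at least `n ^ (k - r)`. -/
theorem one_le_density_mul [Nonempty D] {P : ValuedRel D r} {S : SVR D r} {k : ℕ}
    (hPS : HasSupport P S) (hk : S.Plentiful k) (hkr : k ≤ r) {ψ : Fin n → D}
    (hn : Fintype.card D * r ≤ n) (hn0 : 0 < n) (h0 : density P ψ ≠ 0) :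
    1 ≤ supportConst D r * density P ψ * n ^ (r - k) := by
  obtain ⟨d, hd⟩ := exists_majority ψ
  obtain ⟨T, hT⟩ := exists_ne_zero_of_density_ne_zero h0
  obtain ⟨g, hg, hgle, hgd⟩ := hk d (hist fun j => ψ (T j)) ((hPS _).2 ⟨_, rfl, hT⟩)
  have hle : ∀ e, e ≠ d → g.1 e ≤ colorCount ψ e := fun e he =>
    (hgle e he).trans (hist_comp_le ψ T e)
  have h1 := pow_mul_prod_le hPS hn hd hg hle
  have h2 : n ^ k ≤ supportConst D r * total P ψ :=
    calc n ^ k ≤ n ^ g.1 d := Nat.pow_le_pow_right hn0 hgd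
      _ ≤ n ^ g.1 d * ∏ e ∈ Finset.univ.erase d, colorCount ψ e ^ g.1 e :=
        Nat.le_mul_of_pos_right _ (one_le_prod_pow fun e he => hle e (Finset.ne_of_mem_erase he))
      _ ≤ _ := h1
  have h3 : (n : ℝ) ^ k ≤ supportConst D r * total P ψ := by exact_mod_cast h2
  have h4 := total_le_density_mul P ψ (card_mul_le_imp hn)
  have h5 : (0 : ℝ) < (n : ℝ) ^ k := by positivity
  have h6 : (n : ℝ) ^ r = n ^ (r - k) * n ^ k := by rw [← pow_add, Nat.sub_add_cancel hkr]
  refine le_of_mul_le_mul_right ?_ h5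
  calc 1 * (n : ℝ) ^ k ≤ supportConst D r * total P ψ := by rw [one_mul]; exact h3
    _ ≤ supportConst D r * (density P ψ * n ^ r) :=
      mul_le_mul_of_nonneg_left h4 (Nat.cast_nonneg _)
    _ = _ := by rw [h6]; ring

theorem nonempty_scopes (hrn : r ≤ n) : Nonempty (Fin r ↪ Fin n) :=
  ⟨Fin.castLEEmb hrn⟩

/-- Concentration of the value of a single assignment. -/
theorem freq_sat_sub_gt_le (P : ValuedRel D r) (ψ : Fin n → D) (hrn : r ≤ n) {B w η : ℝ}
    (hB : 0 < B) (hP : ∀ t, (P t : ℝ) ≤ B) (hw : density P ψ ≤ w) (hη : 0 ≤ η) (hη1 : η ≤ 1)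
    (m : ℕ) :
    freq (fun S : Fin m → (Fin r ↪ Fin n) =>
        η * (m * w) < |sat P (Instance.ofScopes S) ψ - m * density P ψ|) ≤
      2 * Real.exp (-(η ^ 2 * (m * w) / (4 * B))) := by
  have := nonempty_scopes hrn
  have h := freq_abs_sum_sub_gt_le (F := fun S : Fin r ↪ Fin n => (P (fun j => ψ (S j)) : ℝ)) hB
    (fun _ => Nat.cast_nonneg _) (fun _ => hP _) hw hη hη1 m
  simpa only [sat_ofScopes, density] using h

/-- The union bound over a set of assignments of not too small density. -/
theorem freq_exists_sat_sub_gt_le [Nonempty D] (P : ValuedRel D r) (hrn : r ≤ n) {ε : ℝ}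
    (hε : 0 < ε) (hε1 : ε ≤ 1) {m : ℕ} (Q : (Fin n → D) → Prop)
    (hQ : ∀ ψ, Q ψ →
      n * (1 + Real.log (Fintype.card D)) ≤ ε ^ 2 * (m * density P ψ) / (4 * valueBound P)) :
    freq (fun S : Fin m → (Fin r ↪ Fin n) => ∃ ψ, Q ψ ∧
      ε * (m * density P ψ) < |sat P (Instance.ofScopes S) ψ - m * density P ψ|) ≤
      2 * Real.exp (-n) := by
  classical
  have hD : (0 : ℝ) < Fintype.card D := by exact_mod_cast Fintype.card_pos
  have hB : 0 < valueBound P := by linarith [one_le_valueBound P]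
  refine (freq_le_sum (Finset.univ.filter Q) (q := fun ψ S =>
    ε * (m * density P ψ) < |sat P (Instance.ofScopes S) ψ - m * density P ψ|)
    fun S ⟨ψ, hψ, h⟩ => ⟨ψ, by simpa using hψ, h⟩).trans ?_
  calc _ ≤ ∑ ψ ∈ Finset.univ.filter Q, 2 * Real.exp (-(n * (1 + Real.log (Fintype.card D)))) := by
        refine Finset.sum_le_sum fun ψ hψ => ?_
        refine (freq_sat_sub_gt_le P ψ hrn hB (le_valueBound P) le_rfl hε.le hε1 m).trans ?_
        have := hQ ψ (Finset.mem_filter.1 hψ).2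
        gcongr
    _ ≤ ∑ ψ : Fin n → D, 2 * Real.exp (-(n * (1 + Real.log (Fintype.card D)))) :=
        Finset.sum_le_sum_of_subset_of_nonneg (Finset.filter_subset _ _)
          fun _ _ _ => by positivity
    _ = 2 * Real.exp (-n) := by
        rw [Finset.sum_const, Finset.card_univ, Fintype.card_fun, Fintype.card_fin, nsmul_eq_mul,
          mul_add, mul_one, neg_add, Real.exp_add, ← mul_neg, mul_comm (n : ℝ) (-_),
          Real.exp_mul, Real.exp_neg (Real.log _), Real.exp_log hD, Real.rpow_natCast]
        push_cast
        rw [inv_pow]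
        field_simp

/-- For a `k`-plentiful relation, a random instance with sufficiently many times
`n ^ (r - k + 1) / ε ^ 2` constraints approximates the complete instance: every nonzero density is
at least of order `n ^ (k - r)`, which allows a union bound over all assignments. -/
theorem exists_freq_not_approximates_le [Nonempty D] {P : ValuedRel D r} {S : SVR D r} {k : ℕ}
    (hPS : HasSupport P S) (hk : S.Plentiful k) (hkr : k ≤ r) :
    ∃ K : ℝ, 1 ≤ K ∧ ∃ N : ℕ, ∀ n : ℕ, N ≤ n → ∀ (m : ℕ) (ε : ℝ), 0 < ε → ε ≤ 1 →
      K * (n : ℝ) ^ (r - k + 1) / ε ^ 2 ≤ m →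
      freq (fun T : Fin m → (Fin r ↪ Fin n) => ¬ Approximates P ε m (Instance.ofScopes T)) ≤
        2 * Real.exp (-n) := by
  have hB := one_le_valueBound P
  have hL : (1 : ℝ) ≤ supportConst D r := by exact_mod_cast one_le_supportConst
  have hD : (1 : ℝ) ≤ Fintype.card D := by exact_mod_cast Fintype.card_pos
  have hlog : 0 ≤ Real.log (Fintype.card D) := Real.log_nonneg hD
  set B := valueBound P
  set L : ℝ := (supportConst D r : ℝ) with hLdef
  set l := Real.log (Fintype.card D)
  refine ⟨4 * B * L * (1 + l), ?_, Fintype.card D * r + 1, fun n hn m ε hε hε1 hm => ?_⟩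
  · have h1 : 1 ≤ B * L := one_le_mul_of_one_le_of_one_le hB hL
    have h2 : 1 ≤ B * L * (1 + l) := one_le_mul_of_one_le_of_one_le h1 (by linarith)
    linarith
  have hn' : Fintype.card D * r ≤ n := by omega
  have hn0 : 0 < n := by omega
  have hrn := card_mul_le_imp hn'
  refine (freq_mono fun T hT => ?_).trans
    (freq_exists_sat_sub_gt_le P hrn hε hε1 (m := m) (fun ψ => density P ψ ≠ 0) fun ψ hψ => ?_)
  · simp only [Approximates, not_forall, not_le] at hT
    obtain ⟨ψ, hψ⟩ := hT
    refine ⟨ψ, fun h0 => ?_, hψ⟩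
    rw [sat_ofScopes_of_density_eq_zero hrn h0, h0] at hψ
    simp at hψ
  · have h1 := one_le_density_mul hPS hk hkr hn' hn0 hψ
    rw [div_le_iff₀ (by positivity)] at hm
    rw [le_div_iff₀ (by positivity)]
    have hd := density_nonneg P ψ
    have hnp : (0 : ℝ) < (n : ℝ) ^ (r - k) := by positivity
    calc n * (1 + l) * (4 * B) = (n * (1 + l) * (4 * B)) * 1 := (mul_one _).symm
      _ ≤ (n * (1 + l) * (4 * B)) * (L * density P ψ * n ^ (r - k)) := by gcongr
      _ = (4 * B * L * (1 + l) * n ^ (r - k + 1)) * density P ψ := by ring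
      _ ≤ (m * ε ^ 2) * density P ψ := by gcongr
      _ = _ := by ring

end Approximation

/-! ### Assignments of small density for marginally uniform relations -/

section Small

variable {D : Type*} [Fintype D] [DecidableEq D] {r n : ℕ}

/-- The number of entries of a tuple that lie in `E`. -/
def inCount (E : Finset D) (t : Fin r → D) : ℕ := ∑ e ∈ E, (hist t).1 e

/-- The assignment `ψ` with all colors in `E` replaced by `d`. -/
def collapse (E : Finset D) (d : D) (ψ : Fin n → D) : Fin n → D :=
  fun v => if ψ v ∈ E then d else ψ v

/-- The part of `P` on the tuples with exactly `k` entries in `E`. -/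
def mainPart (P : ValuedRel D r) (E : Finset D) (k : ℕ) : ValuedRel D r :=
  fun t => if inCount E t = k then P t else 0

open Classical in
/-- The indicator of the tuples with less than `k` entries in `E` that can be brought into the
support of `P` by changing their entries within `E`. -/
noncomputable def minorPart (P : ValuedRel D r) (E : Finset D) (k : ℕ) : ValuedRel D r :=
  fun t => if inCount E t < k ∧ ∃ u, TupleEquiv E t u ∧ P u ≠ 0 then 1 else 0

theorem tupleEquiv_collapse {E : Finset D} {d : D} (hd : d ∈ E) (ψ : Fin n → D)
    (T : Fin r ↪ Fin n) :
    TupleEquiv E (fun j => collapse E d ψ (T j)) (fun j => ψ (T j)) := by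
  intro j
  by_cases h : ψ (T j) ∈ E <;> simp [collapse, h, hd]

theorem TupleEquiv.inCount_eq {E : Finset D} {s t : Fin r → D} (h : TupleEquiv E s t) :
    inCount E t = inCount E s := by
  have h1 := hist_sum_add_compl (hist s) E
  have h2 := hist_sum_add_compl (hist t) E
  have h3 : ∑ e ∈ Eᶜ, (hist t).1 e = ∑ e ∈ Eᶜ, (hist s).1 e :=
    Finset.sum_congr rfl fun e he => h.hist_eq (Finset.mem_compl.1 he)
  simp only [inCount]
  omega

theorem hist_collapse_eq_zero {E : Finset D} {d : D} (ψ : Fin n → D) (T : Fin r ↪ Fin n) {e : D}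
    (he : e ∈ E) (hne : e ≠ d) : (hist fun j => collapse E d ψ (T j)).1 e = 0 := by
  simp only [hist, Finset.card_eq_zero, Finset.filter_eq_empty_iff]
  rintro j - h
  simp only [collapse] at h
  split_ifs at h with h1
  · exact hne h.symm
  · exact h1 (h ▸ he)

theorem hist_ext_of_ne {g h : Hist D r} (d : D) (H : ∀ e, e ≠ d → g.1 e = h.1 e) : g = h := by
  refine Subtype.ext (funext fun e => ?_)
  by_cases he : e = d
  · subst he
    have h3 := Finset.add_sum_erase Finset.univ g.1 (Finset.mem_univ e)
    have h4 := Finset.add_sum_erase Finset.univ h.1 (Finset.mem_univ e)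
    rw [g.2] at h3
    rw [h.2] at h4
    have h5 : ∑ x ∈ Finset.univ.erase e, g.1 x = ∑ x ∈ Finset.univ.erase e, h.1 x :=
      Finset.sum_congr rfl fun x hx => H x (Finset.ne_of_mem_erase hx)
    omega
  · exact H e he

/-- The data of an assignment `ψ` with a majority color `d` and of density so small that every
histogram in the support that fits into `ψ` has at most `k` entries among the popular colors `E`.
The parameter `x` is the density of `ψ` in units of `n ^ (k - r)`, up to a constant. -/
structure SmallDensity (P : ValuedRel D r) (S : SVR D r) (k : ℕ) (ψ : Fin n → D) (d : D)
    (E : Finset D) (x : ℝ) : Prop where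
  support : HasSupport P S
  plentiful : S.Plentiful k
  lt_arity : k < r
  large : Fintype.card D * r ≤ n
  majority : n ≤ Fintype.card D * colorCount ψ d
  total_le : (supportConst D r : ℝ) * total P ψ ≤ x * n ^ k
  one_le : 1 ≤ x
  small : r * x * Fintype.card D < n
  mem_iff : ∀ e, e ∈ E ↔ r * x < colorCount ψ e

namespace SmallDensity

variable {P : ValuedRel D r} {S : SVR D r} {k : ℕ} {ψ : Fin n → D} {d : D} {E : Finset D} {x : ℝ}

theorem mem (hs : SmallDensity P S k ψ d E x) : d ∈ E := by
  have hD : (0 : ℝ) < Fintype.card D := by exact_mod_cast Fintype.card_pos_iff.2 ⟨d⟩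
  rw [hs.mem_iff]
  have h1 : (n : ℝ) ≤ Fintype.card D * colorCount ψ d := by exact_mod_cast hs.majority
  have h2 := hs.small.trans_le h1
  rw [mul_comm] at h2
  exact lt_of_mul_lt_mul_left h2 hD.le

theorem one_le_arity (hs : SmallDensity P S k ψ d E x) : (1 : ℝ) ≤ r := by
  exact_mod_cast (Nat.zero_le k).trans_lt hs.lt_arity

theorem mul_lt (hs : SmallDensity P S k ψ d E x) : r * x < n := by
  have hD : (1 : ℝ) ≤ Fintype.card D := by exact_mod_cast Fintype.card_pos_iff.2 ⟨d⟩
  have h0 : 0 ≤ r * x := by have := hs.one_le; positivity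
  nlinarith [hs.small]

theorem le_mul (hs : SmallDensity P S k ψ d E x) : x ≤ r * x :=
  le_mul_of_one_le_left (by linarith [hs.one_le]) hs.one_le_arity

theorem pos (hs : SmallDensity P S k ψ d E x) : 0 < n := by
  have h1 := hs.mul_lt
  have h2 := hs.le_mul
  have h3 := hs.one_le
  have : (0 : ℝ) < n := by linarith
  exact_mod_cast this

theorem arity_le (hs : SmallDensity P S k ψ d E x) {e : D} (he : e ∈ E) :
    r ≤ colorCount ψ e := by
  have h1 := (hs.mem_iff e).1 he
  have h2 : (r : ℝ) ≤ r * x := le_mul_of_one_le_right (Nat.cast_nonneg _) hs.one_le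
  exact_mod_cast h2.trans h1.le

theorem feasible (hs : SmallDensity P S k ψ d E x) {g : Hist D r}
    (hle : ∀ e, e ∉ E → g.1 e ≤ colorCount ψ e) : ∀ e, e ≠ d → g.1 e ≤ colorCount ψ e := by
  intro e _
  by_cases he : e ∈ E
  · exact (hist_le g e).trans (hs.arity_le he)
  · exact hle e he

/-- A feasible histogram can be changed into one with `k` entries of color `d` and no entries of
the other popular colors, as any other improvement would make the density too large. -/
theorem exists_improved (hs : SmallDensity P S k ψ d E x) {g : Hist D r} (hg : g ∈ S.supp)
    (hle : ∀ e, e ≠ d → g.1 e ≤ colorCount ψ e) :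
    ∃ g' ∈ S.supp, (∀ e, e ≠ d → g'.1 e ≤ g.1 e) ∧ g'.1 d = k ∧
      ∀ e ∈ E, e ≠ d → g'.1 e = 0 := by
  obtain ⟨g', hg', hg'g, hg'd⟩ := hs.plentiful d g hg
  have hle' : ∀ e, e ≠ d → g'.1 e ≤ colorCount ψ e := fun e he => (hg'g e he).trans (hle e he)
  have h1 := pow_mul_prod_le hs.support hs.large hs.majority hg' hle'
  have h2 : ((n ^ g'.1 d * ∏ e ∈ Finset.univ.erase d, colorCount ψ e ^ g'.1 e : ℕ) : ℝ) ≤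
      x * n ^ k := le_trans (by exact_mod_cast h1) hs.total_le
  have hn0 := hs.pos
  have hnk : (0 : ℝ) < (n : ℝ) ^ k := by positivity
  have hx := hs.le_mul
  have hxn := hs.mul_lt
  have hd : g'.1 d = k := by
    refine le_antisymm ?_ hg'd
    by_contra! hlt
    have h3 : n ^ (k + 1) ≤ n ^ g'.1 d * ∏ e ∈ Finset.univ.erase d, colorCount ψ e ^ g'.1 e :=
      (Nat.pow_le_pow_right hn0 hlt).trans (Nat.le_mul_of_pos_right _
        (one_le_prod_pow fun e he => hle' e (Finset.ne_of_mem_erase he)))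
    have h4 : (n : ℝ) ^ (k + 1) ≤ x * n ^ k := le_trans (by exact_mod_cast h3) h2
    rw [pow_succ'] at h4
    have := le_of_mul_le_mul_right h4 hnk
    linarith
  refine ⟨g', hg', hg'g, hd, fun e he hne => ?_⟩
  by_contra h0
  have h3 : n ^ k * colorCount ψ e ≤
      n ^ g'.1 d * ∏ e ∈ Finset.univ.erase d, colorCount ψ e ^ g'.1 e := by
    rw [hd, ← Finset.mul_prod_erase (Finset.univ.erase d) (fun e => colorCount ψ e ^ g'.1 e)
      (Finset.mem_erase.2 ⟨hne, Finset.mem_univ e⟩)]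
    refine Nat.mul_le_mul_left _ ?_
    refine (Nat.le_self_pow h0 _).trans (Nat.le_mul_of_pos_right _ (one_le_prod_pow fun f hf => ?_))
    exact hle' f (Finset.ne_of_mem_erase (Finset.mem_of_mem_erase hf))
  have h4 : (n : ℝ) ^ k * colorCount ψ e ≤ x * n ^ k := le_trans (by exact_mod_cast h3) h2
  rw [mul_comm] at h4
  have := le_of_mul_le_mul_right h4 hnk
  have := (hs.mem_iff e).1 he
  linarith

theorem sum_of_vanish (hs : SmallDensity P S k ψ d E x) {g : Hist D r}
    (hE : ∀ e ∈ E, e ≠ d → g.1 e = 0) : ∑ e ∈ E, g.1 e = g.1 d :=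
  Finset.sum_eq_single_of_mem d hs.mem hE

/-- Every feasible histogram in the support has at most `k` entries of popular colors. -/
theorem sum_le (hs : SmallDensity P S k ψ d E x) {g : Hist D r} (hg : g ∈ S.supp)
    (hle : ∀ e, e ≠ d → g.1 e ≤ colorCount ψ e) : ∑ e ∈ E, g.1 e ≤ k := by
  obtain ⟨g', -, hg'g, hd, hE⟩ := hs.exists_improved hg hle
  have h1 := hist_sum_add_compl g E
  have h2 := hist_sum_add_compl g' E
  have h3 := hs.sum_of_vanish hE
  have h4 : ∑ e ∈ Eᶜ, g'.1 e ≤ ∑ e ∈ Eᶜ, g.1 e := Finset.sum_le_sum fun e he =>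
    hg'g e fun h => Finset.mem_compl.1 he (h ▸ hs.mem)
  omega

theorem tight_rigid (hs : SmallDensity P S k ψ d E x) {g : Hist D r} (hg : g ∈ S.supp)
    (hle : ∀ e, e ≠ d → g.1 e ≤ colorCount ψ e) (hgd : g.1 d = k)
    (hgE : ∀ e ∈ E, e ≠ d → g.1 e = 0) : S.Tight d k g ∧ S.Rigid d E g := by
  have hgsum := hs.sum_of_vanish hgE
  refine ⟨⟨hg, fun f hf hfg => ?_, hgd⟩, hg, hs.mem, hgE, fun f hf hfg => ?_⟩
  · have hfd : f.1 d ≤ k := (Finset.single_le_sum (f := f.1) (fun _ _ => Nat.zero_le _)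
      hs.mem).trans (hs.sum_le hf fun e he => (hfg e he).trans (hle e he))
    have h1 := Finset.add_sum_erase Finset.univ f.1 (Finset.mem_univ d)
    have h2 := Finset.add_sum_erase Finset.univ g.1 (Finset.mem_univ d)
    rw [f.2] at h1
    rw [g.2] at h2
    have hle' : ∀ e ∈ Finset.univ.erase d, f.1 e ≤ g.1 e := fun e he =>
      hfg e (Finset.ne_of_mem_erase he)
    have h3 := Finset.sum_le_sum hle'
    have h4 := (Finset.sum_eq_sum_iff_of_le hle').1 (by omega)
    exact hist_ext_of_ne d fun e he => h4 e (Finset.mem_erase.2 ⟨he, Finset.mem_univ e⟩)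
  · have h1 := hs.sum_le hf (hs.feasible fun e he =>
      (hfg e he).trans (hle e fun h => he (h ▸ hs.mem)))
    have h2 : ∑ e ∈ Eᶜ, f.1 e ≤ ∑ e ∈ Eᶜ, g.1 e := Finset.sum_le_sum fun e he =>
      hfg e (Finset.mem_compl.1 he)
    have h3 := hist_sum_add_compl f E
    have h4 := hist_sum_add_compl g E
    omega

/-- If a feasible histogram `g` in the support has `k` entries of popular colors, then the
histogram with the same entries off `E` and with `k` entries of color `d` is tight and rigid. -/
theorem tight_rigid_of_eq (hs : SmallDensity P S k ψ d E x) {g g₀ : Hist D r} (hg : g ∈ S.supp)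
    (hle : ∀ e, e ≠ d → g.1 e ≤ colorCount ψ e) (hgk : ∑ e ∈ E, g.1 e = k)
    (hg₀ : ∀ e, e ∉ E → g₀.1 e = g.1 e) (hE : ∀ e ∈ E, e ≠ d → g₀.1 e = 0) :
    S.Tight d k g₀ ∧ S.Rigid d E g₀ := by
  obtain ⟨g', hg', hg'g, hg'd, hg'E⟩ := hs.exists_improved hg hle
  have h1 := hist_sum_add_compl g E
  have h2 := hist_sum_add_compl g' E
  have h3 := hs.sum_of_vanish hg'E
  have hle' : ∀ e ∈ Eᶜ, g'.1 e ≤ g.1 e := fun e he =>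
    hg'g e fun h => Finset.mem_compl.1 he (h ▸ hs.mem)
  have h4 := (Finset.sum_eq_sum_iff_of_le hle').1 (by omega)
  have : g₀ = g' := hist_ext_of_ne d fun e he => by
    by_cases heE : e ∈ E
    · rw [hE e heE he, hg'E e heE he]
    · rw [hg₀ e heE, h4 e (Finset.mem_compl.2 heE)]
  rw [this]
  exact hs.tight_rigid hg' (fun e he => (hg'g e he).trans (hle e he)) hg'd hg'E

/-- On constraints with `k` popular entries, collapsing the popular colors does not matter. -/
theorem eq_collapse (hs : SmallDensity P S k ψ d E x) (hP : TupleUniform P S k)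
    (T : Fin r ↪ Fin n) (hT : inCount E (fun j => collapse E d ψ (T j)) = k) :
    P (fun j => ψ (T j)) = P (fun j => collapse E d ψ (T j)) := by
  have hequiv := tupleEquiv_collapse hs.mem ψ T
  have hvan : ∀ e ∈ E, e ≠ d → (hist fun j => collapse E d ψ (T j)).1 e = 0 :=
    fun e he hne => hist_collapse_eq_zero ψ T he hne
  suffices h : P (fun j => ψ (T j)) ≠ 0 ∨ P (fun j => collapse E d ψ (T j)) ≠ 0 →
      S.Tight d k (hist fun j => collapse E d ψ (T j)) ∧
        S.Rigid d E (hist fun j => collapse E d ψ (T j)) by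
    by_cases h0 : P (fun j => ψ (T j)) ≠ 0 ∨ P (fun j => collapse E d ψ (T j)) ≠ 0
    · obtain ⟨ht, hr⟩ := h h0
      exact (hP d E _ ht hr _ _ rfl hequiv).symm
    · push Not at h0
      rw [h0.1, h0.2]
  rintro (h | h)
  · exact hs.tight_rigid_of_eq (g := hist fun j => ψ (T j)) ((hs.support _).2 ⟨_, rfl, h⟩)
      (fun e _ => hist_comp_le ψ T e) (hequiv.inCount_eq.trans hT)
      (fun e he => (hequiv.hist_eq he).symm) hvan
  · refine hs.tight_rigid_of_eq ((hs.support _).2 ⟨_, rfl, h⟩) (hs.feasible fun e he => ?_) hT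
      (fun _ _ => rfl) hvan
    rw [← hequiv.hist_eq he]
    exact hist_comp_le ψ T e

/-- On every constraint, the value of `ψ` is that of the main part of the collapsed assignment, up
to an error that is bounded by the minor part. -/
theorem value_le (hs : SmallDensity P S k ψ d E x) (hP : TupleUniform P S k)
    (T : Fin r ↪ Fin n) : (mainPart P E k (fun j => collapse E d ψ (T j)) : ℝ) ≤
        P (fun j => ψ (T j)) ∧ (P (fun j => ψ (T j)) : ℝ) ≤
      mainPart P E k (fun j => collapse E d ψ (T j)) +
        valueBound P * minorPart P E k (fun j => collapse E d ψ (T j)) := by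
  have hequiv := tupleEquiv_collapse hs.mem ψ T
  have hB := one_le_valueBound P
  have hPB := le_valueBound P (fun j => ψ (T j))
  rcases lt_trichotomy (inCount E fun j => collapse E d ψ (T j)) k with h | h | h
  · have h1 : mainPart P E k (fun j => collapse E d ψ (T j)) = 0 := if_neg h.ne
    rw [h1, Nat.cast_zero, zero_add]
    refine ⟨Nat.cast_nonneg _, ?_⟩
    by_cases h0 : P (fun j => ψ (T j)) = 0
    · rw [h0, Nat.cast_zero]
      exact mul_nonneg (by linarith) (Nat.cast_nonneg _)
    · have h2 : minorPart P E k (fun j => collapse E d ψ (T j)) = 1 :=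
        if_pos ⟨h, _, hequiv, h0⟩
      rw [h2, Nat.cast_one, mul_one]
      exact hPB
  · have h1 : mainPart P E k (fun j => collapse E d ψ (T j)) = P (fun j => ψ (T j)) :=
      (if_pos h).trans (hs.eq_collapse hP T h).symm
    rw [h1]
    refine ⟨le_rfl, le_add_of_nonneg_right (mul_nonneg (by linarith) (Nat.cast_nonneg _))⟩
  · have h1 : mainPart P E k (fun j => collapse E d ψ (T j)) = 0 := if_neg h.ne'
    have h0 : P (fun j => ψ (T j)) = 0 := by
      by_contra h0
      have := hs.sum_le ((hs.support _).2 ⟨_, rfl, h0⟩) fun e _ => hist_comp_le ψ T e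
      have h3 := hequiv.inCount_eq
      simp only [inCount] at h h3
      omega
    rw [h1, h0, Nat.cast_zero, zero_add]
    exact ⟨le_rfl, mul_nonneg (by linarith) (Nat.cast_nonneg _)⟩

theorem card_collapse_le (hs : SmallDensity P S k ψ d E x) :
    ((Finset.univ.filter fun v => collapse E d ψ v ∉ E).card : ℝ) ≤ Fintype.card D * (r * x) := by
  have h1 : (Finset.univ.filter fun v => collapse E d ψ v ∉ E).card ≤
      ∑ e ∈ Eᶜ, colorCount ψ e := by
    refine (Finset.card_le_card (t := Finset.univ.filter fun v => ψ v ∈ Eᶜ) fun v hv => ?_).trans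
      (le_of_eq ?_)
    · replace hv := (Finset.mem_filter.1 hv).2
      simp only [collapse, Finset.mem_filter, Finset.mem_univ, true_and, Finset.mem_compl] at hv ⊢
      intro h
      rw [if_pos h] at hv
      exact hv hs.mem
    · rw [Finset.card_eq_sum_card_fiberwise (f := ψ) (t := Eᶜ) (fun v hv => by simpa using hv)]
      refine Finset.sum_congr rfl fun e he => ?_
      simp only [colorCount]
      congr 1
      ext v
      simp only [Finset.mem_filter, Finset.mem_univ, true_and, and_iff_right_iff_imp]
      rintro rfl
      exact he
  calc ((Finset.univ.filter fun v => collapse E d ψ v ∉ E).card : ℝ)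
      ≤ ((∑ e ∈ Eᶜ, colorCount ψ e : ℕ) : ℝ) := by exact_mod_cast h1
    _ = ∑ e ∈ Eᶜ, (colorCount ψ e : ℝ) := by push_cast; rfl
    _ ≤ ∑ _e ∈ Eᶜ, r * x := Finset.sum_le_sum fun e he => by
        rw [Finset.mem_compl, hs.mem_iff, not_lt] at he
        exact he
    _ ≤ ∑ _e : D, r * x := Finset.sum_le_sum_of_subset_of_nonneg (Finset.subset_univ _)
        fun _ _ _ => by have := hs.one_le; positivity
    _ = _ := by simp

/-- A single pattern of the minor part is rarer than the relation itself by a factor of order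
`x / n`. -/
theorem card_pattern_mul_le (hs : SmallDensity P S k ψ d E x) {t : Fin r → D}
    (ht : minorPart P E k t ≠ 0) :
    ((Finset.univ.filter fun T : Fin r ↪ Fin n =>
      (fun j => collapse E d ψ (T j)) = t).card : ℝ) * n ≤
        r * x * (supportConst D r * total P ψ) := by
  have hx0 : 0 ≤ r * x := by have := hs.one_le; positivity
  rcases Finset.eq_empty_or_nonempty (Finset.univ.filter fun T : Fin r ↪ Fin n =>
      (fun j => collapse E d ψ (T j)) = t) with h0 | ⟨T, hT⟩
  · rw [h0, Finset.card_empty, Nat.cast_zero, zero_mul]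
    positivity
  have hT' : (fun j => collapse E d ψ (T j)) = t := (Finset.mem_filter.1 hT).2
  have hlt : inCount E t < k ∧ ∃ u, TupleEquiv E t u ∧ P u ≠ 0 := by
    by_contra h
    exact ht (if_neg h)
  obtain ⟨hlt, u, htu, hu⟩ := hlt
  -- The histogram of `u` is feasible, because off `E` it agrees with that of `ψ` on a scope.
  have hoff : ∀ e, e ∉ E → (hist t).1 e ≤ colorCount ψ e := fun e he => by
    rw [← hT', ← (tupleEquiv_collapse hs.mem ψ T).hist_eq he]
    exact hist_comp_le ψ T e
  obtain ⟨g, hg, hgu, hgd, hgE⟩ := hs.exists_improved ((hs.support _).2 ⟨u, rfl, hu⟩)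
    (hs.feasible fun e he => by rw [htu.hist_eq he]; exact hoff e he)
  have hgt : ∀ e ∈ Eᶜ, g.1 e ≤ (hist t).1 e := fun e he => by
    rw [← htu.hist_eq (Finset.mem_compl.1 he)]
    exact hgu e fun h => Finset.mem_compl.1 he (h ▸ hs.mem)
  have hgfeas : ∀ e, e ≠ d → g.1 e ≤ colorCount ψ e := fun e he => by
    by_cases heE : e ∈ E
    · rw [hgE e heE he]; exact Nat.zero_le _
    · exact (hgt e (Finset.mem_compl.2 heE)).trans (hoff e heE)
  have h1 := pow_mul_prod_le hs.support hs.large hs.majority hg hgfeas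
  have h2 : n ^ k * ∏ e ∈ Eᶜ, colorCount ψ e ^ g.1 e ≤ supportConst D r * total P ψ := by
    refine le_trans (le_of_eq ?_) h1
    rw [hgd]
    congr 1
    refine Finset.prod_subset (fun e he => Finset.mem_erase.2
      ⟨fun h => Finset.mem_compl.1 he (h ▸ hs.mem), Finset.mem_univ e⟩) fun e he he' => ?_
    rw [hgE e (by simpa using he') (Finset.ne_of_mem_erase he), pow_zero]
  -- The number of scopes with pattern `t`.
  have h3 : (Finset.univ.filter fun T : Fin r ↪ Fin n =>
      (fun j => collapse E d ψ (T j)) = t).card ≤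
        n ^ inCount E t * ∏ e ∈ Eᶜ, colorCount ψ e ^ (hist t).1 e := by
    rw [card_scopes, ← Finset.prod_mul_prod_compl E]
    refine Nat.mul_le_mul ?_ (Finset.prod_le_prod' fun e he => ?_)
    · rw [inCount, ← Finset.prod_pow_eq_pow_sum]
      refine Finset.prod_le_prod' fun e _ => (Nat.descFactorial_le_pow _ _).trans ?_
      exact Nat.pow_le_pow_left (colorCount_le _ _) _
    · refine (Nat.descFactorial_le_pow _ _).trans (Nat.pow_le_pow_left ?_ _)
      refine Finset.card_le_card fun v hv => ?_
      replace hv := (Finset.mem_filter.1 hv).2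
      simp only [collapse, Finset.mem_filter, Finset.mem_univ, true_and] at hv ⊢
      split_ifs at hv with h
      · exact absurd (hv ▸ hs.mem) (Finset.mem_compl.1 he)
      · exact hv
  have hsum : ∑ e ∈ Eᶜ, ((hist t).1 e - g.1 e) = k - inCount E t := by
    have h4 := hist_sum_add_compl (hist t) E
    have h5 := hist_sum_add_compl g E
    have h6 := hs.sum_of_vanish hgE
    have h7 := Finset.sum_tsub_distrib Eᶜ hgt
    have h8 := Finset.sum_le_sum hgt
    simp only [inCount] at hlt ⊢
    omega
  have h4 : ∏ e ∈ Eᶜ, (colorCount ψ e : ℝ) ^ (hist t).1 e ≤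
      (∏ e ∈ Eᶜ, (colorCount ψ e : ℝ) ^ g.1 e) * (r * x) ^ (k - inCount E t) := by
    rw [← hsum, ← Finset.prod_pow_eq_pow_sum, ← Finset.prod_mul_distrib]
    refine Finset.prod_le_prod (fun _ _ => by positivity) fun e he => ?_
    calc (colorCount ψ e : ℝ) ^ (hist t).1 e
        = (colorCount ψ e : ℝ) ^ g.1 e * (colorCount ψ e : ℝ) ^ ((hist t).1 e - g.1 e) := by
          rw [← pow_add, Nat.add_sub_cancel' (hgt e he)]
      _ ≤ _ := by
          refine mul_le_mul_of_nonneg_left (pow_le_pow_left₀ (Nat.cast_nonneg _) ?_ _)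
            (by positivity)
          rw [Finset.mem_compl, hs.mem_iff, not_lt] at he
          exact he
  obtain ⟨a, ha⟩ : ∃ a, k - inCount E t = a + 1 := ⟨k - inCount E t - 1, by omega⟩
  have hk : k = inCount E t + a + 1 := by omega
  calc ((Finset.univ.filter fun T : Fin r ↪ Fin n =>
        (fun j => collapse E d ψ (T j)) = t).card : ℝ) * n
      ≤ (n ^ inCount E t * ∏ e ∈ Eᶜ, (colorCount ψ e : ℝ) ^ (hist t).1 e) * n := by
        gcongr
        exact_mod_cast h3
    _ ≤ (n ^ inCount E t * ((∏ e ∈ Eᶜ, (colorCount ψ e : ℝ) ^ g.1 e) *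
          (r * x) ^ (k - inCount E t))) * n := by gcongr
    _ = (r * x) ^ a * (n ^ inCount E t * n) * (r * x) *
          ∏ e ∈ Eᶜ, (colorCount ψ e : ℝ) ^ g.1 e := by rw [ha]; ring
    _ ≤ (n : ℝ) ^ a * (n ^ inCount E t * n) * (r * x) *
          ∏ e ∈ Eᶜ, (colorCount ψ e : ℝ) ^ g.1 e := by
        gcongr
        exact hs.mul_lt.le
    _ = r * x * (n ^ k * ∏ e ∈ Eᶜ, (colorCount ψ e : ℝ) ^ g.1 e) := by
        rw [hk, pow_add, pow_add]; ring
    _ ≤ _ := by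
        refine mul_le_mul_of_nonneg_left ?_ hx0
        exact_mod_cast h2

theorem density_minorPart_mul_le (hs : SmallDensity P S k ψ d E x) :
    density (minorPart P E k) (collapse E d ψ) * n ≤
      Fintype.card D ^ r * (r * x * supportConst D r) * density P ψ := by
  have hx0 : 0 ≤ r * x := by have := hs.one_le; positivity
  have h1 : (total (minorPart P E k) (collapse E d ψ) : ℝ) * n ≤
      Fintype.card D ^ r * (r * x * (supportConst D r * total P ψ)) := by
    rw [total_eq_sum]
    push_cast
    rw [Finset.sum_mul]
    calc _ ≤ ∑ _t : Fin r → D, r * x * (supportConst D r * total P ψ) := by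
          refine Finset.sum_le_sum fun t _ => ?_
          by_cases ht : minorPart P E k t = 0
          · rw [ht, Nat.cast_zero, zero_mul, zero_mul]
            positivity
          · refine le_trans (le_of_eq ?_) (hs.card_pattern_mul_le ht)
            have : minorPart P E k t = 1 := by
              unfold minorPart at ht ⊢
              split_ifs at ht ⊢
              · rfl
              · exact absurd rfl ht
            rw [card_scopes, this]
            push_cast
            ring
      _ = _ := by simp
  rw [density_eq, density_eq, div_mul_eq_mul_div, ← mul_div_assoc]
  refine div_le_div_of_nonneg_right (h1.trans (le_of_eq (by ring))) (Nat.cast_nonneg _)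

theorem density_mainPart_le (hs : SmallDensity P S k ψ d E x) (hP : TupleUniform P S k) :
    density (mainPart P E k) (collapse E d ψ) ≤ density P ψ ∧
      density P ψ ≤ density (mainPart P E k) (collapse E d ψ) +
        valueBound P * density (minorPart P E k) (collapse E d ψ) := by
  constructor
  · exact mean_mono fun T => (hs.value_le hP T).1
  · rw [density, density, density, ← mean_mul_left, ← mean_add]
    exact mean_mono fun T => (hs.value_le hP T).2

theorem sat_le (hs : SmallDensity P S k ψ d E x) (hP : TupleUniform P S k) {m : ℕ}
    (T : Fin m → (Fin r ↪ Fin n)) :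
    sat (mainPart P E k) (Instance.ofScopes T) (collapse E d ψ) ≤ sat P (Instance.ofScopes T) ψ ∧
      sat P (Instance.ofScopes T) ψ ≤
        sat (mainPart P E k) (Instance.ofScopes T) (collapse E d ψ) +
          valueBound P * sat (minorPart P E k) (Instance.ofScopes T) (collapse E d ψ) := by
  simp only [sat_ofScopes, Finset.mul_sum, ← Finset.sum_add_distrib]
  exact ⟨Finset.sum_le_sum fun i _ => (hs.value_le hP _).1,
    Finset.sum_le_sum fun i _ => (hs.value_le hP _).2⟩

/-- If the main part and the minor part of the collapsed assignment are concentrated, then so is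
the value of `ψ`. -/
theorem abs_sat_sub_le (hs : SmallDensity P S k ψ d E x) (hP : TupleUniform P S k) {m : ℕ}
    (T : Fin m → (Fin r ↪ Fin n)) {ε w : ℝ} (hε : 0 < ε) (hε1 : ε ≤ 1) (hw : w ≤ density P ψ)
    (hx : 8 * valueBound P * (Fintype.card D ^ r * (r * x * supportConst D r)) ≤ ε * n)
    (h1 : |sat (mainPart P E k) (Instance.ofScopes T) (collapse E d ψ) -
        m * density (mainPart P E k) (collapse E d ψ)| ≤ ε / (8 * valueBound P) *
          (m * max (density (mainPart P E k) (collapse E d ψ)) w))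
    (h2 : |sat (minorPart P E k) (Instance.ofScopes T) (collapse E d ψ) -
        m * density (minorPart P E k) (collapse E d ψ)| ≤ ε / (8 * valueBound P) *
          (m * max (density (minorPart P E k) (collapse E d ψ)) w)) :
    |sat P (Instance.ofScopes T) ψ - m * density P ψ| ≤ ε * (m * density P ψ) := by
  have hB := one_le_valueBound P
  have hn : (0 : ℝ) < n := by exact_mod_cast hs.pos
  have hm : (0 : ℝ) ≤ m := Nat.cast_nonneg m
  have hdens := density_nonneg P ψ
  obtain ⟨h3, h4⟩ := hs.density_mainPart_le hP
  obtain ⟨h5, h6⟩ := hs.sat_le hP T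
  have h7 : valueBound P * density (minorPart P E k) (collapse E d ψ) ≤ ε / 8 * density P ψ := by
    refine le_of_mul_le_mul_right ?_ hn
    have := hs.density_minorPart_mul_le
    calc _ = valueBound P * (density (minorPart P E k) (collapse E d ψ) * n) := by ring
      _ ≤ valueBound P * (Fintype.card D ^ r * (r * x * supportConst D r) * density P ψ) := by
          gcongr
      _ = 8 * valueBound P * (Fintype.card D ^ r * (r * x * supportConst D r)) *
            density P ψ / 8 := by ring
      _ ≤ ε * n * density P ψ / 8 := by gcongr
      _ = _ := by ring
  have h8 : 0 ≤ density (minorPart P E k) (collapse E d ψ) := density_nonneg _ _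
  have h9 : density (minorPart P E k) (collapse E d ψ) ≤ density P ψ := by
    nlinarith
  set B := valueBound P
  set p := density P ψ
  set p1 := density (mainPart P E k) (collapse E d ψ)
  set p2 := density (minorPart P E k) (collapse E d ψ)
  have h10 : ε / (8 * B) * (m * max p1 w) ≤ ε / (8 * B) * (m * p) := by
    gcongr
    exact max_le h3 hw
  have h11 : ε / (8 * B) * (m * max p2 w) ≤ ε / (8 * B) * (m * p) := by
    gcongr
    exact max_le h9 hw
  have h12 : ε / (8 * B) * (m * p) ≤ ε / 8 * (m * p) := by
    gcongr
    linarith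
  obtain ⟨h13, h14⟩ := abs_le.1 (h1.trans (h10.trans h12))
  have h15 := (abs_le.1 (h2.trans h11)).2
  have h16 : B * sat (minorPart P E k) (Instance.ofScopes T) (collapse E d ψ) ≤
      ε / 4 * (m * p) := by
    calc _ ≤ B * (m * p2 + ε / (8 * B) * (m * p)) := by gcongr; linarith
      _ = m * (B * p2) + ε / 8 * (m * p) := by field_simp
      _ ≤ m * (ε / 8 * p) + ε / 8 * (m * p) := by gcongr
      _ = _ := by ring
  have h17 : m * p1 ≤ m * p := mul_le_mul_of_nonneg_left h3 hm
  have h18 : m * p ≤ m * p1 + ε / 8 * (m * p) := by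
    calc m * p ≤ m * (p1 + B * p2) := mul_le_mul_of_nonneg_left h4 hm
      _ ≤ m * (p1 + ε / 8 * p) := by gcongr
      _ = _ := by ring
  have h19 : 0 ≤ ε * (m * p) := by positivity
  rw [abs_le]
  constructor <;> linarith

end SmallDensity

end Small

section Uniform

variable {D : Type*} [Fintype D] [DecidableEq D] {r n : ℕ}

/-- The union bound over collapsed assignments. The failure probability of a collapsed assignment
with `a` entries off `E` is at most `2 y ^ (a + 1)`, and there are at most `(n |D|) ^ a` such
assignments. -/
theorem freq_exists_collapsed_le (F : Finset D → ValuedRel D r) (hrn : r ≤ n)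
    {B η c y : ℝ} (hB : 0 < B) (hF : ∀ E t, (F E t : ℝ) ≤ B) (hη : 0 ≤ η) (hη1 : η ≤ 1)
    {m : ℕ} (hy : Real.exp (-(η ^ 2 * (m * c) / (4 * B))) ≤ y)
    (hyn : n * (Fintype.card D * y) ≤ 1) :
    freq (fun T : Fin m → (Fin r ↪ Fin n) => ∃ (p : Finset D × D) (χ : Fin n → D),
      (∀ v, χ v ∈ insert p.2 p.1ᶜ) ∧
        η * (m * max (density (F p.1) χ)
            (((Finset.univ.filter fun v => χ v ∉ p.1).card + 1) * c)) <
          |sat (F p.1) (Instance.ofScopes T) χ - m * density (F p.1) χ|) ≤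
      2 ^ Fintype.card D * Fintype.card D * (6 * y) := by
  have hy0 : 0 < y := (Real.exp_pos _).trans_le hy
  have hsingle : ∀ (p : Finset D × D),
      freq (fun T : Fin m → (Fin r ↪ Fin n) => ∃ χ : Fin n → D, (∀ v, χ v ∈ insert p.2 p.1ᶜ) ∧
        η * (m * max (density (F p.1) χ)
            (((Finset.univ.filter fun v => χ v ∉ p.1).card + 1) * c)) <
          |sat (F p.1) (Instance.ofScopes T) χ - m * density (F p.1) χ|) ≤ 6 * y := by
    rintro ⟨E, d⟩
    refine (freq_le_sum (Fintype.piFinset fun _ : Fin n => insert d Eᶜ) (q := fun χ T =>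
      η * (m * max (density (F E) χ)
            (((Finset.univ.filter fun v => χ v ∉ E).card + 1) * c)) <
          |sat (F E) (Instance.ofScopes T) χ - m * density (F E) χ|)
      fun T ⟨χ, hχ, h⟩ => ⟨χ, Fintype.mem_piFinset.2 hχ, h⟩).trans ?_
    calc _ ≤ ∑ χ ∈ Fintype.piFinset fun _ : Fin n => insert d Eᶜ,
          2 * y * ∏ v, (if χ v ∈ E then 1 else y) := by
          refine Finset.sum_le_sum fun χ _ => ?_
          refine (freq_sat_sub_gt_le (F E) χ hrn hB (hF E) (le_max_left _ _) hη hη1 m).trans ?_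
          rw [mul_assoc]
          refine mul_le_mul_of_nonneg_left ?_ zero_le_two
          set a := (Finset.univ.filter fun v => χ v ∉ E).card with ha
          have h1 : ∏ v, (if χ v ∈ E then 1 else y) = y ^ a := by
            rw [Finset.prod_ite, Finset.prod_const_one, one_mul, Finset.prod_const]
          rw [h1, ← pow_succ']
          calc Real.exp (-(η ^ 2 * (m * max (density (F E) χ) ((a + 1) * c)) / (4 * B)))
              ≤ Real.exp (-(η ^ 2 * (m * ((a + 1) * c)) / (4 * B))) := by
                gcongr
                exact le_max_right _ _
            _ = Real.exp (-(η ^ 2 * (m * c) / (4 * B))) ^ (a + 1) := by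
                rw [← Real.exp_nat_mul]
                congr 1
                push_cast
                ring
            _ ≤ y ^ (a + 1) := pow_le_pow_left₀ (Real.exp_pos _).le hy _
      _ = 2 * y * (∑ e ∈ insert d Eᶜ, if e ∈ E then 1 else y) ^ n := by
          rw [← Finset.mul_sum, ← Finset.prod_univ_sum (fun _ => insert d Eᶜ)
            (fun _ e => if e ∈ E then 1 else y), Finset.prod_const, Finset.card_univ,
            Fintype.card_fin]
      _ ≤ 2 * y * Real.exp 1 := by
          refine mul_le_mul_of_nonneg_left ?_ (by positivity)
          have h1 : ∑ e ∈ insert d Eᶜ, (if e ∈ E then 1 else y) ≤ 1 + Fintype.card D * y := by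
            calc ∑ e ∈ insert d Eᶜ, (if e ∈ E then 1 else y)
                ≤ ∑ e ∈ insert d Eᶜ, ((if e = d then 1 else 0) + y) := by
                  refine Finset.sum_le_sum fun e he => ?_
                  rcases Finset.mem_insert.1 he with rfl | h
                  · rw [if_pos rfl]
                    split_ifs
                    · linarith
                    · linarith
                  · rw [if_neg (Finset.mem_compl.1 h)]
                    split_ifs
                    · linarith
                    · linarith
              _ ≤ 1 + Fintype.card D * y := by
                  rw [Finset.sum_add_distrib, Finset.sum_ite_eq',
                    if_pos (Finset.mem_insert_self _ _), Finset.sum_const, nsmul_eq_mul]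
                  gcongr
                  exact Finset.card_le_univ _
          have h0 : 0 ≤ ∑ e ∈ insert d Eᶜ, (if e ∈ E then 1 else y) :=
            Finset.sum_nonneg fun e _ => by split_ifs <;> positivity
          calc _ ≤ (1 + Fintype.card D * y) ^ n := pow_le_pow_left₀ h0 h1 n
            _ ≤ Real.exp (Fintype.card D * y) ^ n := by
                refine pow_le_pow_left₀ (by positivity) ?_ n
                rw [add_comm]
                exact Real.add_one_le_exp _
            _ = Real.exp (n * (Fintype.card D * y)) := (Real.exp_nat_mul _ _).symm
            _ ≤ _ := Real.exp_le_exp.2 hyn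
      _ ≤ 6 * y := by
          have := Real.exp_one_lt_d9
          nlinarith
  refine (freq_le_sum Finset.univ fun T ⟨p, h⟩ => ⟨p, Finset.mem_univ p, h⟩).trans ?_
  refine (Finset.sum_le_sum fun p _ => hsingle p).trans (le_of_eq ?_)
  simp [Fintype.card_finset]

/-- For a marginally uniform relation, a random instance with sufficiently many times
`n ^ (r - k) (1 + log n) / ε ^ 3` constraints approximates the complete instance. -/
theorem exists_freq_not_approximates_le_of_uniform [Nonempty D] {P : ValuedRel D r} {S : SVR D r}
    {k : ℕ} (hPS : HasSupport P S) (hk : S.Plentiful k) (hkr : k < r) (hP : TupleUniform P S k) :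
    ∃ K C : ℝ, 1 ≤ K ∧ ∃ N : ℕ, ∀ n : ℕ, N ≤ n → ∀ (m : ℕ) (ε : ℝ), 0 < ε → ε ≤ 1 →
      K * ((n : ℝ) ^ (r - k) * (1 + Real.log n)) / ε ^ 3 ≤ m →
      freq (fun T : Fin m → (Fin r ↪ Fin n) => ¬ Approximates P ε m (Instance.ofScopes T)) ≤
        C / n := by
  classical
  have hB := one_le_valueBound P
  have hL : (1 : ℝ) ≤ supportConst D r := by exact_mod_cast one_le_supportConst
  have hD : (1 : ℝ) ≤ Fintype.card D := by exact_mod_cast Fintype.card_pos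
  have hr : (1 : ℝ) ≤ r := by exact_mod_cast (Nat.zero_le k).trans_lt hkr
  have hl : 0 ≤ Real.log (Fintype.card D) := Real.log_nonneg hD
  have hDr : (Fintype.card D : ℝ) ≤ Fintype.card D ^ r :=
    le_self_pow₀ hD (by omega)
  set B := valueBound P with hBdef
  set L : ℝ := (supportConst D r : ℝ) with hLdef
  set q : ℝ := (Fintype.card D : ℝ) with hqdef
  set l := Real.log q with hldef
  -- `x ≤ ε n / Z` marks the assignments of small density.
  set Z : ℝ := 8 * B * (q ^ r * (r * L)) with hZ
  have hZr : r * q ≤ Z := by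
    have h1 : r * q ≤ (r * L) * q ^ r := by
      have : r * q ≤ r * q ^ r := by gcongr
      have h2 : r * q ^ r ≤ (r * L) * q ^ r := by
        gcongr
        exact le_mul_of_one_le_right (by positivity) hL
      linarith
    have h2 : (r * L) * q ^ r ≤ (8 * B) * ((r * L) * q ^ r) :=
      le_mul_of_one_le_left (by positivity) (by linarith)
    rw [hZ]
    linarith
  have hZ0 : 0 < Z := by positivity
  -- `K1` is for the union bound over all assignments of larger density, and `K2` for the one over
  -- collapsed assignments, where the threshold `c` below has to make the failure probability at
  -- most `1 / (n ^ 2 |D|)` for every variable off `E`.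
  set K1 : ℝ := 4 * B * L * (1 + l) * Z with hK1
  set K2 : ℝ := 256 * B ^ 3 * L * (q * r + 1) * (2 + l) with hK2
  have hK10 : 0 ≤ K1 := by positivity
  have hK20 : 0 ≤ K2 := by positivity
  refine ⟨1 + K1 + K2, 2 + 12 * 2 ^ Fintype.card D, by linarith, Fintype.card D * r + 1,
    fun n hn m ε hε hε1 hm => ?_⟩
  have hn' : Fintype.card D * r ≤ n := by omega
  have hn0 : 0 < n := by omega
  have hrn := card_mul_le_imp hn'
  have hn1 : (1 : ℝ) ≤ n := by exact_mod_cast hn0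
  have hlogn : 0 ≤ Real.log n := Real.log_nonneg hn1
  have hnp : (0 : ℝ) < (n : ℝ) ^ (r - k) := by positivity
  rw [div_le_iff₀ (by positivity)] at hm
  set c : ℝ := 1 / (L * n ^ (r - k) * (q * r + 1)) with hc
  set y : ℝ := 1 / (n ^ 2 * q) with hydef
  have hy : Real.exp (-((ε / (8 * B)) ^ 2 * (m * c) / (4 * B))) ≤ y := by
    have h1 : Real.exp (-(2 * Real.log n + l)) = y := by
      rw [Real.exp_neg, Real.exp_add, hldef, Real.exp_log (by linarith),
        show (2 : ℝ) * Real.log n = ((2 : ℕ) : ℝ) * Real.log n by norm_num, Real.exp_nat_mul,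
        Real.exp_log (by linarith), hydef, one_div]
    rw [← h1]
    refine Real.exp_le_exp.2 (neg_le_neg ?_)
    have h2 : (ε / (8 * B)) ^ 2 * (m * c) / (4 * B) =
        m * ε ^ 2 / (256 * B ^ 3 * L * (q * r + 1) * n ^ (r - k)) := by
      rw [hc]; field_simp; ring
    rw [h2, le_div_iff₀ (by positivity)]
    have h3 : (m : ℝ) * ε ^ 3 ≤ m * ε ^ 2 := by
      rw [pow_succ ε 2, ← mul_assoc]
      exact mul_le_of_le_one_right (by positivity) hε1
    calc (2 * Real.log n + l) * (256 * B ^ 3 * L * (q * r + 1) * n ^ (r - k))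
        ≤ ((2 + l) * (1 + Real.log n)) * (256 * B ^ 3 * L * (q * r + 1) * n ^ (r - k)) := by
          gcongr
          nlinarith [mul_nonneg hl hlogn]
      _ = K2 * (n ^ (r - k) * (1 + Real.log n)) := by rw [hK2]; ring
      _ ≤ (1 + K1 + K2) * (n ^ (r - k) * (1 + Real.log n)) := by
          gcongr
          linarith
      _ ≤ _ := hm.trans h3
  have hqy : n * (q * y) ≤ 1 := by
    rw [hydef]
    have : n * (q * (1 / (n ^ 2 * q))) = 1 / (n : ℝ) := by field_simp
    rw [this, div_le_one (by linarith)]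
    exact hn1
  have hη : 0 ≤ ε / (8 * B) := by positivity
  have hη1 : ε / (8 * B) ≤ 1 := by
    rw [div_le_one (by positivity)]
    linarith
  have hmain := freq_exists_collapsed_le (fun E => mainPart P E k) hrn (B := B) (by linarith)
    (fun E t => by
      have := le_valueBound P t
      simp only [mainPart]
      split_ifs
      · exact this
      · simp only [Nat.cast_zero]; linarith) hη hη1 hy hqy
  have hminor := freq_exists_collapsed_le (fun E => minorPart P E k) hrn (B := B)
    (by linarith) (fun E t => by
      simp only [minorPart]
      split_ifs
      · simp only [Nat.cast_one]; exact hB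
      · simp only [Nat.cast_zero]; linarith) hη hη1 hy hqy
  have hbig := freq_exists_sat_sub_gt_le P hrn hε hε1 (m := m)
    (fun ψ => ε * n ≤ L * density P ψ * n ^ (r - k) * Z) fun ψ hψ => by
      rw [le_div_iff₀ (by positivity)]
      have hd := density_nonneg P ψ
      refine le_of_mul_le_mul_right ?_ (show 0 < ε * (L * n ^ (r - k) * Z) by positivity)
      calc n * (1 + l) * (4 * B) * (ε * (L * n ^ (r - k) * Z))
          = ε * n * (K1 * (n ^ (r - k) * 1)) := by rw [hK1]; ring
        _ ≤ ε * n * ((1 + K1 + K2) * (n ^ (r - k) * (1 + Real.log n))) := by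
            gcongr <;> linarith
        _ ≤ ε * n * (m * ε ^ 3) := by gcongr
        _ ≤ (L * density P ψ * n ^ (r - k) * Z) * (m * ε ^ 3) := by gcongr
        _ = _ := by ring
  refine (freq_or_le (q' := _) (q := _) fun T hT => ?_).trans
    ((add_le_add hbig ((freq_or_le (q := _) (q' := _) fun T hT => hT).trans
      (add_le_add hmain hminor))).trans ?_)
  · simp only [Approximates, not_forall, not_le] at hT
    obtain ⟨ψ, hψ⟩ := hT
    have h0 : density P ψ ≠ 0 := fun h0 => by
      rw [sat_ofScopes_of_density_eq_zero hrn h0, h0] at hψ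
      simp at hψ
    by_cases hb : ε * n ≤ L * density P ψ * n ^ (r - k) * Z
    · exact Or.inl ⟨ψ, hb, hψ⟩
    right
    rw [not_le] at hb
    set x := L * density P ψ * n ^ (r - k) with hx
    obtain ⟨d, hd⟩ := exists_majority ψ
    have hx1 : 1 ≤ x := one_le_density_mul hPS hk hkr.le hn' hn0 h0
    have hs : SmallDensity P S k ψ d
        (Finset.univ.filter fun e => (r : ℝ) * x < colorCount ψ e) x := by
      refine ⟨hPS, hk, hkr, hn', hd, ?_, hx1, ?_, by simp⟩
      · have h6 : (n : ℝ) ^ r = n ^ (r - k) * n ^ k := by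
          rw [← pow_add, Nat.sub_add_cancel hkr.le]
        calc L * total P ψ ≤ L * (density P ψ * n ^ r) :=
              mul_le_mul_of_nonneg_left (total_le_density_mul P ψ hrn) (by linarith)
          _ = _ := by rw [h6, hx]; ring
      · calc r * x * q = x * (r * q) := by ring
          _ ≤ x * Z := by gcongr
          _ < ε * n := hb
          _ ≤ n := mul_le_of_le_one_left (by linarith) hε1
    set E := Finset.univ.filter fun e => (r : ℝ) * x < colorCount ψ e
    have hmem : ∀ v, collapse E d ψ v ∈ insert d Eᶜ := fun v => by
      simp only [collapse]
      split_ifs with h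
      · exact Finset.mem_insert_self _ _
      · exact Finset.mem_insert_of_mem (Finset.mem_compl.2 h)
    by_contra hgood
    rw [not_or] at hgood
    obtain ⟨hg1, hg2⟩ := hgood
    have hg1' := not_lt.1 fun h => hg1 ⟨(E, d), _, hmem, h⟩
    have hg2' := not_lt.1 fun h => hg2 ⟨(E, d), _, hmem, h⟩
    refine absurd (hs.abs_sat_sub_le hP T hε hε1 ?_ ?_ hg1' hg2') (not_le.2 hψ)
    · have h1 := hs.card_collapse_le
      rw [hc, mul_one_div, div_le_iff₀ (by positivity)]
      calc ((Finset.univ.filter fun v => collapse E d ψ v ∉ E).card : ℝ) + 1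
          ≤ q * (r * x) + x := add_le_add h1 hx1
        _ = _ := by rw [hx]; ring
    · calc 8 * B * (q ^ r * (r * x * L)) = x * Z := by rw [hZ]; ring
        _ ≤ ε * n := hb.le
  · have h1 : Real.exp (-n) ≤ 1 / n := by
      rw [Real.exp_neg, ← one_div]
      refine one_div_le_one_div_of_le (by linarith) ?_
      linarith [Real.add_one_le_exp (n : ℝ)]
    have h2 : q * (6 * y) ≤ 6 / n := by
      rw [hydef, le_div_iff₀ (by linarith)]
      have : q * (6 * (1 / (n ^ 2 * q))) * n = 6 / (n : ℝ) := by field_simp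
      rw [this]
      exact div_le_self (by norm_num) hn1
    have h3 : (2 : ℝ) ^ Fintype.card D * q * (6 * y) ≤ 2 ^ Fintype.card D * (6 / n) := by
      rw [mul_assoc]
      gcongr
    calc _ ≤ 2 * (1 / (n : ℝ)) + (2 ^ Fintype.card D * (6 / n) + 2 ^ Fintype.card D * (6 / n)) := by
          gcongr
      _ = _ := by ring

end Uniform

/-! ### Upper bounds on the size of sparsifiers -/

section Upper

theorem le_softO {A : ℝ} {b : ℕ} {f : ℝ} (hA : 1 ≤ A) (hf : 0 ≤ f) : f ≤ softO A b f := by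
  have hlog : 0 ≤ Real.log (1 + f) := Real.log_nonneg (by linarith)
  have h1 : 1 ≤ (1 + Real.log (1 + f)) ^ b := one_le_pow₀ (by linarith)
  have h2 : f ≤ A * f := le_mul_of_one_le_left hf hA
  exact h2.trans (le_mul_of_one_le_right (by linarith) h1)

theorem softO_mul (a A : ℝ) (b : ℕ) (f : ℝ) : softO (a * A) b f = a * softO A b f := by
  simp only [softO]; ring

theorem one_le_pow_div_pow {n : ℕ} (hn : 0 < n) {ε : ℝ} (hε : 0 < ε) (hε1 : ε ≤ 1) (a j : ℕ) :
    1 ≤ (n : ℝ) ^ a / ε ^ j := by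
  rw [le_div_iff₀ (by positivity), one_mul]
  have h1 : ε ^ j ≤ 1 := pow_le_one₀ hε.le hε1
  have h2 : (1 : ℝ) ≤ (n : ℝ) ^ a := one_le_pow₀ (by exact_mod_cast hn)
  exact h1.trans h2

variable {D : Type*} [Fintype D] [DecidableEq D] {r : ℕ}

/-- Random instances with at least `softO A b (n ^ a / ε ^ j)` constraints approximate the complete
instance with high probability. -/
def ApproximatesBeyond (P : ValuedRel D r) (a j : ℕ) (A : ℝ) (b : ℕ) : Prop :=
  ∀ δ : ℝ, 0 < δ → ∃ N : ℕ, ∀ n : ℕ, N ≤ n → ∀ (m : ℕ) (ε : ℝ), 0 < ε → ε < 1 →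
    softO A b ((n : ℝ) ^ a / ε ^ j) ≤ m →
      freq (fun T : Fin m → (Fin r ↪ Fin n) => ¬ Approximates P (ε / 3) m (Instance.ofScopes T)) ≤ δ

theorem exists_natCast_ge_forall_exp_le {δ : ℝ} (hδ : 0 < δ) :
    ∃ N : ℕ, ∀ n : ℕ, N ≤ n → 2 * Real.exp (-n) ≤ δ := by
  obtain ⟨N, hN⟩ := exists_nat_gt (2 / δ)
  refine ⟨N, fun n hn => ?_⟩
  have h1 : 2 / δ < n := hN.trans_le (by exact_mod_cast hn)
  have h2 := Real.add_one_le_exp (n : ℝ)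
  rw [div_lt_iff₀ hδ] at h1
  rw [Real.exp_neg, ← div_eq_mul_inv, div_le_iff₀ (Real.exp_pos _)]
  nlinarith

theorem approximatesBeyond_of_plentiful [Nonempty D] {P : ValuedRel D r} {S : SVR D r} {k : ℕ}
    (hPS : HasSupport P S) (hk : S.Plentiful k) (hkr : k ≤ r) :
    ∃ A : ℝ, 1 ≤ A ∧ ApproximatesBeyond P (r - k + 1) 2 A 0 := by
  obtain ⟨K, hK, N, h⟩ := exists_freq_not_approximates_le hPS hk hkr
  refine ⟨9 * K, by linarith, fun δ hδ => ?_⟩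
  obtain ⟨N', hN'⟩ := exists_natCast_ge_forall_exp_le hδ
  refine ⟨max N N', fun n hn m ε hε hε1 hm => ?_⟩
  refine (h n (le_of_max_le_left hn) m (ε / 3) (by positivity) (by linarith) ?_).trans
    (hN' n (le_of_max_le_right hn))
  refine le_trans (le_of_eq ?_) hm
  simp only [softO, pow_zero, mul_one]
  field_simp
  norm_num

/-- If `k = r`, then a marginally uniform relation is constant, as the histogram of a constant tuple
is tight, and rigid with respect to the whole domain. -/
theorem TupleUniform.eq_of_arity [Nonempty D] {P : ValuedRel D r} {S : SVR D r}
    (hS : S.Plentiful r) (hne : ∃ h, S h ≠ 0) (hP : TupleUniform P S r) (t u : Fin r → D) :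
    P t = P u := by
  obtain ⟨h, hh⟩ := hne
  obtain ⟨d⟩ := ‹Nonempty D›
  obtain ⟨g, hg, -, hgd⟩ := hS d h hh
  have hgr : g.1 d = r := le_antisymm (hist_le g d) hgd
  have h0 : ∀ e, e ≠ d → g.1 e = 0 := fun e he => by
    have h3 := Finset.add_sum_erase Finset.univ g.1 (Finset.mem_univ d)
    rw [g.2, hgr] at h3
    have h4 : ∑ x ∈ Finset.univ.erase d, g.1 x = 0 := by omega
    exact Finset.sum_eq_zero_iff.1 h4 e (Finset.mem_erase.2 ⟨he, Finset.mem_univ e⟩)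
  have htight : S.Tight d r g := ⟨hg, fun f _ hfg => hist_ext_of_ne d fun e he => by
    have := hfg e he
    rw [h0 e he] at this ⊢
    omega, hgr⟩
  have hrigid : S.Rigid d Finset.univ g :=
    ⟨hg, Finset.mem_univ d, fun e _ he => h0 e he, fun f _ _ => f.2.trans hgr.symm⟩
  obtain ⟨s, hs⟩ := exists_hist_eq g
  rw [← hP d _ g htight hrigid s t hs fun i => Or.inl ⟨Finset.mem_univ _, Finset.mem_univ _⟩,
    ← hP d _ g htight hrigid s u hs fun i => Or.inl ⟨Finset.mem_univ _, Finset.mem_univ _⟩]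

theorem density_of_const {n : ℕ} {P : ValuedRel D r} (hP : ∀ t u, P t = P u) (hrn : r ≤ n)
    (ψ : Fin n → D) (t : Fin r → D) : density P ψ = P t := by
  have h : (0 : ℝ) < n.descFactorial r := by exact_mod_cast Nat.descFactorial_pos.2 hrn
  simp only [density, mean, hP _ t]
  rw [Finset.sum_const, Finset.card_univ, Fintype.card_embedding_eq]
  simp only [Fintype.card_fin, nsmul_eq_mul]
  field_simp

theorem approximates_of_const {n : ℕ} {P : ValuedRel D r} (hP : ∀ t u, P t = P u) (hrn : r ≤ n)
    {ε w : ℝ} (hε : 0 ≤ ε) (hw : 0 ≤ w) {C : Instance r n} (hC : ∑ i, C.weight i = w) :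
    Approximates P ε w C := by
  intro ψ
  have h1 : sat P C ψ = w * density P ψ := by
    rw [sat, ← hC, Finset.sum_mul]
    exact Finset.sum_congr rfl fun i _ => by rw [density_of_const hP hrn ψ]
  rw [h1, sub_self, abs_zero]
  exact mul_nonneg hε (mul_nonneg hw (density_nonneg P ψ))

/-- For a marginally uniform relation, random instances with `Õ(n ^ (r - k) / ε ^ 3)` constraints
approximate the complete instance. If `k = r`, then the relation is constant and no concentration
is needed. -/
theorem approximatesBeyond_of_uniform [Nonempty D] {P : ValuedRel D r} {S : SVR D r} {k : ℕ}
    (hPS : HasSupport P S) (hk : S.Plentiful k) (hne : ∃ h, S h ≠ 0) (hkr : k ≤ r)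
    (hP : TupleUniform P S k) :
    ∃ A : ℝ, 1 ≤ A ∧ ApproximatesBeyond P (r - k) 3 A 1 := by
  rcases hkr.eq_or_lt with rfl | hkr
  · have hc := hP.eq_of_arity hk hne
    refine ⟨1, le_rfl, fun δ hδ => ⟨k, fun n hn m ε hε hε1 _ => ?_⟩⟩
    refine le_trans (le_of_eq ?_) hδ.le
    have : ∀ T : Fin m → (Fin k ↪ Fin n), Approximates P (ε / 3) m (Instance.ofScopes T) :=
      fun T => approximates_of_const hc hn (by positivity) (Nat.cast_nonneg m)
        (by simp only [Instance.ofScopes, Finset.sum_const, nsmul_eq_mul, mul_one]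
            exact congrArg Nat.cast (Finset.card_fin m))
    simp [freq, this]
  · obtain ⟨K, C, hK, N, h⟩ := exists_freq_not_approximates_le_of_uniform hPS hk hkr hP
    refine ⟨27 * K, by linarith, fun δ hδ => ?_⟩
    obtain ⟨N', hN'⟩ := exists_nat_gt (C / δ)
    refine ⟨max N (max N' 1), fun n hn m ε hε hε1 hm => ?_⟩
    have hn1 : 1 ≤ n := (le_max_right _ _).trans ((le_max_right _ _).trans hn)
    have hnN : N' ≤ n := (le_max_left _ _).trans ((le_max_right _ _).trans hn)
    have hn0 : (1 : ℝ) ≤ n := by exact_mod_cast hn1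
    refine (h n (le_of_max_le_left hn) m (ε / 3) (by positivity) (by linarith) ?_).trans ?_
    · refine le_trans ?_ hm
      simp only [softO, pow_one]
      have hf := one_le_pow_div_pow hn1 hε hε1.le (r - k) 3
      have hnf : (n : ℝ) ≤ 1 + (n : ℝ) ^ (r - k) / ε ^ 3 := by
        have h1 : (n : ℝ) ≤ (n : ℝ) ^ (r - k) := le_self_pow₀ hn0 (by omega)
        have h2 : (n : ℝ) ^ (r - k) ≤ (n : ℝ) ^ (r - k) / ε ^ 3 :=
          le_div_self (by positivity) (by positivity) (pow_le_one₀ hε.le hε1.le)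
        linarith
      have hlog : Real.log n ≤ Real.log (1 + (n : ℝ) ^ (r - k) / ε ^ 3) :=
        Real.log_le_log (by linarith) hnf
      calc K * ((n : ℝ) ^ (r - k) * (1 + Real.log n)) / (ε / 3) ^ 3
          = 27 * K * ((n : ℝ) ^ (r - k) / ε ^ 3) * (1 + Real.log n) := by
            field_simp; norm_num
        _ ≤ _ := by gcongr
    · rw [div_le_iff₀ (by linarith)]
      rw [div_lt_iff₀ hδ] at hN'
      have : (N' : ℝ) ≤ n := by exact_mod_cast hnN
      nlinarith

/-- The complete instance has small approximations of every total weight. -/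
theorem ApproximatesBeyond.exists_small {P : ValuedRel D r} {a j : ℕ} {A : ℝ} {b : ℕ}
    (hA : 1 ≤ A) (h : ApproximatesBeyond P a j A b) :
    ∃ N : ℕ, ∀ n : ℕ, N ≤ n → ∀ ε w : ℝ, 0 < ε → ε < 1 → 0 ≤ w →
      ∃ C : Instance r n, Approximates P (ε / 3) w C ∧
        (C.size : ℝ) ≤ softO (2 * A) b ((n : ℝ) ^ a / ε ^ j) := by
  obtain ⟨N, hN⟩ := h (1 / 2) (by norm_num)
  refine ⟨max N (max r 1), fun n hn ε w hε hε1 hw => ?_⟩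
  have hn1 : 1 ≤ n := (le_max_right _ _).trans ((le_max_right _ _).trans hn)
  have hrn : r ≤ n := (le_max_left _ _).trans ((le_max_right _ _).trans hn)
  have hf := one_le_pow_div_pow hn1 hε hε1.le a j
  have hs : 1 ≤ softO A b ((n : ℝ) ^ a / ε ^ j) := hf.trans (le_softO hA (by linarith))
  set s := softO A b ((n : ℝ) ^ a / ε ^ j) with hsdef
  have hm : s ≤ (⌈s⌉₊ : ℝ) := Nat.le_ceil s
  have := nonempty_scopes hrn
  obtain ⟨T, hT⟩ := exists_of_freq_not_lt_one (lt_of_le_of_lt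
    (hN n (le_of_max_le_left hn) ⌈s⌉₊ ε hε hε1 hm) (by norm_num))
  have hm0 : (0 : ℝ) < (⌈s⌉₊ : ℝ) := by linarith
  have h1 := hT.scale (a := w / ⌈s⌉₊) (by positivity)
  rw [div_mul_cancel₀ _ hm0.ne'] at h1
  refine ⟨_, h1, ?_⟩
  rw [softO_mul, ← hsdef]
  have := (Nat.ceil_lt_add_one (show 0 ≤ s by linarith)).le
  simp only [Instance.scale, Instance.ofScopes]
  linarith

theorem IsSparsifier.refl {n : ℕ} (P : ValuedRel D r) {ε : ℝ} (hε : 0 ≤ ε) (C : Instance r n) :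
    IsSparsifier P ε C C := by
  intro ψ
  have h : 0 ≤ sat P C ψ := Finset.sum_nonneg fun i _ =>
    mul_nonneg (C.weight_nonneg i) (Nat.cast_nonneg _)
  constructor <;> nlinarith

/-- A long random instance is sparsified by a scaled short one, as both approximate the complete
instance. An instance that is not long is its own sparsifier. -/
theorem ApproximatesBeyond.whp_sparsifiable {P : ValuedRel D r} {a j : ℕ} {A : ℝ} {b : ℕ}
    (hA : 1 ≤ A) (h : ApproximatesBeyond P a j A b) :
    WHP r (fun _ _ ε => 0 < ε ∧ ε < 1) (fun n m ε =>
      SparsifiableTo P ε (softO (2 * A) b (min (m : ℝ) ((n : ℝ) ^ a / ε ^ j)))) := by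
  intro δ hδ
  obtain ⟨N, hN⟩ := h δ hδ
  obtain ⟨N', hN'⟩ := h.exists_small hA
  refine ⟨max (max N N') (max r 1), fun n hn m ε ⟨hε, hε1⟩ => ?_⟩
  have hn1 : 1 ≤ n := (le_max_right _ _).trans ((le_max_right _ _).trans hn)
  have hrn : r ≤ n := (le_max_left _ _).trans ((le_max_right _ _).trans hn)
  have hnN : N ≤ n := (le_max_left _ _).trans ((le_max_left _ _).trans hn)
  have hnN' : N' ≤ n := (le_max_right _ _).trans ((le_max_left _ _).trans hn)
  have hf := one_le_pow_div_pow hn1 hε hε1.le a j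
  have := nonempty_scopes hrn
  set f := (n : ℝ) ^ a / ε ^ j with hfdef
  have hsf := le_softO (A := A) (b := b) hA (show 0 ≤ f by linarith)
  have htwo : softO A b f ≤ softO (2 * A) b f := by rw [softO_mul]; linarith
  rw [randomProb_eq_freq]
  by_cases hm : softO A b f ≤ m
  · refine one_sub_le_freq ((freq_mono fun T hT => ?_).trans (hN n hnN m ε hε hε1 hm))
    refine fun happ => hT ?_
    obtain ⟨C, hC, hsize⟩ := hN' n hnN' ε m hε hε1 (Nat.cast_nonneg m)
    refine ⟨C, isSparsifier_of_approximates hε hε1.le (Nat.cast_nonneg m) happ hC, ?_⟩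
    rwa [min_eq_right (hsf.trans hm)]
  · rw [freq_of_forall]
    · linarith
    · intro T
      refine ⟨_, IsSparsifier.refl P hε.le _, ?_⟩
      simp only [Instance.ofScopes]
      rcases le_total (m : ℝ) f with hmf | hmf
      · rw [min_eq_left hmf]
        exact le_softO (by linarith) (Nat.cast_nonneg m)
      · rw [min_eq_right hmf]
        exact (not_le.1 hm).le.trans htwo

/-- The instance in which every constraint of `C` is replaced by all its reorderings. -/
noncomputable def Instance.symm {n : ℕ} (C : Instance r n) : Instance r n where
  size := Fintype.card (Fin C.size × Equiv.Perm (Fin r))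
  scope := fun i => ((Fintype.equivFin _).symm i).2.toEmbedding.trans
    (C.scope ((Fintype.equivFin _).symm i).1)
  weight := fun i => C.weight ((Fintype.equivFin _).symm i).1
  weight_nonneg := fun _ => C.weight_nonneg _

theorem sat_symm {n : ℕ} (R : ValuedRel D r) (C : Instance r n) (ψ : Fin n → D) :
    sat R C.symm ψ = sat (fun t => R.Sym (hist t)) C ψ := by
  have h1 : sat R C.symm ψ = ∑ p : Fin C.size × Equiv.Perm (Fin r),
      C.weight p.1 * (R (fun j => ψ (C.scope p.1 (p.2 j))) : ℝ) :=
    (Fintype.equivFin (Fin C.size × Equiv.Perm (Fin r))).symm.sum_comp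
      fun p => C.weight p.1 * (R (fun j => ψ (C.scope p.1 (p.2 j))) : ℝ)
  rw [h1, Fintype.sum_prod_type, sat]
  refine Finset.sum_congr rfl fun i _ => ?_
  rw [← sum_perm_eq_sym]
  push_cast
  rw [Finset.mul_sum]
  rfl

theorem density_comp_hist {n : ℕ} (R : ValuedRel D r) (ψ : Fin n → D) :
    density (fun t => R.Sym (hist t)) ψ = r ! * density R ψ := by
  have h1 : total (fun t => R.Sym (hist t)) ψ = r ! * total R ψ := by
    simp only [total, ← sum_perm_eq_sym]
    rw [Finset.sum_comm]
    have : ∀ σ : Equiv.Perm (Fin r), ∑ T : Fin r ↪ Fin n, R ((fun j => ψ (T j)) ∘ σ) =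
        ∑ T : Fin r ↪ Fin n, R fun j => ψ (T j) := fun σ =>
      (Equiv.embeddingCongr σ.symm (Equiv.refl (Fin n))).sum_comp
        fun T : Fin r ↪ Fin n => R fun j => ψ (T j)
    simp [this, Fintype.card_perm]
  rw [density_eq, density_eq, h1]
  push_cast
  ring

theorem Approximates.symm {n : ℕ} {R : ValuedRel D r} {ε w : ℝ} {C : Instance r n}
    (h : Approximates (fun t => R.Sym (hist t)) ε w C) : Approximates R ε (w * r !) C.symm := by
  intro ψ
  have := h ψ
  rwa [← sat_symm, density_comp_hist, ← mul_assoc] at this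

/-- Upper bound for the case in which only the symmetrization is marginally uniform: long random
instances approximate the complete instance, which is sparsified by symmetrizing a short random
instance. -/
theorem whp_sparsifiable_of_sym [Nonempty D] {R : ValuedRel D r} {k : ℕ}
    (hk : R.Sym.Plentiful k) (hne : ∃ h, R.Sym h ≠ 0) (hkr : k ≤ r)
    (hR : R.Sym.MarginallyUniform k) :
    ∃ (κ A : ℝ) (b : ℕ), 0 < κ ∧ 0 < A ∧
      WHP r (fun n m ε => 0 < ε ∧ ε < 1 ∧ κ * (n : ℝ) ^ (r - k + 1) / ε ^ 2 ≤ (m : ℝ))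
        (fun n _ ε => SparsifiableTo R ε (softO A b ((n : ℝ) ^ (r - k) / ε ^ 3))) := by
  obtain ⟨κ, hκ, happ⟩ := approximatesBeyond_of_plentiful (hasSupport_sym R) hk hkr
  obtain ⟨A, hA, hsym⟩ := approximatesBeyond_of_uniform (hasSupport_comp_hist R.Sym) hk hne hkr
    (tupleUniform_comp_hist hR)
  have hfac : (0 : ℝ) < (r ! : ℝ) := by exact_mod_cast Nat.factorial_pos r
  refine ⟨κ, r ! * (2 * A), 1, by linarith, by positivity, fun δ hδ => ?_⟩
  obtain ⟨N, hN⟩ := happ δ hδ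
  obtain ⟨N', hN'⟩ := hsym.exists_small hA
  refine ⟨max (max N N') r, fun n hn m ε ⟨hε, hε1, hm⟩ => ?_⟩
  have hrn : r ≤ n := (le_max_right _ _).trans hn
  have hnN : N ≤ n := (le_max_left _ _).trans ((le_max_left _ _).trans hn)
  have hnN' : N' ≤ n := (le_max_right _ _).trans ((le_max_left _ _).trans hn)
  have := nonempty_scopes hrn
  rw [randomProb_eq_freq]
  refine one_sub_le_freq ((freq_mono fun T hT => ?_).trans (hN n hnN m ε hε hε1 ?_))
  · refine fun happ => hT ?_
    obtain ⟨C, hC, hsize⟩ := hN' n hnN' ε (m / r !) hε hε1 (by positivity)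
    have h1 := hC.symm
    rw [div_mul_cancel₀ _ hfac.ne'] at h1
    refine ⟨_, isSparsifier_of_approximates hε hε1.le (Nat.cast_nonneg m) happ h1, ?_⟩
    rw [softO_mul]
    have h2 : C.symm.size = C.size * r ! := by
      simp [Instance.symm, Fintype.card_perm]
    rw [h2]
    push_cast
    rw [mul_comm]
    gcongr
  · simpa [softO, mul_div_assoc] using hm

end Upper

/-! ### Overlaps of random scopes -/

section Overlaps

variable {r n : ℕ}

theorem pow_le_two_pow_mul_descFactorial (hn : 2 * r ≤ n) :
    n ^ r ≤ 2 ^ r * n.descFactorial r := by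
  calc n ^ r ≤ (2 * (n + 1 - r)) ^ r := Nat.pow_le_pow_left (by omega) r
    _ = 2 ^ r * (n + 1 - r) ^ r := mul_pow _ _ _
    _ ≤ _ := Nat.mul_le_mul_left _ (Nat.pow_sub_le_descFactorial n r)

theorem freq_forall_mem_eq_le (hn : 2 * r ≤ n) (hn0 : 0 < n) (J : Finset (Fin r))
    (f : Fin r → Fin n) :
    freq (fun y : Fin r ↪ Fin n => ∀ j ∈ J, y j = f j) ≤ 2 ^ r / n ^ J.card := by
  classical
  have hJ : J.card ≤ r := by simpa using Finset.card_le_univ J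
  have h1 : Nat.card {y : Fin r ↪ Fin n // ∀ j ∈ J, y j = f j} ≤ n ^ (r - J.card) := by
    have : Nat.card ({j // j ∉ J} → Fin n) = n ^ (r - J.card) := by
      rw [Nat.card_eq_fintype_card, Fintype.card_fun, Fintype.card_fin,
        Fintype.card_subtype_compl, Fintype.card_fin, Fintype.card_coe]
    rw [← this]
    refine Nat.card_le_card_of_injective (fun y j => y.1 j.1) fun y z h => ?_
    ext j
    by_cases hj : j ∈ J
    · rw [y.2 j hj, z.2 j hj]
    · exact congrArg Fin.val (congrFun h ⟨j, hj⟩)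
  have h2 := pow_le_two_pow_mul_descFactorial hn
  have h3 : (0 : ℝ) < n.descFactorial r := by
    exact_mod_cast Nat.descFactorial_pos.2 (by omega : r ≤ n)
  have h4 : Nat.card (Fin r ↪ Fin n) = n.descFactorial r := by
    rw [Nat.card_eq_fintype_card, Fintype.card_embedding_eq, Fintype.card_fin, Fintype.card_fin]
  rw [freq, h4, div_le_div_iff₀ h3 (by positivity)]
  calc _ ≤ ((n ^ (r - J.card) : ℕ) : ℝ) * n ^ J.card := by gcongr
    _ = ((n ^ r : ℕ) : ℝ) := by
        push_cast
        rw [← pow_add, Nat.sub_add_cancel hJ]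
    _ ≤ _ := by exact_mod_cast h2

/-- The number of common variables of two scopes. -/
def overlap (x y : Fin r ↪ Fin n) : ℕ := (Finset.univ.map x ∩ Finset.univ.map y).card

theorem overlap_comm (x y : Fin r ↪ Fin n) : overlap x y = overlap y x := by
  rw [overlap, overlap, Finset.inter_comm]

theorem freq_le_overlap_le (hn : 2 * r ≤ n) (hn0 : 0 < n) (q : ℕ) (x : Fin r ↪ Fin n) :
    freq (fun y : Fin r ↪ Fin n => q ≤ overlap x y) ≤ 4 ^ r * r ^ r / n ^ q := by
  classical
  have hn1 : (1 : ℝ) ≤ n := by exact_mod_cast hn0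
  refine (freq_le_sum (Finset.univ.filter fun p : Finset (Fin r) × (Fin r → Fin r) => q ≤ p.1.card)
    (q := fun p y => ∀ j ∈ p.1, y j = x (p.2 j)) fun y hy => ?_).trans ?_
  · have hf : ∀ j, ∃ i, (∃ i', y j = x i') → y j = x i := fun j => by
      by_cases h : ∃ i', y j = x i'
      · exact ⟨h.choose, fun _ => h.choose_spec⟩
      · exact ⟨j, fun h' => absurd h' h⟩
    choose f hf using hf
    refine ⟨(Finset.univ.filter fun j => ∃ i', y j = x i', f), ?_, fun j hj =>
      hf j (Finset.mem_filter.1 hj).2⟩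
    simp only [Finset.mem_filter, Finset.mem_univ, true_and]
    refine hy.trans ?_
    rw [overlap, ← Finset.card_map y]
    refine Finset.card_le_card fun v hv => ?_
    obtain ⟨h1, h2⟩ := Finset.mem_inter.1 hv
    obtain ⟨i, -, rfl⟩ := Finset.mem_map.1 h1
    obtain ⟨j, -, hj⟩ := Finset.mem_map.1 h2
    exact Finset.mem_map.2 ⟨j, Finset.mem_filter.2 ⟨Finset.mem_univ j, i, hj⟩, hj⟩
  · calc _ ≤ ∑ p ∈ Finset.univ.filter fun p : Finset (Fin r) × (Fin r → Fin r) => q ≤ p.1.card,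
          (2 : ℝ) ^ r / n ^ q := by
          refine Finset.sum_le_sum fun p hp => (freq_forall_mem_eq_le hn hn0 _ _).trans ?_
          gcongr
          exact (Finset.mem_filter.1 hp).2
      _ ≤ ∑ _p : Finset (Fin r) × (Fin r → Fin r), (2 : ℝ) ^ r / n ^ q :=
          Finset.sum_le_sum_of_subset_of_nonneg (Finset.subset_univ _) fun _ _ _ => by positivity
      _ = _ := by
          rw [Finset.sum_const, Finset.card_univ, Fintype.card_prod, Fintype.card_finset,
            Fintype.card_fun, Fintype.card_fin, nsmul_eq_mul]
          push_cast
          rw [show (4 : ℝ) = 2 * 2 by norm_num, mul_pow]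
          ring

/-- The constraints that share less than `q` variables with every other constraint. -/
def isolated (q : ℕ) {m : ℕ} (S : Fin m → (Fin r ↪ Fin n)) : Finset (Fin m) :=
  Finset.univ.filter fun i => ∀ j, j ≠ i → overlap (S i) (S j) < q

theorem freq_comp_equiv {X : Type*} (e : X ≃ X) (p : X → Prop) :
    freq (fun x => p (e x)) = freq p := by
  rw [freq, freq, Nat.card_congr (e.subtypeEquiv (q := p) fun _ => Iff.rfl)]

/-- A constraint that is not isolated collides with an earlier one in `S` or in the reversal of
`S`. -/
theorem le_card_isolated_add (q : ℕ) {m : ℕ} (S : Fin m → (Fin r ↪ Fin n)) :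
    m ≤ (isolated q S).card + (collisions (fun x y => q ≤ overlap x y) m S +
      collisions (fun x y => q ≤ overlap x y) m (S ∘ Fin.revPerm)) := by
  classical
  set A := Finset.univ.filter fun j : Fin m => (j : ℕ) < m ∧ ∃ i < j, q ≤ overlap (S i) (S j)
  set A' := Finset.univ.filter fun j : Fin m =>
    (j : ℕ) < m ∧ ∃ i < j, q ≤ overlap ((S ∘ Fin.revPerm) i) ((S ∘ Fin.revPerm) j)
  have hA : collisions (fun x y => q ≤ overlap x y) m S = A.card := by
    simp only [collisions, A]
  have hA' : collisions (fun x y => q ≤ overlap x y) m (S ∘ Fin.revPerm) = A'.card := by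
    simp only [collisions, A']
  rw [hA, hA']
  have hsub : (Finset.univ : Finset (Fin m)) ⊆
      isolated q S ∪ (A ∪ A'.map Fin.revPerm.toEmbedding) := by
    intro i _
    by_cases hi : i ∈ isolated q S
    · exact Finset.mem_union_left _ hi
    refine Finset.mem_union_right _ ?_
    simp only [isolated, Finset.mem_filter, Finset.mem_univ, true_and, not_forall, not_lt] at hi
    obtain ⟨j, hji, hj⟩ := hi
    rcases lt_or_gt_of_ne hji with h | h
    · refine Finset.mem_union_left _ (Finset.mem_filter.2 ⟨Finset.mem_univ i, i.2, j, h, ?_⟩)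
      rwa [overlap_comm]
    · refine Finset.mem_union_right _ (Finset.mem_map.2 ⟨i.rev, Finset.mem_filter.2
        ⟨Finset.mem_univ _, i.rev.2, j.rev, Fin.rev_lt_rev.2 h, ?_⟩, by simp⟩)
      simpa [overlap_comm] using hj
  have := Finset.card_le_card hsub
  rw [Finset.card_univ, Fintype.card_fin] at this
  refine this.trans ((Finset.card_union_le _ _).trans (Nat.add_le_add_left ?_ _))
  refine (Finset.card_union_le _ _).trans ?_
  rw [Finset.card_map]

/-- A random instance with sufficiently less than `n ^ q` constraints has many isolated ones. -/
theorem freq_not_le_isolated_le (hn : 2 * r ≤ n) (hn0 : 0 < n) {q m : ℕ} (hm0 : 0 < m)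
    (hm : (m : ℝ) ≤ n ^ q / (32 * (4 ^ r * (r + 1) ^ r))) :
    freq (fun S : Fin m → (Fin r ↪ Fin n) => ¬ m ≤ 2 * (isolated q S).card) ≤
      256 * (4 ^ r * (r + 1) ^ r / n ^ q) := by
  have := nonempty_scopes (show r ≤ n by omega)
  set δ : ℝ := 4 ^ r * (r + 1) ^ r / n ^ q with hδ
  have hn1 : (0 : ℝ) < n := by exact_mod_cast hn0
  have hδ0 : 0 < δ := by positivity
  have hrel : ∀ x : Fin r ↪ Fin n,
      freq (fun y : Fin r ↪ Fin n => q ≤ overlap x y) ≤ δ := fun x => by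
    refine (freq_le_overlap_le hn hn0 q x).trans ?_
    rw [hδ]
    gcongr
    linarith
  have hmδ : 32 * (m * δ) ≤ 1 := by
    rw [le_div_iff₀ (by positivity)] at hm
    rw [hδ, ← mul_div_assoc, ← mul_div_assoc, div_le_one (by positivity)]
    linarith
  have h1 := freq_collisions_ge_le (fun x y : Fin r ↪ Fin n => q ≤ overlap x y) le_rfl hm0 hδ0
    hmδ hrel
  have h2 := freq_comp_equiv (Equiv.arrowCongr (Fin.revPerm (n := m)) (Equiv.refl (Fin r ↪ Fin n)))
    (fun S => m ≤ 4 * collisions (fun x y => q ≤ overlap x y) m S)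
  have h3 : freq (fun S : Fin m → (Fin r ↪ Fin n) =>
      m ≤ 4 * collisions (fun x y => q ≤ overlap x y) m (S ∘ Fin.revPerm)) ≤ 128 * δ :=
    le_trans (le_of_eq h2) h1
  refine (freq_or_le fun S hS => ?_).trans ((add_le_add h1 h3).trans (by linarith))
  have := le_card_isolated_add q S
  by_contra! h
  omega

end Overlaps

/-! ### Assignments around a tight and rigid histogram -/

section Core

variable {D : Type*} [Fintype D] [DecidableEq D] {r n : ℕ}

/-- The variables of a scope at the positions where the tuple `s` is not in `E`. -/
def core (E : Finset D) (s : Fin r → D) (U : Fin r ↪ Fin n) : {i // s i ∉ E} ↪ Fin n :=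
  (Function.Embedding.subtype _).trans U

/-- The assignment `ψ` agrees with `s` on the core `T` and takes values in `E` elsewhere. -/
def Compatible (E : Finset D) (s : Fin r → D) (T : {i // s i ∉ E} ↪ Fin n) (ψ : Fin n → D) :
    Prop :=
  (∀ p, ψ (T p) = s p) ∧ ∀ v, v ∉ Set.range T → ψ v ∈ E

/-- The scope `U` contains all variables of the core `T`. -/
def ContainsCore {ι : Type*} (T : ι ↪ Fin n) (U : Fin r ↪ Fin n) : Prop := ∀ p, ∃ j, U j = T p

theorem containsCore_core (E : Finset D) (s : Fin r → D) (U : Fin r ↪ Fin n) :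
    ContainsCore (core E s U) U := fun p => ⟨p.1, rfl⟩

/-- The assignment that agrees with `s` on the core `T` and is `d` elsewhere. -/
noncomputable def baseAssignment (E : Finset D) (s : Fin r → D) (T : {i // s i ∉ E} ↪ Fin n)
    (d : D) : Fin n → D :=
  Function.extend T (fun p => s p) fun _ => d

theorem baseAssignment_apply (E : Finset D) (s : Fin r → D) (T : {i // s i ∉ E} ↪ Fin n)
    (d : D) (p : {i // s i ∉ E}) : baseAssignment E s T d (T p) = s p :=
  T.injective.extend_apply _ _ _

theorem baseAssignment_of_notMem (E : Finset D) (s : Fin r → D) (T : {i // s i ∉ E} ↪ Fin n)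
    (d : D) {v : Fin n} (hv : v ∉ Set.range T) : baseAssignment E s T d v = d :=
  Function.extend_apply' _ _ _ fun ⟨p, hp⟩ => hv ⟨p, hp⟩

theorem compatible_baseAssignment {E : Finset D} (s : Fin r → D) (T : {i // s i ∉ E} ↪ Fin n)
    {d : D} (hd : d ∈ E) : Compatible E s T (baseAssignment E s T d) :=
  ⟨baseAssignment_apply E s T d, fun v hv => by rwa [baseAssignment_of_notMem E s T d hv]⟩

theorem Compatible.colorCount_eq {E : Finset D} {s : Fin r → D} {T : {i // s i ∉ E} ↪ Fin n}
    {ψ : Fin n → D} (h : Compatible E s T ψ) {e : D} (he : e ∉ E) :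
    colorCount ψ e = (hist s).1 e := by
  symm
  simp only [colorCount, hist]
  refine Finset.card_bij (fun i hi => T ⟨i, by rw [(Finset.mem_filter.1 hi).2]; exact he⟩) ?_ ?_ ?_
  · intro i hi
    simp only [Finset.mem_filter, Finset.mem_univ, true_and]
    rw [h.1]
    exact (Finset.mem_filter.1 hi).2
  · intro i hi j hj hij
    simpa using hij
  · intro v hv
    have hv' := (Finset.mem_filter.1 hv).2
    by_cases hT : v ∈ Set.range T
    · obtain ⟨p, rfl⟩ := hT
      refine ⟨p.1, Finset.mem_filter.2 ⟨Finset.mem_univ _, ?_⟩, rfl⟩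
      rw [← h.1, hv']
    · exact absurd (hv' ▸ h.2 v hT) he

variable {S : SVR D r} {d : D} {E : Finset D} {k : ℕ} {s : Fin r → D}

/-- By rigidity, a histogram in the support that fits into a compatible assignment agrees with the
given one off `E`. -/
theorem SVR.Rigid.eq_of_le (hr : S.Rigid d E (hist s)) {g : Hist D r} (hg : g ∈ S.supp)
    (hle : ∀ e, e ∉ E → g.1 e ≤ (hist s).1 e) : ∀ e, e ∉ E → g.1 e = (hist s).1 e := by
  have h1 := hr.2.2.2 g hg hle
  have h2 := hr.sum_eq
  have h3 := hist_sum_add_compl g E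
  have h4 := hist_sum_add_compl (hist s) E
  have h5 := (Finset.sum_eq_sum_iff_of_le (s := Eᶜ) fun e he => hle e (Finset.mem_compl.1 he)).1
    (by omega)
  exact fun e he => h5 e (Finset.mem_compl.2 he)

/-- Under a compatible assignment, only constraints that contain the core are satisfied. -/
theorem SVR.Rigid.containsCore {P : ValuedRel D r} (hPS : HasSupport P S)
    (hr : S.Rigid d E (hist s)) {T : {i // s i ∉ E} ↪ Fin n} {ψ : Fin n → D}
    (h : Compatible E s T ψ) {U : Fin r ↪ Fin n} (hU : P (fun j => ψ (U j)) ≠ 0) :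
    ContainsCore T U := by
  have hg := (hPS (hist fun j => ψ (U j))).2 ⟨_, rfl, hU⟩
  have heq := hr.eq_of_le hg fun e he => (hist_comp_le ψ U e).trans (h.colorCount_eq he).le
  intro p
  have hp := p.2
  have hcard : (Finset.univ.filter fun v => ψ v = s p).card ≤
      ((Finset.univ.filter fun j => ψ (U j) = s p).map U).card := by
    rw [Finset.card_map]
    exact ((h.colorCount_eq hp).trans (heq _ hp).symm).le
  have hsub : (Finset.univ.filter fun j => ψ (U j) = s p).map U ⊆
      Finset.univ.filter fun v => ψ v = s p := by
    intro v hv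
    obtain ⟨j, hj, rfl⟩ := Finset.mem_map.1 hv
    simpa using hj
  have hmem : T p ∈ (Finset.univ.filter fun j => ψ (U j) = s p).map U := by
    rw [Finset.eq_of_subset_of_card_le hsub hcard]
    simp [h.1 p]
  obtain ⟨j, -, hj⟩ := Finset.mem_map.1 hmem
  exact ⟨j, hj⟩

theorem SVR.Rigid.eq_of_mem (hr : S.Rigid d E (hist s)) {i : Fin r} (hi : s i ∈ E) : s i = d := by
  by_contra h
  have := hr.2.2.1 _ hi h
  simp only [hist, Finset.card_eq_zero, Finset.filter_eq_empty_iff] at this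
  exact this (Finset.mem_univ i) rfl

theorem SVR.Rigid.card_core (hr : S.Rigid d E (hist s)) (hk : (hist s).1 d = k) :
    Fintype.card {i // s i ∉ E} = r - k := by
  have h1 := hist_sum_add_compl (hist s) E
  rw [hr.sum_eq, hk] at h1
  have h2 : Fintype.card {i // s i ∉ E} = ∑ e ∈ Eᶜ, (hist s).1 e := by
    rw [Fintype.card_subtype, Finset.card_eq_sum_card_fiberwise (f := s) (t := Eᶜ)
      (fun i hi => by simpa using hi)]
    refine Finset.sum_congr rfl fun e he => ?_
    simp only [hist]
    congr 1
    ext i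
    simp only [Finset.mem_filter, Finset.mem_univ, true_and, and_iff_right_iff_imp]
    rintro rfl
    exact Finset.mem_compl.1 he
  omega

theorem SVR.Rigid.baseAssignment_comp (hr : S.Rigid d E (hist s)) {U : Fin r ↪ Fin n} :
    (fun j => baseAssignment E s (core E s U) d (U j)) = s := by
  funext j
  by_cases hj : s j ∈ E
  · rw [hr.eq_of_mem hj]
    refine baseAssignment_of_notMem E s _ d ?_
    rintro ⟨p, hp⟩
    have : p.1 = j := U.injective hp
    exact p.2 (this ▸ hj)
  · exact baseAssignment_apply E s (core E s U) d ⟨j, hj⟩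

open Classical in
theorem card_containsCore_le {ι : Type*} [Fintype ι] (U : Fin r ↪ Fin n) :
    (Finset.univ.filter fun T : ι ↪ Fin n => ContainsCore T U).card ≤ r ^ Fintype.card ι := by
  have : Fintype.card (ι → Fin r) = r ^ Fintype.card ι := by simp
  rw [← this, ← Fintype.card_subtype]
  refine Fintype.card_le_of_injective
    (fun (T : {T : ι ↪ Fin n // ContainsCore T U}) p => (T.2 p).choose) fun T T' h => ?_
  ext p
  rw [← (T.2 p).choose_spec, ← (T'.2 p).choose_spec]
  exact congrArg (fun j => (U j : ℕ)) (congrFun h p)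

end Core

/-! ### Lower bounds by counting cores and by recoloring isolated constraints -/

section Lower

open Classical

variable {D : Type*} [Fintype D] [DecidableEq D] {r n : ℕ}
  {R : ValuedRel D r} {S : SVR D r} {d : D} {E : Finset D} {k : ℕ} {s : Fin r → D}

/-- Every core of a constraint of the instance is also contained in a constraint of a
sparsifier. -/
theorem card_cores_le (hPS : HasSupport R S) (hr : S.Rigid d E (hist s)) (hs : R s ≠ 0) {m : ℕ}
    {U : Fin m → (Fin r ↪ Fin n)} {C' : Instance r n} {ε : ℝ} (hε : ε < 1)
    (h : IsSparsifier R ε (Instance.ofScopes U) C') :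
    (Finset.univ.image fun i => core E s (U i)).card ≤
      r ^ Fintype.card {i // s i ∉ E} * C'.size := by
  have hsub : (Finset.univ.image fun i => core E s (U i)) ⊆
      Finset.univ.biUnion fun j => Finset.univ.filter fun T => ContainsCore T (C'.scope j) := by
    intro T hT
    obtain ⟨i, -, rfl⟩ := Finset.mem_image.1 hT
    have h1 : 1 ≤ sat R (Instance.ofScopes U) (baseAssignment E s (core E s (U i)) d) := by
      rw [sat_ofScopes]
      have h2 := Finset.single_le_sum (f := fun i' =>
        (R (fun j => baseAssignment E s (core E s (U i)) d (U i' j)) : ℝ))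
        (fun _ _ => Nat.cast_nonneg _) (Finset.mem_univ i)
      rw [hr.baseAssignment_comp] at h2
      refine le_trans ?_ h2
      exact_mod_cast Nat.one_le_iff_ne_zero.2 hs
    have h2 := (h (baseAssignment E s (core E s (U i)) d)).1
    have h3 : sat R C' (baseAssignment E s (core E s (U i)) d) ≠ 0 := by
      have : 0 < (1 - ε) * sat R (Instance.ofScopes U) (baseAssignment E s (core E s (U i)) d) :=
        mul_pos (by linarith) (by linarith)
      linarith
    obtain ⟨j, -, hj⟩ := Finset.exists_ne_zero_of_sum_ne_zero h3
    refine Finset.mem_biUnion.2 ⟨j, Finset.mem_univ j, Finset.mem_filter.2 ⟨Finset.mem_univ _, ?_⟩⟩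
    refine hr.containsCore hPS (compatible_baseAssignment s _ hr.2.1) ?_
    exact fun h0 => right_ne_zero_of_mul hj (by rw [h0, Nat.cast_zero])
  refine (Finset.card_le_card hsub).trans (Finset.card_biUnion_le.trans ?_)
  refine (Finset.sum_le_sum fun j _ => card_containsCore_le (C'.scope j)).trans ?_
  rw [Finset.sum_const, Finset.card_univ, Fintype.card_fin, smul_eq_mul, mul_comm]

theorem le_card_cores_add {m a : ℕ} (ham : a ≤ m) (U : Fin m → (Fin r ↪ Fin n)) :
    a ≤ (Finset.univ.image fun i => core E s (U i)).card +
      collisions (fun x y => core E s x = core E s y) a U := by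
  have h1 : (Finset.univ.filter fun j : Fin m => (j : ℕ) < a).card = a := by
    rw [Fin.card_filter_val_lt, min_eq_right ham]
  have h2 := Finset.card_filter_add_card_filter_not
    (s := Finset.univ.filter fun j : Fin m => (j : ℕ) < a)
    (fun j => ∃ i < j, core E s (U i) = core E s (U j))
  rw [h1, Finset.filter_filter, Finset.filter_filter] at h2
  have h3 : (Finset.univ.filter fun j : Fin m =>
      (j : ℕ) < a ∧ ¬ ∃ i < j, core E s (U i) = core E s (U j)).card ≤
      (Finset.univ.image fun i => core E s (U i)).card := by
    refine Finset.card_le_card_of_injOn (fun i => core E s (U i)) (fun i _ => by simp) ?_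
    intro i hi j hj hij
    simp only [Finset.coe_filter, Finset.mem_univ, true_and, Set.mem_ofPred_eq] at hi hj
    by_contra hne
    rcases lt_or_gt_of_ne hne with h | h
    · exact hj.2 ⟨i, h, hij⟩
    · exact hi.2 ⟨j, h, hij.symm⟩
  have h4 : collisions (fun x y => core E s x = core E s y) a U =
      (Finset.univ.filter fun j : Fin m =>
      (j : ℕ) < a ∧ ∃ i < j, core E s (U i) = core E s (U j)).card := by
    simp only [collisions]
  omega

theorem freq_core_eq_le (hn : 2 * r ≤ n) (hn0 : 0 < n) (x : Fin r ↪ Fin n) :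
    freq (fun y => core E s x = core E s y) ≤ 2 ^ r / n ^ Fintype.card {i // s i ∉ E} := by
  rw [Fintype.card_subtype]
  refine le_trans (freq_mono fun y hy j hj => ?_) (freq_forall_mem_eq_le hn hn0 _ x)
  have := DFunLike.congr_fun hy ⟨j, (Finset.mem_filter.1 hj).2⟩
  exact this.symm

theorem mul_min_le_one {c x : ℝ} (hc1 : c ≤ 1) (hc : 0 ≤ c) (m : ℝ) (hx : x ≤ 1) :
    c * min m x ≤ 1 := by
  calc c * min m x ≤ c * 1 := mul_le_mul_of_nonneg_left ((min_le_right _ _).trans hx) hc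
    _ ≤ 1 := by linarith

theorem exists_natCast_ge_forall_div_pow_le (A : ℝ) {δ : ℝ} (hδ : 0 < δ) :
    ∃ N : ℕ, 0 < N ∧ ∀ n : ℕ, N ≤ n → ∀ q : ℕ, q ≠ 0 → A / (n : ℝ) ^ q ≤ δ := by
  obtain ⟨N, hN⟩ := exists_nat_gt (A / δ)
  refine ⟨N + 1, Nat.succ_pos N, fun n hn q hq => ?_⟩
  have hn1 : (1 : ℝ) ≤ n := by exact_mod_cast (Nat.succ_pos N).trans_le hn
  have h1 : A / δ < n := hN.trans (by exact_mod_cast hn)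
  rw [div_lt_iff₀ hδ] at h1
  rw [div_le_iff₀ (by positivity)]
  have h2 : (n : ℝ) ≤ (n : ℝ) ^ q := le_self_pow₀ hn1 hq
  nlinarith

/-- Every sparsifier has order `min m (n ^ (r - k))` constraints, as it has to contain the cores of
all constraints. -/
theorem whp_requires_of_preciselyPlentiful (R : ValuedRel D r) (hR : R.PreciselyPlentiful k) :
    ∃ ε₀ c : ℝ, 0 < ε₀ ∧ 0 < c ∧ WHP r (fun _ _ ε => 0 < ε ∧ ε ≤ ε₀) (fun n m ε =>
      SparsifierRequires R ε (c * min (m : ℝ) ((n : ℝ) ^ (r - k)))) := by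
  have hkr : k ≤ r := SVR.PreciselyPlentiful.le hR
  obtain ⟨d, h, ht⟩ := exists_tight hR
  obtain ⟨s, rfl, hs⟩ := (hasSupport_sym R h).1 ht.1
  have hr := ht.rigid_singleton
  have hcard := hr.card_core ht.2.2
  set a : ℝ := ((r : ℝ) + 1) ^ r with ha
  have ha1 : 1 ≤ a := one_le_pow₀ (by linarith [(Nat.cast_nonneg r : (0 : ℝ) ≤ r)])
  have har : ((r ^ (r - k) : ℕ) : ℝ) ≤ a := by
    push_cast
    calc (r : ℝ) ^ (r - k) ≤ ((r : ℝ) + 1) ^ (r - k) := by gcongr; linarith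
      _ ≤ _ := pow_le_pow_right₀ (by linarith [(Nat.cast_nonneg r : (0 : ℝ) ≤ r)]) (Nat.sub_le r k)
  have h2r : (1 : ℝ) ≤ 2 ^ r := one_le_pow₀ one_le_two
  set c : ℝ := 1 / (128 * 2 ^ r * a) with hc
  have hc0 : 0 < c := by positivity
  have hc1 : c ≤ 1 := by
    rw [hc, div_le_one (by positivity)]
    nlinarith
  refine ⟨1 / 2, c, by norm_num, hc0, fun δ hδ => ?_⟩
  obtain ⟨N, hN0, hN⟩ := exists_natCast_ge_forall_div_pow_le (128 * 2 ^ r) hδ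
  refine ⟨max N (max (2 * r) (32 * 2 ^ r)), fun n hn m ε ⟨hε, hε1⟩ => ?_⟩
  have hnN : N ≤ n := (le_max_left _ _).trans hn
  have hnr : 2 * r ≤ n := (le_max_left _ _).trans ((le_max_right _ _).trans hn)
  have hn32 : 32 * 2 ^ r ≤ n := (le_max_right _ _).trans ((le_max_right _ _).trans hn)
  have hn0 : 0 < n := hN0.trans_le hnN
  have := nonempty_scopes (show r ≤ n by omega)
  rw [randomProb_eq_freq]
  rcases Nat.eq_zero_or_pos m with rfl | hm
  · rw [freq_of_forall]
    · linarith
    · intro U C' _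
      rw [Nat.cast_zero, min_eq_left (by positivity), mul_zero]
      exact Nat.cast_nonneg _
  have hcores : ∀ (U : Fin m → (Fin r ↪ Fin n)) (C' : Instance r n),
      IsSparsifier R ε (Instance.ofScopes U) C' →
      ((Finset.univ.image fun i => core {d} s (U i)).card : ℝ) ≤ a * C'.size := by
    intro U C' hC'
    have h1 := card_cores_le (hasSupport_sym R) hr hs (by linarith) hC'
    rw [hcard] at h1
    calc _ ≤ ((r ^ (r - k) * C'.size : ℕ) : ℝ) := by exact_mod_cast h1
      _ = ((r ^ (r - k) : ℕ) : ℝ) * C'.size := by rw [Nat.cast_mul]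
      _ ≤ _ := mul_le_mul_of_nonneg_right har (Nat.cast_nonneg _)
  rcases hkr.eq_or_lt with hkr | hkr
  · -- If `k = r`, then the bound only says that the sparsifier is not empty.
    rw [freq_of_forall]
    · linarith
    · intro U C' hC'
      have h1 := hcores U C' hC'
      have h2 : 0 < (Finset.univ.image fun i => core {d} s (U i)).card :=
        Finset.card_pos.2 ⟨_, Finset.mem_image_of_mem _ (Finset.mem_univ ⟨0, hm⟩)⟩
      have h3 : C'.size ≠ 0 := by
        intro h0
        rw [h0, Nat.cast_zero, mul_zero] at h1
        have : (0 : ℝ) < ((Finset.univ.image fun i => core {d} s (U i)).card : ℝ) := by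
          exact_mod_cast h2
        linarith
      have h4 : (1 : ℝ) ≤ C'.size := by exact_mod_cast Nat.one_le_iff_ne_zero.2 h3
      refine (mul_min_le_one hc1 hc0.le m ?_).trans h4
      rw [hkr, Nat.sub_self, pow_zero]
  · set q := r - k with hq
    have hq0 : q ≠ 0 := by omega
    have hn1 : (1 : ℝ) ≤ n := by exact_mod_cast hn0
    set y : ℝ := (n : ℝ) ^ q / (32 * 2 ^ r) with hy
    have hy1 : 1 ≤ y := by
      rw [hy, le_div_iff₀ (by positivity), one_mul]
      calc (32 * 2 ^ r : ℝ) ≤ n := by exact_mod_cast hn32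
        _ ≤ _ := le_self_pow₀ hn1 hq0
    set a0 := min m ⌊y⌋₊ with ha0
    have hfl : 1 ≤ ⌊y⌋₊ := (Nat.one_le_floor_iff y).2 hy1
    have ha00 : 0 < a0 := lt_min hm hfl
    have ha0y : (a0 : ℝ) ≤ y :=
      le_trans (by exact_mod_cast min_le_right _ _) (Nat.floor_le (by linarith))
    have hmin : min (m : ℝ) ((n : ℝ) ^ q) ≤ 64 * 2 ^ r * a0 := by
      rcases le_total m ⌊y⌋₊ with h1 | h1
      · rw [ha0, min_eq_left h1]
        have : (0 : ℝ) ≤ m := Nat.cast_nonneg m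
        exact (min_le_left _ _).trans (by nlinarith)
      · rw [ha0, min_eq_right h1]
        refine (min_le_right _ _).trans ?_
        have h2 := Nat.lt_floor_add_one y
        have h3 : (1 : ℝ) ≤ ⌊y⌋₊ := by exact_mod_cast hfl
        have h4 : (n : ℝ) ^ q = 32 * 2 ^ r * y := by rw [hy]; field_simp
        rw [h4]
        nlinarith
    have hδ' : (0 : ℝ) < 2 ^ r / n ^ q := by positivity
    have hcoll := freq_collisions_ge_le (fun x y : Fin r ↪ Fin n => core {d} s x = core {d} s y)
      (min_le_left m ⌊y⌋₊) ha00 hδ' (by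
        calc 32 * (a0 * (2 ^ r / (n : ℝ) ^ q)) ≤ 32 * (y * (2 ^ r / (n : ℝ) ^ q)) := by gcongr
          _ = 1 := by rw [hy]; field_simp
          _ ≤ 1 := le_rfl) (fun x => by
        have := freq_core_eq_le (E := {d}) (s := s) hnr hn0 x
        rwa [hcard] at this)
    refine one_sub_le_freq (le_trans (freq_mono fun U hU => ?_) (hcoll.trans ?_))
    · by_contra hlt
      refine hU fun C' hC' => ?_
      have h1 := hcores U C' hC'
      have h2 := le_card_cores_add (E := {d}) (s := s) (min_le_left m ⌊y⌋₊) U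
      have h3 : a0 ≤ 2 * (Finset.univ.image fun i => core {d} s (U i)).card := by omega
      have h4 : (a0 : ℝ) ≤ 2 * ((Finset.univ.image fun i => core {d} s (U i)).card : ℝ) := by
        exact_mod_cast h3
      rw [hc, one_div_mul_eq_div, div_le_iff₀ (by positivity)]
      calc min (m : ℝ) ((n : ℝ) ^ q) ≤ 64 * 2 ^ r * a0 := hmin
        _ ≤ 64 * 2 ^ r * (2 * (a * C'.size)) := by gcongr; linarith
        _ = _ := by ring
    · rw [← mul_div_assoc]
      exact hN n hnN q hq0

/-- The variables outside the core `T` in the constraints of `C` that contain `T`. -/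
noncomputable def touched {ι : Type*} (C : Instance r n) (T : ι ↪ Fin n) : Finset (Fin n) :=
  Finset.univ.filter fun v => v ∉ Set.range T ∧ ∃ j, ContainsCore T (C.scope j) ∧
    v ∈ Set.range (C.scope j)

theorem mem_touched {ι : Type*} {C : Instance r n} {T : ι ↪ Fin n} {v : Fin n} :
    v ∈ touched C T ↔ v ∉ Set.range T ∧ ∃ j, ContainsCore T (C.scope j) ∧
      v ∈ Set.range (C.scope j) := by
  simp [touched]

theorem sum_card_touched_le {ι : Type*} [Fintype ι] (C : Instance r n) :
    ∑ T : ι ↪ Fin n, (touched C T).card ≤ r ^ Fintype.card ι * r * C.size := by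
  have h1 : ∀ T : ι ↪ Fin n, (touched C T).card ≤
      ∑ j, if ContainsCore T (C.scope j) then r else 0 := by
    intro T
    rw [← Finset.sum_filter]
    calc (touched C T).card ≤ ((Finset.univ.filter fun j => ContainsCore T (C.scope j)).biUnion
          fun j => Finset.univ.map (C.scope j)).card := by
          refine Finset.card_le_card fun v hv => ?_
          obtain ⟨-, j, hj, i, hi⟩ := mem_touched.1 hv
          exact Finset.mem_biUnion.2 ⟨j, by simpa using hj, by simpa using ⟨i, hi⟩⟩
      _ ≤ _ := Finset.card_biUnion_le
      _ = _ := Finset.sum_congr rfl fun j _ => by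
          rw [Finset.card_map, Finset.card_univ, Fintype.card_fin]
  calc _ ≤ ∑ T : ι ↪ Fin n, ∑ j, (if ContainsCore T (C.scope j) then r else 0) :=
        Finset.sum_le_sum fun T _ => h1 T
    _ = ∑ j, (Finset.univ.filter fun T : ι ↪ Fin n => ContainsCore T (C.scope j)).card * r := by
        rw [Finset.sum_comm]
        refine Finset.sum_congr rfl fun j _ => ?_
        rw [← Finset.sum_filter, Finset.sum_const, smul_eq_mul]
    _ ≤ ∑ _j : Fin C.size, r ^ Fintype.card ι * r := Finset.sum_le_sum fun j _ =>
        Nat.mul_le_mul_right _ (card_containsCore_le _)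
    _ = _ := by rw [Finset.sum_const, Finset.card_univ, Fintype.card_fin, smul_eq_mul, mul_comm]

/-- An instance does not distinguish compatible assignments that agree on its touched
variables. -/
theorem sat_eq_of_touched (hPS : HasSupport R S) (hr : S.Rigid d E (hist s))
    {T : {i // s i ∉ E} ↪ Fin n} {ψ ψ' : Fin n → D} (h : Compatible E s T ψ)
    (h' : Compatible E s T ψ') (C : Instance r n) (heq : ∀ v ∈ touched C T, ψ v = ψ' v) :
    sat R C ψ = sat R C ψ' := by
  refine Finset.sum_congr rfl fun j _ => ?_
  by_cases hj : ContainsCore T (C.scope j)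
  · congr 3
    funext i
    by_cases hi : C.scope j i ∈ Set.range T
    · obtain ⟨p, hp⟩ := hi
      rw [← hp, h.1, h'.1]
    · exact heq _ (mem_touched.2 ⟨hi, j, hj, i, rfl⟩)
  · have h1 : R (fun i => ψ (C.scope j i)) = 0 := by
      by_contra h0; exact hj (hr.containsCore hPS h h0)
    have h2 : R (fun i => ψ' (C.scope j i)) = 0 := by
      by_contra h0; exact hj (hr.containsCore hPS h' h0)
    rw [h1, h2]

theorem card_core_add_one_le_overlap {T : {i // s i ∉ E} ↪ Fin n} {x y : Fin r ↪ Fin n}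
    (hx : ContainsCore T x) (hy : ContainsCore T y) {j j' : Fin r} (hj : x j ∉ Set.range T)
    (hjj' : y j' = x j) : Fintype.card {i // s i ∉ E} + 1 ≤ overlap x y := by
  have h1 : (insert (x j) (Finset.univ.map T)).card = Fintype.card {i // s i ∉ E} + 1 := by
    rw [Finset.card_insert_of_notMem (by simpa using hj), Finset.card_map, Finset.card_univ]
  rw [← h1, overlap]
  refine Finset.card_le_card fun v hv => ?_
  rw [Finset.mem_inter]
  rcases Finset.mem_insert.1 hv with rfl | hv
  · exact ⟨by simp, by simpa using ⟨j', hjj'⟩⟩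
  · obtain ⟨p, -, rfl⟩ := Finset.mem_map.1 hv
    obtain ⟨i, hi⟩ := hx p
    obtain ⟨i', hi'⟩ := hy p
    exact ⟨by simpa using ⟨i, hi⟩, by simpa using ⟨i', hi'⟩⟩

theorem notMem_range_core {U : Fin r ↪ Fin n} {j : Fin r} (hj : s j ∈ E) :
    U j ∉ Set.range (core E s U) := by
  rintro ⟨p, hp⟩
  have : p.1 = j := U.injective hp
  exact p.2 (this ▸ hj)

/-- An isolated constraint meets other constraints with the same core only in the core. -/
theorem eq_of_isolated (hcard : Fintype.card {i // s i ∉ E} = r - k) {m : ℕ}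
    {U : Fin m → (Fin r ↪ Fin n)} {i i' : Fin m} (hi : i ∈ isolated (r - k + 1) U)
    (hi' : ContainsCore (core E s (U i)) (U i')) {j j' : Fin r} (hj : s j ∈ E)
    (hjj' : U i' j' = U i j) : i' = i := by
  by_contra hne
  have h1 := (Finset.mem_filter.1 hi).2 i' hne
  have h2 := card_core_add_one_le_overlap (containsCore_core E s (U i)) hi' (notMem_range_core hj)
    hjj'
  omega

/-- The isolated constraints with core `T` that avoid the touched variables of `C`. -/
noncomputable def freeConstraints (k : ℕ) (E : Finset D) (s : Fin r → D) {m : ℕ}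
    (U : Fin m → (Fin r ↪ Fin n)) (C : Instance r n) (T : {i // s i ∉ E} ↪ Fin n) :
    Finset (Fin m) :=
  (isolated (r - k + 1) U).filter fun i =>
    core E s (U i) = T ∧ ∀ j, s j ∈ E → U i j ∉ touched C T

theorem card_isolated_le_sum (hcard : Fintype.card {i // s i ∉ E} = r - k) {m : ℕ}
    (U : Fin m → (Fin r ↪ Fin n)) (C : Instance r n) :
    (isolated (r - k + 1) U).card ≤ ∑ T, (freeConstraints k E s U C T).card +
      ∑ T : {i // s i ∉ E} ↪ Fin n, (touched C T).card := by
  rw [← Finset.sum_add_distrib, Finset.card_eq_sum_card_fiberwise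
    (f := fun i => core E s (U i)) (t := Finset.univ) fun _ _ => by simp]
  refine Finset.sum_le_sum fun T _ => ?_
  have h1 : (isolated (r - k + 1) U).filter (fun i => core E s (U i) = T) ⊆
      freeConstraints k E s U C T ∪ (isolated (r - k + 1) U).filter fun i =>
        core E s (U i) = T ∧ ∃ j, s j ∈ E ∧ U i j ∈ touched C T := by
    intro i hi
    obtain ⟨hi1, hi2⟩ := Finset.mem_filter.1 hi
    by_cases h : ∃ j, s j ∈ E ∧ U i j ∈ touched C T
    · exact Finset.mem_union_right _ (Finset.mem_filter.2 ⟨hi1, hi2, h⟩)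
    · push Not at h
      exact Finset.mem_union_left _ (Finset.mem_filter.2 ⟨hi1, hi2, h⟩)
  refine (Finset.card_le_card h1).trans ((Finset.card_union_le _ _).trans
    (Nat.add_le_add_left ?_ _))
  rcases Finset.eq_empty_or_nonempty ((isolated (r - k + 1) U).filter fun i =>
      core E s (U i) = T ∧ ∃ j, s j ∈ E ∧ U i j ∈ touched C T) with h0 | ⟨i₀, hi₀⟩
  · rw [h0, Finset.card_empty]
    exact Nat.zero_le _
  obtain ⟨j₀, -⟩ := (Finset.mem_filter.1 hi₀).2.2
  have h2 : ∀ i, ∃ v, (core E s (U i) = T ∧ ∃ j, s j ∈ E ∧ U i j ∈ touched C T) →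
      v ∈ touched C T ∧ ∃ j, s j ∈ E ∧ U i j = v := by
    intro i
    by_cases h : core E s (U i) = T ∧ ∃ j, s j ∈ E ∧ U i j ∈ touched C T
    · obtain ⟨-, j, hj, hj'⟩ := id h
      exact ⟨U i j, fun _ => ⟨hj', j, hj, rfl⟩⟩
    · exact ⟨U i₀ j₀, fun h' => absurd h' h⟩
  choose f hf using h2
  refine Finset.card_le_card_of_injOn f (fun i hi => ?_) fun i hi i' hi' hii' => ?_
  · exact (hf i (Finset.mem_filter.1 hi).2).1
  · obtain ⟨hi1, hi2⟩ := Finset.mem_filter.1 hi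
    obtain ⟨hi1', hi2'⟩ := Finset.mem_filter.1 hi'
    obtain ⟨-, j, hj, hij⟩ := hf i hi2
    obtain ⟨-, j', hj', hij'⟩ := hf i' hi2'
    refine (eq_of_isolated hcard hi1 ?_ hj (hij'.trans (hii'.symm.trans hij.symm))).symm
    rw [hi2.1, ← hi2'.1]
    exact containsCore_core E s (U i')

/-- The base assignment of the core `T`, recolored from `s` to `t` on the free constraints. -/
noncomputable def recolored (k : ℕ) (E : Finset D) (s t : Fin r → D) {m : ℕ}
    (U : Fin m → (Fin r ↪ Fin n)) (C : Instance r n) (T : {i // s i ∉ E} ↪ Fin n) (d : D) :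
    Fin n → D := fun v =>
  if h : ∃ p : Fin m × Fin r, p.1 ∈ freeConstraints k E s U C T ∧ s p.2 ∈ E ∧ U p.1 p.2 = v then
    t h.choose.2 else baseAssignment E s T d v

theorem recolored_eq_base {t : Fin r → D} {m : ℕ} {U : Fin m → (Fin r ↪ Fin n)}
    {C : Instance r n} {T : {i // s i ∉ E} ↪ Fin n} {v : Fin n}
    (h : ∀ i ∈ freeConstraints k E s U C T, ∀ j, s j ∈ E → U i j ≠ v) :
    recolored k E s t U C T d v = baseAssignment E s T d v :=
  dif_neg fun ⟨p, h1, h2, h3⟩ => h p.1 h1 p.2 h2 h3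

theorem recolored_apply (hcard : Fintype.card {i // s i ∉ E} = r - k) {t : Fin r → D} {m : ℕ}
    {U : Fin m → (Fin r ↪ Fin n)} {C : Instance r n} {T : {i // s i ∉ E} ↪ Fin n} {i : Fin m}
    (hi : i ∈ freeConstraints k E s U C T) {j : Fin r} (hj : s j ∈ E) :
    recolored k E s t U C T d (U i j) = t j := by
  have h : ∃ p : Fin m × Fin r, p.1 ∈ freeConstraints k E s U C T ∧ s p.2 ∈ E ∧
      U p.1 p.2 = U i j := ⟨(i, j), hi, hj, rfl⟩
  rw [recolored, dif_pos h]
  obtain ⟨h1, h2, h3⟩ := h.choose_spec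
  obtain ⟨hi1, hi2, -⟩ := Finset.mem_filter.1 hi
  obtain ⟨-, hc, -⟩ := Finset.mem_filter.1 h1
  have hcont : ContainsCore (core E s (U i)) (U h.choose.1) := by
    rw [show core E s (U i) = core E s (U h.choose.1) from hi2.trans hc.symm]
    exact containsCore_core E s _
  have heq : h.choose.1 = i := eq_of_isolated hcard hi1 hcont hj h3
  rw [heq] at h3
  rw [(U i).injective h3]

/-- If a sparsifier touches few variables around the core `T`, then recoloring the free constraints
changes the value of the instance, but not that of the sparsifier. -/
theorem card_freeConstraints_le (hR1 : ∀ u, R u ≤ 1) (hPS : HasSupport R S)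
    (hr : S.Rigid d E (hist s)) (hcard : Fintype.card {i // s i ∉ E} = r - k) {t : Fin r → D}
    (hst : TupleEquiv E s t) (hne : R s ≠ R t) {m : ℕ} {U : Fin m → (Fin r ↪ Fin n)}
    {C : Instance r n} {ε : ℝ} (hε : 0 ≤ ε) (h : IsSparsifier R ε (Instance.ofScopes U) C)
    (T : {i // s i ∉ E} ↪ Fin n) :
    ((freeConstraints k E s U C T).card : ℝ) ≤
      2 * ε * (Finset.univ.filter fun i => ContainsCore T (U i)).card := by
  set F := freeConstraints k E s U C T with hF
  set ψ := baseAssignment E s T d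
  set ψ' := recolored k E s t U C T d
  have hcore : ∀ i ∈ F, core E s (U i) = T := fun i hi => (Finset.mem_filter.1 hi).2.1
  have hcomp : Compatible E s T ψ := compatible_baseAssignment s T hr.2.1
  have hrange : ∀ i ∈ F, ∀ j, s j ∈ E → U i j ∉ Set.range T := fun i hi j hj => by
    rw [← hcore i hi]; exact notMem_range_core hj
  have hcomp' : Compatible E s T ψ' := by
    refine ⟨fun p => ?_, fun v hv => ?_⟩
    · rw [← hcomp.1 p]
      exact recolored_eq_base fun i hi j hj h => hrange i hi j hj ⟨p, h.symm⟩
    · by_cases hv' : ∃ i ∈ F, ∃ j, s j ∈ E ∧ U i j = v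
      · obtain ⟨i, hi, j, hj, rfl⟩ := hv'
        rw [show ψ' (U i j) = t j from recolored_apply hcard hi hj]
        rcases hst j with h | h
        · exact h.2
        · exact h ▸ hj
      · rw [show ψ' v = ψ v from recolored_eq_base fun i hi j hj h => hv' ⟨i, hi, j, hj, h⟩]
        exact hcomp.2 v hv
  have hsame : sat R C ψ = sat R C ψ' := sat_eq_of_touched hPS hr hcomp hcomp' C fun v hv =>
    (recolored_eq_base fun i hi j hj h => (Finset.mem_filter.1 hi).2.2 j hj (h ▸ hv)).symm
  have hle : ∀ χ, Compatible E s T χ → sat R (Instance.ofScopes U) χ ≤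
      (Finset.univ.filter fun i => ContainsCore T (U i)).card := by
    intro χ hχ
    rw [sat_ofScopes, Finset.card_filter]
    push_cast
    refine Finset.sum_le_sum fun i _ => ?_
    split_ifs with hi
    · exact_mod_cast hR1 _
    · have : R (fun j => χ (U i j)) = 0 := by
        by_contra h0; exact hi (hr.containsCore hPS hχ h0)
      rw [this, Nat.cast_zero]
  have hdiff : sat R (Instance.ofScopes U) ψ' - sat R (Instance.ofScopes U) ψ =
      F.card * ((R t : ℝ) - R s) := by
    rw [sat_ofScopes, sat_ofScopes, ← Finset.sum_sub_distrib, ← nsmul_eq_mul, ← Finset.sum_const,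
      ← Finset.sum_subset (Finset.subset_univ F)]
    · refine Finset.sum_congr rfl fun i hi => ?_
      have h1 : (fun j => ψ' (U i j)) = t := by
        funext j
        by_cases hj : s j ∈ E
        · exact recolored_apply hcard hi hj
        · have h2 : U i j = T ⟨j, hj⟩ := by rw [← hcore i hi]; rfl
          rw [h2, hcomp'.1]
          rcases hst j with h | h
          · exact absurd h.1 hj
          · exact h
      have h2 : (fun j => ψ (U i j)) = s := by
        have := hr.baseAssignment_comp (U := U i)
        rwa [hcore i hi] at this
      rw [h1, h2]
    · intro i _ hi
      by_cases hi' : ContainsCore T (U i)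
      · have : (fun j => ψ' (U i j)) = fun j => ψ (U i j) := by
          funext j
          refine recolored_eq_base fun i' hi1 j' hj' h => hi ?_
          have := eq_of_isolated hcard (Finset.mem_filter.1 hi1).1
            (by rw [hcore i' hi1]; exact hi') hj' h.symm
          rwa [this]
        rw [this, sub_self]
      · have h1 : R (fun j => ψ (U i j)) = 0 := by
          by_contra h0; exact hi' (hr.containsCore hPS hcomp h0)
        have h2 : R (fun j => ψ' (U i j)) = 0 := by
          by_contra h0; exact hi' (hr.containsCore hPS hcomp' h0)
        rw [h1, h2, sub_self]
  have h1 := h ψ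
  have h2 := h ψ'
  have h3 := hle ψ hcomp
  have h4 := hle ψ' hcomp'
  rw [← hsame] at h2
  have h5 := mul_le_mul_of_nonneg_left h3 hε
  have h6 := mul_le_mul_of_nonneg_left h4 hε
  have hs1 := hR1 s
  have ht1 := hR1 t
  have hcases : (R s = 0 ∧ R t = 1) ∨ (R s = 1 ∧ R t = 0) := by omega
  rcases hcases with ⟨h7, h8⟩ | ⟨h7, h8⟩
  · rw [h7, h8, Nat.cast_one, Nat.cast_zero, sub_zero, mul_one] at hdiff
    linarith [h1.1, h1.2, h2.1, h2.2]
  · rw [h7, h8, Nat.cast_one, Nat.cast_zero, zero_sub, mul_neg, mul_one] at hdiff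
    linarith [h1.1, h1.2, h2.1, h2.2]

theorem card_isolated_le (hR1 : ∀ u, R u ≤ 1) (hPS : HasSupport R S)
    (hr : S.Rigid d E (hist s)) (hcard : Fintype.card {i // s i ∉ E} = r - k) {t : Fin r → D}
    (hst : TupleEquiv E s t) (hne : R s ≠ R t) {m : ℕ} {U : Fin m → (Fin r ↪ Fin n)}
    {C : Instance r n} {ε : ℝ} (hε : 0 ≤ ε) (h : IsSparsifier R ε (Instance.ofScopes U) C) :
    ((isolated (r - k + 1) U).card : ℝ) ≤ 2 * ε * (r ^ (r - k) * m) + r ^ (r - k) * r * C.size := by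
  have h1 := card_isolated_le_sum (k := k) hcard U C
  have h2 := sum_card_touched_le (ι := {i // s i ∉ E}) C
  rw [hcard] at h2
  have h3 : ∑ T : {i // s i ∉ E} ↪ Fin n,
      (Finset.univ.filter fun i => ContainsCore T (U i)).card ≤ r ^ (r - k) * m := by
    simp only [Finset.card_filter]
    rw [Finset.sum_comm]
    simp only [← Finset.card_filter]
    refine (Finset.sum_le_sum fun i _ => card_containsCore_le (U i)).trans ?_
    rw [Finset.sum_const, Finset.card_univ, Fintype.card_fin, smul_eq_mul, mul_comm, hcard]
  have h4 : (∑ T, ((freeConstraints k E s U C T).card : ℝ)) ≤ 2 * ε * (r ^ (r - k) * m) := by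
    calc _ ≤ ∑ T : {i // s i ∉ E} ↪ Fin n,
          2 * ε * ((Finset.univ.filter fun i => ContainsCore T (U i)).card : ℝ) :=
        Finset.sum_le_sum fun T _ => card_freeConstraints_le hR1 hPS hr hcard hst hne hε h T
      _ = 2 * ε * ((∑ T : {i // s i ∉ E} ↪ Fin n,
          (Finset.univ.filter fun i => ContainsCore T (U i)).card : ℕ) : ℝ) := by
        rw [← Finset.mul_sum]; push_cast; rfl
      _ ≤ 2 * ε * ((r ^ (r - k) * m : ℕ) : ℝ) := by
        gcongr
      _ = _ := by push_cast; rfl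
  have h5 : ((isolated (r - k + 1) U).card : ℝ) ≤
      ∑ T, ((freeConstraints k E s U C T).card : ℝ) + ((r ^ (r - k) * r * C.size : ℕ) : ℝ) := by
    exact_mod_cast h1.trans (Nat.add_le_add_left h2 _)
  push_cast at h5
  linarith

/-- If the relation is not marginally uniform, then a random instance with sufficiently less than
`n ^ (r - k + 1)` constraints cannot be sparsified. -/
theorem whp_requires_of_not_uniform (R : ValuedRel D r) (hR1 : ∀ u, R u ≤ 1)
    (hR : ¬ R.MarginallyUniform k) :
    ∃ κ ε₀ c : ℝ, 0 < κ ∧ 0 < ε₀ ∧ 0 < c ∧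
      WHP r (fun n m ε => 0 < ε ∧ ε ≤ ε₀ ∧ (m : ℝ) ≤ (n : ℝ) ^ (r - k + 1) / κ)
        (fun _ m ε => SparsifierRequires R ε (c * (m : ℝ))) := by
  simp only [ValuedRel.MarginallyUniform, not_forall] at hR
  obtain ⟨d, E, h, ht, hr, s, t, rfl, hst, hne⟩ := hR
  have hcard := hr.card_core ht.2.2
  set a : ℝ := ((r : ℝ) + 1) ^ (r - k) with ha
  have hr0 : (0 : ℝ) ≤ r := Nat.cast_nonneg r
  have ha1 : 1 ≤ a := one_le_pow₀ (by linarith)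
  have har : (r : ℝ) ^ (r - k) ≤ a := by rw [ha]; gcongr; linarith
  refine ⟨32 * (4 ^ r * (r + 1) ^ r), 1 / (8 * a), 1 / (4 * a * (r + 1)), by positivity,
    by positivity, by positivity, fun δ hδ => ?_⟩
  obtain ⟨N, hN0, hN⟩ := exists_natCast_ge_forall_div_pow_le (256 * (4 ^ r * (r + 1) ^ r)) hδ
  refine ⟨max N (2 * r), fun n hn m ε ⟨hε, hε1, hm⟩ => ?_⟩
  have hnN : N ≤ n := (le_max_left _ _).trans hn
  have hnr : 2 * r ≤ n := (le_max_right _ _).trans hn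
  have hn0 : 0 < n := hN0.trans_le hnN
  have := nonempty_scopes (show r ≤ n by omega)
  rw [randomProb_eq_freq]
  rcases Nat.eq_zero_or_pos m with rfl | hm0
  · rw [freq_of_forall]
    · linarith
    · intro U C' _
      rw [Nat.cast_zero, mul_zero]
      exact Nat.cast_nonneg _
  refine one_sub_le_freq (le_trans (freq_mono fun U hU => ?_)
    ((freq_not_le_isolated_le hnr hn0 hm0 hm).trans ?_))
  · intro hiso
    refine hU fun C' hC' => ?_
    have h1 := card_isolated_le hR1 (hasSupport_sym R) hr hcard hst hne hε.le hC'
    have h2 : (m : ℝ) ≤ 2 * ((isolated (r - k + 1) U).card : ℝ) := by exact_mod_cast hiso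
    have h3 : 2 * ε * (r ^ (r - k) * m) ≤ m / 4 := by
      calc 2 * ε * ((r : ℝ) ^ (r - k) * m) ≤ 2 * (1 / (8 * a)) * (a * m) := by gcongr
        _ = m / 4 := by field_simp; norm_num
    have h4 : (r : ℝ) ^ (r - k) * r * C'.size ≤ a * (r + 1) * C'.size := by
      gcongr; linarith
    rw [one_div_mul_eq_div, div_le_iff₀ (by positivity)]
    linarith
  · rw [← mul_div_assoc]
    exact hN n hnN _ (Nat.succ_ne_zero _)

end Lower

/-! ### Densities of compatible assignments in the limit -/

section Limit

open Filter Topology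

/-- A homogeneous polynomial of degree `k` that is constant on the simplex, near the vertex `d`, is
a multiple of the `k`th power of the sum of the variables. Here in contrapositive form: if the
coefficients `b` are not proportional to the multinomial coefficients, then the polynomial takes a
value different from `b₀` on the simplex. -/
theorem exists_weights {σ : Type*} [Fintype σ] [DecidableEq σ] (d : σ) (k : ℕ) (b : (σ → ℕ) → ℝ)
    (b₀ : ℝ) (hb : ∃ g ∈ Finset.piAntidiag Finset.univ k, b g * ∏ e, ((g e)! : ℝ) ≠ b₀ * k !) :
    ∃ α : σ → ℝ, (∀ e, 0 ≤ α e) ∧ ∑ e, α e = 1 ∧ ∑ e ∈ Finset.univ.erase d, α e ≤ 1 / 2 ∧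
      ∑ g ∈ Finset.piAntidiag Finset.univ k, b g * ∏ e, α e ^ g e ≠ b₀ := by
  by_contra! hall
  obtain ⟨g, hg, hne⟩ := hb
  let p : MvPolynomial σ ℝ := ∑ g ∈ Finset.piAntidiag Finset.univ k,
    MvPolynomial.monomial (Finsupp.equivFunOnFinite.symm g)
      (b g - b₀ * (Nat.multinomial Finset.univ g : ℝ))
  -- By homogeneity, it suffices to scale a point of this box to the simplex, where the large
  -- coordinate `d` makes up at least half of the sum.
  let box : σ → Set ℝ := fun e => if e = d then Set.Ioi (Fintype.card σ : ℝ) else Set.Ioo 0 1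
  have hp : p = 0 := by
    refine MvPolynomial.funext_set box (fun e => ?_) fun x hx => ?_
    · simp only [box]
      split_ifs
      · exact Set.Ioi_infinite _
      · exact Set.Ioo_infinite one_pos
    have hxd : (Fintype.card σ : ℝ) < x d := by simpa [box] using hx d (Set.mem_univ d)
    have hxe : ∀ e, e ≠ d → 0 < x e ∧ x e < 1 := fun e he => by
      simpa [box, he] using hx e (Set.mem_univ e)
    have hpos : ∀ e, 0 < x e := fun e => by
      by_cases he : e = d
      · subst he; exact (Nat.cast_nonneg _).trans_lt hxd
      · exact (hxe e he).1
    set L := ∑ e, x e with hL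
    have hsplit : x d + ∑ e ∈ Finset.univ.erase d, x e = L :=
      Finset.add_sum_erase _ _ (Finset.mem_univ d)
    have hrest : ∑ e ∈ Finset.univ.erase d, x e ≤ Fintype.card σ := by
      calc _ ≤ ∑ e ∈ Finset.univ.erase d, (1 : ℝ) :=
            Finset.sum_le_sum fun e he => (hxe e (Finset.ne_of_mem_erase he)).2.le
        _ ≤ ∑ _e : σ, (1 : ℝ) := Finset.sum_le_sum_of_subset_of_nonneg (Finset.subset_univ _)
            fun _ _ _ => zero_le_one
        _ = _ := by simp
    have hrest0 : 0 ≤ ∑ e ∈ Finset.univ.erase d, x e := Finset.sum_nonneg fun e _ => (hpos e).le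
    have hL0 : 0 < L := by linarith [hpos d]
    have hα := hall (fun e => x e / L) (fun e => div_nonneg (hpos e).le hL0.le)
      (by rw [← Finset.sum_div, div_self hL0.ne']) (by
        rw [← Finset.sum_div, div_le_iff₀ hL0]
        linarith)
    have hhom : ∑ g ∈ Finset.piAntidiag Finset.univ k, b g * ∏ e, x e ^ g e = b₀ * L ^ k := by
      rw [← hα, Finset.sum_mul]
      refine Finset.sum_congr rfl fun g hg => ?_
      have hgk : ∑ e, g e = k := (Finset.mem_piAntidiag.1 hg).1
      rw [mul_assoc, ← hgk, ← Finset.prod_pow_eq_pow_sum, ← Finset.prod_mul_distrib]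
      congr 1
      refine Finset.prod_congr rfl fun e _ => ?_
      rw [div_pow, div_mul_cancel₀ _ (pow_ne_zero _ hL0.ne')]
    have hmult : L ^ k = ∑ g ∈ Finset.piAntidiag Finset.univ k,
        (Nat.multinomial Finset.univ g : ℝ) * ∏ e, x e ^ g e :=
      Finset.sum_pow_eq_sum_piAntidiag Finset.univ x k
    rw [map_zero]
    calc MvPolynomial.eval x p = ∑ g ∈ Finset.piAntidiag Finset.univ k,
          (b g - b₀ * (Nat.multinomial Finset.univ g : ℝ)) * ∏ e, x e ^ g e := by
          simp only [p, map_sum, MvPolynomial.eval_monomial]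
          refine Finset.sum_congr rfl fun g _ => ?_
          congr 1
          rw [Finsupp.prod_fintype _ _ fun i => pow_zero _]
          rfl
      _ = ∑ g ∈ Finset.piAntidiag Finset.univ k, b g * ∏ e, x e ^ g e - b₀ * L ^ k := by
          rw [hmult, Finset.mul_sum, ← Finset.sum_sub_distrib]
          exact Finset.sum_congr rfl fun g _ => by ring
      _ = 0 := by rw [hhom, sub_self]
  have hcoeff : MvPolynomial.coeff (Finsupp.equivFunOnFinite.symm g) p =
      b g - b₀ * (Nat.multinomial Finset.univ g : ℝ) := by
    simp only [p, MvPolynomial.coeff_sum, MvPolynomial.coeff_monomial]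
    rw [Finset.sum_eq_single_of_mem g hg fun g' _ hne => if_neg fun h =>
      hne (Finsupp.equivFunOnFinite.symm.injective h), if_pos rfl]
  rw [hp, MvPolynomial.coeff_zero] at hcoeff
  have hspec := Nat.multinomial_spec Finset.univ g
  rw [(Finset.mem_piAntidiag.1 hg).1] at hspec
  refine hne ?_
  have hspec' : (∏ e, ((g e)! : ℝ)) * (Nat.multinomial Finset.univ g : ℝ) = k ! := by
    exact_mod_cast hspec
  rw [← hspec']
  have : b g = b₀ * (Nat.multinomial Finset.univ g : ℝ) := by linarith
  rw [this]
  ring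

theorem tendsto_descFactorial_div_pow {y : ℕ → ℕ} {α : ℝ}
    (hy : Tendsto (fun n => (y n : ℝ) / n) atTop (𝓝 α)) (g : ℕ) :
    Tendsto (fun n => ((y n).descFactorial g : ℝ) / (n : ℝ) ^ g) atTop (𝓝 (α ^ g)) := by
  induction g with
  | zero => simp
  | succ g ih =>
    have h1 : Tendsto (fun n => ((y n - g : ℕ) : ℝ) / n) atTop (𝓝 α) := by
      have h2 : Tendsto (fun n : ℕ => (y n : ℝ) / n - g / n) atTop (𝓝 (α - 0)) :=
        hy.sub (tendsto_const_div_atTop_nhds_zero_nat _)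
      rw [sub_zero] at h2
      refine tendsto_of_tendsto_of_tendsto_of_le_of_le h2 hy (fun n => ?_) fun n => ?_
      · rw [← sub_div]
        refine div_le_div_of_nonneg_right ?_ (Nat.cast_nonneg n)
        have : y n ≤ (y n - g) + g := by omega
        have : (y n : ℝ) ≤ ((y n - g : ℕ) : ℝ) + g := by exact_mod_cast this
        linarith
      · refine div_le_div_of_nonneg_right ?_ (Nat.cast_nonneg n)
        exact Nat.cast_le.2 (Nat.sub_le _ _)
    rw [pow_succ']
    refine (h1.mul ih).congr fun n => ?_
    rw [Nat.descFactorial_succ, pow_succ']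
    push_cast
    rw [div_mul_div_comm]

variable {D : Type*} [Fintype D] [DecidableEq D] {r : ℕ}
  {R : ValuedRel D r} {S : SVR D r} {d : D} {E : Finset D} {k : ℕ} {h : Hist D r}

open Classical in
/-- The limit of the densities, in units of `n ^ (k - r)`, of assignments that have `h e` variables
of the colors `e ∉ E` and a fraction `α e` of variables of the colors `e ∈ E`. -/
noncomputable def limitDensity (R : ValuedRel D r) (E : Finset D) (h : Hist D r) (α : D → ℝ) : ℝ :=
  ∑ t, if ∀ e, e ∉ E → (hist t).1 e = h.1 e then
    (R t : ℝ) * ((∏ e ∈ Eᶜ, ((h.1 e)! : ℝ)) * ∏ e ∈ E, α e ^ (hist t).1 e) else 0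

theorem tendsto_density (hPS : HasSupport R S) (hr : S.Rigid d E h) (hk : h.1 d = k)
    {y : ℕ → D → ℕ} {α : D → ℝ} (hyE : ∀ e, e ∉ E → ∀ n, y n e = h.1 e)
    (hy : ∀ e ∈ E, Tendsto (fun n => (y n e : ℝ) / n) atTop (𝓝 (α e))) :
    Tendsto (fun n => ((∑ t, R t * ∏ e, (y n e).descFactorial ((hist t).1 e) : ℕ) : ℝ) /
      n.descFactorial r * (n : ℝ) ^ (r - k)) atTop (𝓝 (limitDensity R E h α)) := by
  have hkr : k ≤ r := hk ▸ hist_le h d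
  have hr1 : Tendsto (fun n : ℕ => (n.descFactorial r : ℝ) / (n : ℝ) ^ r) atTop (𝓝 1) := by
    have h1 : Tendsto (fun n : ℕ => (n : ℝ) / n) atTop (𝓝 1) := by
      refine tendsto_const_nhds.congr' ?_
      filter_upwards [eventually_gt_atTop 0] with n hn
      rw [div_self (by exact_mod_cast hn.ne')]
    simpa using tendsto_descFactorial_div_pow (y := fun n => n) h1 r
  have hterm : ∀ t : Fin r → D, Tendsto (fun n => ((R t * ∏ e, (y n e).descFactorial
      ((hist t).1 e) : ℕ) : ℝ) / (n : ℝ) ^ k) atTop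
      (𝓝 (if ∀ e, e ∉ E → (hist t).1 e = h.1 e then
        (R t : ℝ) * ((∏ e ∈ Eᶜ, ((h.1 e)! : ℝ)) * ∏ e ∈ E, α e ^ (hist t).1 e) else 0)) := by
    intro t
    by_cases ht : R t = 0
    · simp [ht]
    have hsupp := (hPS (hist t)).2 ⟨t, rfl, ht⟩
    by_cases hle : ∀ e, e ∉ E → (hist t).1 e ≤ h.1 e
    · have hsum := hr.2.2.2 _ hsupp hle
      have h1 := hist_sum_add_compl h E
      have h2 := hist_sum_add_compl (hist t) E
      have h3 := hr.sum_eq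
      have h4 := (Finset.sum_eq_sum_iff_of_le (s := Eᶜ)
        fun e he => hle e (Finset.mem_compl.1 he)).1 (by omega)
      rw [if_pos fun e he => h4 e (Finset.mem_compl.2 he)]
      have h5 : Tendsto (fun n => (R t : ℝ) * ((∏ e ∈ Eᶜ, ((h.1 e)! : ℝ)) *
          ∏ e ∈ E, (((y n e).descFactorial ((hist t).1 e) : ℝ) / (n : ℝ) ^ (hist t).1 e)))
          atTop (𝓝 ((R t : ℝ) * ((∏ e ∈ Eᶜ, ((h.1 e)! : ℝ)) * ∏ e ∈ E, α e ^ (hist t).1 e))) :=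
        (tendsto_const_nhds.mul (tendsto_finsetProd _ fun e he =>
          tendsto_descFactorial_div_pow (hy e he) _)).const_mul _
      refine h5.congr fun n => ?_
      rw [Finset.prod_div_distrib, Finset.prod_pow_eq_pow_sum, hsum, hk,
        ← Finset.prod_mul_prod_compl E]
      have h6 : ∏ e ∈ Eᶜ, (y n e).descFactorial ((hist t).1 e) = ∏ e ∈ Eᶜ, (h.1 e)! :=
        Finset.prod_congr rfl fun e he => by
          rw [hyE e (Finset.mem_compl.1 he), h4 e he, Nat.descFactorial_self]
      rw [h6]
      push_cast
      ring
    · rw [if_neg fun h' => hle fun e he => (h' e he).le]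
      push Not at hle
      obtain ⟨e, he, hlt⟩ := hle
      refine tendsto_const_nhds.congr fun n => ?_
      rw [Finset.prod_eq_zero (Finset.mem_univ e), mul_zero, Nat.cast_zero, zero_div]
      rw [Nat.descFactorial_eq_zero_iff_lt, hyE e he]
      exact hlt
  have hsum := (tendsto_finsetSum Finset.univ fun t _ => hterm t).div hr1 one_ne_zero
  rw [div_one] at hsum
  have hlim : limitDensity R E h α = ∑ t, if ∀ e, e ∉ E → (hist t).1 e = h.1 e then
        (R t : ℝ) * ((∏ e ∈ Eᶜ, ((h.1 e)! : ℝ)) * ∏ e ∈ E, α e ^ (hist t).1 e) else 0 := by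
    simp only [limitDensity]
  rw [hlim]
  refine hsum.congr' ?_
  filter_upwards [eventually_gt_atTop 0] with n hn
  have hn' : (0 : ℝ) < n := by exact_mod_cast hn
  simp only [Pi.div_apply]
  rw [← Finset.sum_div, Nat.cast_sum, div_div_eq_mul_div, div_mul_eq_mul_div, div_mul_eq_mul_div,
    div_div]
  have h6 : (n : ℝ) ^ r = n ^ (r - k) * n ^ k := by
    rw [← pow_add, Nat.sub_add_cancel hkr]
  rw [h6]
  field_simp

theorem sym_eq_sum (R : ValuedRel D r) (E : Finset D) (H : Hist D r) :
    (R.Sym H : ℝ) = (∏ e ∈ Eᶜ, ((H.1 e)! : ℝ)) * (∏ e ∈ E, ((H.1 e)! : ℝ)) *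
      ∑ t ∈ Finset.univ.filter (fun t : Fin r → D => ∀ e, (hist t).1 e = H.1 e), (R t : ℝ) := by
  rw [ValuedRel.Sym]
  push_cast
  rw [← Finset.prod_mul_prod_compl E, mul_comm (∏ e ∈ Eᶜ, _)]
  congr 1
  refine Finset.sum_congr ?_ fun _ _ => rfl
  ext t
  simp only [Finset.mem_filter, Finset.mem_univ, true_and]
  exact ⟨fun h e => by rw [h], fun h => Subtype.ext (funext h)⟩

/-- If the symmetrization is not constant on the histograms that agree with `h` off `E`, then the
limit density is not constant. -/
theorem exists_limitDensity_ne (hr : R.Sym.Rigid d E h) (hk : h.1 d = k) {H : Hist D r}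
    (hH : ∀ e, e ∉ E → H.1 e = h.1 e) (hne : R.Sym H ≠ R.Sym h) :
    ∃ α : D → ℝ, (∀ e ∈ E, 0 ≤ α e) ∧ ∑ e ∈ E, α e = 1 ∧ ∑ e ∈ E.erase d, α e ≤ 1 / 2 ∧
      limitDensity R E h α ≠ limitDensity R E h (fun e => if e = d then 1 else 0) := by
  classical
  have hd := hr.2.1
  have hkE : ∑ e ∈ E, h.1 e = k := hr.sum_eq.trans hk
  have hsumE : ∀ t : Fin r → D, (∀ e, e ∉ E → (hist t).1 e = h.1 e) →
      ∑ e ∈ E, (hist t).1 e = k := by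
    intro t ht
    have h1 := hist_sum_add_compl h E
    have h2 := hist_sum_add_compl (hist t) E
    have h3 : ∑ e ∈ Eᶜ, (hist t).1 e = ∑ e ∈ Eᶜ, h.1 e :=
      Finset.sum_congr rfl fun e he => ht e (Finset.mem_compl.1 he)
    omega
  set c : ℝ := ∏ e ∈ Eᶜ, ((h.1 e)! : ℝ) with hc
  let A : Finset (Fin r → D) := Finset.univ.filter fun t => ∀ e, e ∉ E → (hist t).1 e = h.1 e
  let b : (E → ℕ) → ℝ := fun g =>
    ∑ t ∈ A.filter (fun t : Fin r → D => (fun e : E => (hist t).1 e) = g), (R t : ℝ) * c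
  have hlim : ∀ α : D → ℝ, limitDensity R E h α =
      ∑ g ∈ Finset.piAntidiag (Finset.univ : Finset E) k, b g * ∏ e : E, α e ^ g e := by
    intro α
    have h1 : limitDensity R E h α = ∑ t ∈ A, (R t : ℝ) * (c * ∏ e ∈ E, α e ^ (hist t).1 e) := by
      rw [Finset.sum_filter, limitDensity]
    rw [h1, ← Finset.sum_fiberwise_of_maps_to (s := A)
      (t := Finset.piAntidiag (Finset.univ : Finset E) k)
      (g := fun t : Fin r → D => (fun e : E => (hist t).1 e))]
    · refine Finset.sum_congr rfl fun g _ => ?_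
      rw [Finset.sum_mul]
      refine Finset.sum_congr rfl fun t ht => ?_
      rw [← (Finset.mem_filter.1 ht).2, mul_assoc,
        Finset.prod_coe_sort E (fun e => α e ^ (hist t).1 e)]
    · intro t ht
      rw [Finset.mem_piAntidiag]
      refine ⟨?_, fun _ _ => Finset.mem_univ _⟩
      rw [Finset.sum_coe_sort E (fun e => (hist t).1 e)]
      exact hsumE t (Finset.mem_filter.1 ht).2
  have hbH : ∀ G : Hist D r, (∀ e, e ∉ E → G.1 e = h.1 e) →
      b (fun e => G.1 e) * ∏ e : E, ((G.1 e)! : ℝ) = R.Sym G := by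
    intro G hG
    have h1 : A.filter (fun t : Fin r → D => (fun e : E => (hist t).1 e) = fun e : E => G.1 e) =
        Finset.univ.filter fun t => ∀ e, (hist t).1 e = G.1 e := by
      ext t
      simp only [A, Finset.mem_filter, Finset.mem_univ, true_and, funext_iff, Subtype.forall]
      refine ⟨fun ⟨h1, h2⟩ e => ?_, fun h1 => ⟨fun e he => (h1 e).trans (hG e he),
        fun e _ => h1 e⟩⟩
      by_cases he : e ∈ E
      · exact h2 e he
      · rw [h1 e he, hG e he]
    have h2 : ∏ e ∈ Eᶜ, ((G.1 e)! : ℝ) = c :=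
      Finset.prod_congr rfl fun e he => by rw [hG e (Finset.mem_compl.1 he)]
    simp only [b]
    rw [h1, sym_eq_sum R E G, h2, ← Finset.sum_mul, Finset.prod_coe_sort E
      (fun e => ((G.1 e)! : ℝ))]
    ring
  have hb0 : limitDensity R E h (fun e => if e = d then 1 else 0) * k ! = R.Sym h := by
    have h1 : limitDensity R E h (fun e => if e = d then 1 else 0) =
        b (fun e => h.1 e) := by
      rw [hlim, Finset.sum_eq_single_of_mem (fun e : E => h.1 e)]
      · rw [Finset.prod_eq_one, mul_one]
        intro e _
        split_ifs with he
        · exact one_pow _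
        · rw [show (fun e : E => h.1 e) e = 0 from hr.2.2.1 e e.2 he, pow_zero]
      · rw [Finset.mem_piAntidiag, Finset.sum_coe_sort E (fun e => h.1 e)]
        exact ⟨hkE, fun _ _ => Finset.mem_univ _⟩
      · intro g hg hgne
        have hgk : ∑ e, g e = k := (Finset.mem_piAntidiag.1 hg).1
        have : ∃ e : E, (e : D) ≠ d ∧ g e ≠ 0 := by
          by_contra! hall
          have hgd : g ⟨d, hd⟩ = k := by
            rw [← hgk]
            symm
            refine Finset.sum_eq_single_of_mem _ (Finset.mem_univ _)
              fun e _ he => hall e fun h => ?_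
            exact he (Subtype.ext h)
          refine hgne (funext fun e => ?_)
          by_cases he : (e : D) = d
          · have : e = ⟨d, hd⟩ := Subtype.ext he
            rw [this, hgd, hk]
          · rw [hall e he, hr.2.2.1 e e.2 he]
        obtain ⟨e, he, he'⟩ := this
        rw [Finset.prod_eq_zero (Finset.mem_univ e), mul_zero]
        rw [if_neg he, zero_pow he']
    have h2 : ∏ e : E, ((h.1 e)! : ℝ) = k ! := by
      rw [Finset.prod_eq_single_of_mem (⟨d, hd⟩ : E) (Finset.mem_univ _), hk]
      intro e _ he
      rw [hr.2.2.1 e e.2 fun h' => he (Subtype.ext h'), Nat.factorial_zero, Nat.cast_one]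
    rw [h1, ← h2]
    exact hbH h fun _ _ => rfl
  obtain ⟨α, h1, h2, h3, h4⟩ := exists_weights (⟨d, hd⟩ : E) k b
    (limitDensity R E h fun e => if e = d then 1 else 0) ⟨fun e => H.1 e, by
      rw [Finset.mem_piAntidiag, Finset.sum_coe_sort E (fun e => H.1 e)]
      refine ⟨?_, fun _ _ => Finset.mem_univ _⟩
      obtain ⟨t, rfl⟩ := exists_hist_eq H
      exact hsumE t hH, by
      rw [hbH H hH, hb0]
      exact_mod_cast hne⟩
  let α' : D → ℝ := fun e => if he : e ∈ E then α ⟨e, he⟩ else 0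
  have hα' : ∀ e : E, α' e = α e := fun e => by simp [α']
  refine ⟨α', fun e he => ?_, ?_, ?_, ?_⟩
  · rw [show α' e = α ⟨e, he⟩ from hα' ⟨e, he⟩]
    exact h1 _
  · rw [← Finset.sum_coe_sort E α']
    simpa only [hα'] using h2
  · refine le_trans (le_of_eq ?_) h3
    have h5 := Finset.add_sum_erase Finset.univ α (Finset.mem_univ (⟨d, hd⟩ : E))
    have h6 := Finset.add_sum_erase E α' hd
    rw [← Finset.sum_coe_sort E α'] at h6
    simp only [hα'] at h6
    have h7 := hα' ⟨d, hd⟩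
    simp only at h7
    linarith
  · rw [hlim]
    simpa only [hα'] using h4

end Limit

/-! ### Lower bounds by comparing the limit densities -/

section Dense

open Filter Topology
open Classical

variable {D : Type*} [Fintype D] [DecidableEq D] {r n : ℕ}
  {R : ValuedRel D r} {d : D} {E : Finset D} {k : ℕ} {s : Fin r → D}

/-- A compatible assignment can have any prescribed numbers of variables of the colors in
`E \ {d}`, and use these colors only outside a given set `V`. -/
theorem exists_compatible_colorCount (hd : d ∈ E) (T : {i // s i ∉ E} ↪ Fin n)
    (V : Finset (Fin n)) {y : D → ℕ}
    (hy : ∑ e ∈ E.erase d, y e + Fintype.card {i // s i ∉ E} + V.card ≤ n) :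
    ∃ ψ : Fin n → D, Compatible E s T ψ ∧ (∀ v ∈ V, v ∉ Set.range T → ψ v = d) ∧
      ∀ e ∈ E.erase d, colorCount ψ e = y e := by
  let X := Σ e : E.erase d, Fin (y e)
  have hX : Fintype.card X = ∑ e ∈ E.erase d, y e := by
    simp only [X, Fintype.card_sigma, Fintype.card_fin]
    exact Finset.sum_coe_sort (E.erase d) y
  let W := (Finset.univ.map T ∪ V)ᶜ
  have hW : Fintype.card X ≤ Fintype.card W := by
    rw [Fintype.card_coe, Finset.card_compl, Fintype.card_fin, hX]
    have := Finset.card_union_le (Finset.univ.map T) V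
    rw [Finset.card_map, Finset.card_univ] at this
    omega
  obtain ⟨f⟩ := Function.Embedding.nonempty_of_card_le hW
  have hfT : ∀ x : X, (f x : Fin n) ∉ Set.range T := fun x ⟨p, hp⟩ =>
    Finset.mem_compl.1 (f x).2 (Finset.mem_union_left _ (by simpa using ⟨p.1, p.2, hp⟩))
  have hfV : ∀ x : X, (f x : Fin n) ∉ V := fun x hx =>
    Finset.mem_compl.1 (f x).2 (Finset.mem_union_right _ hx)
  let F : X ↪ Fin n := f.trans (Function.Embedding.subtype _)
  let ψ : Fin n → D := Function.extend F (fun x => (x.1 : D)) (baseAssignment E s T d)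
  have hψF : ∀ x, ψ (F x) = x.1 := fun x => F.injective.extend_apply _ _ _
  have hψ : ∀ v, v ∉ Set.range F → ψ v = baseAssignment E s T d v := fun v hv =>
    Function.extend_apply' _ _ _ fun ⟨x, hx⟩ => hv ⟨x, hx⟩
  refine ⟨ψ, ⟨fun p => ?_, fun v hv => ?_⟩, fun v hv hvT => ?_, fun e he => ?_⟩
  · rw [hψ, baseAssignment_apply]
    rintro ⟨x, hx⟩
    exact hfT x ⟨p, hx.symm⟩
  · by_cases hF : v ∈ Set.range F
    · obtain ⟨x, rfl⟩ := hF
      rw [hψF]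
      exact Finset.mem_of_mem_erase x.1.2
    · rwa [hψ v hF, baseAssignment_of_notMem E s T d hv]
  · rw [hψ, baseAssignment_of_notMem E s T d hvT]
    rintro ⟨x, rfl⟩
    exact hfV x hv
  · have h1 : (Finset.univ.filter fun v => ψ v = e) = Finset.univ.map
        ((Function.Embedding.sigmaMk (β := fun e : E.erase d => Fin (y e)) ⟨e, he⟩).trans F) := by
      ext v
      simp only [Finset.mem_filter, Finset.mem_univ, true_and, Finset.mem_map,
        Function.Embedding.trans_apply]
      refine ⟨fun hv => ?_, ?_⟩
      · by_cases hF : v ∈ Set.range F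
        · obtain ⟨⟨⟨e', he'⟩, i⟩, rfl⟩ := hF
          rw [hψF] at hv
          subst hv
          exact ⟨i, rfl⟩
        · rw [hψ v hF] at hv
          by_cases hT : v ∈ Set.range T
          · obtain ⟨p, rfl⟩ := hT
            rw [baseAssignment_apply] at hv
            exact absurd (hv ▸ Finset.mem_of_mem_erase he) p.2
          · rw [baseAssignment_of_notMem E s T d hT] at hv
            exact absurd hv.symm (Finset.ne_of_mem_erase he)
      · rintro ⟨i, rfl⟩
        exact hψF _
    rw [colorCount, h1, Finset.card_map, Finset.card_univ, Fintype.card_fin]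

theorem limitDensity_nonneg (h : Hist D r) {α : D → ℝ} (hα : ∀ e ∈ E, 0 ≤ α e) :
    0 ≤ limitDensity R E h α := by
  refine Finset.sum_nonneg fun t _ => ?_
  split_ifs
  · exact mul_nonneg (Nat.cast_nonneg _) (mul_nonneg
      (Finset.prod_nonneg fun _ _ => Nat.cast_nonneg _)
      (Finset.prod_nonneg fun e he => pow_nonneg (hα e he) _))
  · exact le_rfl

/-- The limit densities are approximated by compatible assignments that are constant on a given
small set. -/
theorem exists_natCast_forall_exists_density_near (hr : R.Sym.Rigid d E (hist s))
    (hk : (hist s).1 d = k) {α : D → ℝ} (hα : ∀ e ∈ E, 0 ≤ α e) (hα1 : ∑ e ∈ E, α e = 1)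
    (hα2 : ∑ e ∈ E.erase d, α e ≤ 1 / 2) {η : ℝ} (hη : 0 < η) :
    ∃ N : ℕ, ∀ n, N ≤ n → ∀ (T : {i // s i ∉ E} ↪ Fin n) (V : Finset (Fin n)), 4 * V.card ≤ n →
      ∃ ψ : Fin n → D, Compatible E s T ψ ∧ (∀ v ∈ V, v ∉ Set.range T → ψ v = d) ∧
        |density R ψ * (n : ℝ) ^ (r - k) - limitDensity R E (hist s) α| ≤ η := by
  have hd := hr.2.1
  have hcard := hr.card_core hk
  let z : ℕ → D → ℕ := fun n e => ⌊α e * n⌋₊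
  let y : ℕ → D → ℕ := fun n e => if e ∉ E then (hist s).1 e else
    if e = d then n - (r - k) - ∑ f ∈ E.erase d, z n f else z n e
  have hz : ∀ e ∈ E, Tendsto (fun n => (z n e : ℝ) / n) atTop (𝓝 (α e)) := fun e he =>
    (tendsto_nat_floor_mul_div_atTop (R := ℝ) (hα e he)).comp tendsto_natCast_atTop_atTop
  have hzsum : ∀ n, 2 * ∑ f ∈ E.erase d, z n f ≤ n := by
    intro n
    have h1 : ((∑ f ∈ E.erase d, z n f : ℕ) : ℝ) ≤ 1 / 2 * n := by
      push_cast
      calc ∑ f ∈ E.erase d, (z n f : ℝ) ≤ ∑ f ∈ E.erase d, α f * n :=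
            Finset.sum_le_sum fun f hf => Nat.floor_le
              (mul_nonneg (hα f (Finset.mem_of_mem_erase hf)) (Nat.cast_nonneg n))
        _ = (∑ f ∈ E.erase d, α f) * n := (Finset.sum_mul _ _ _).symm
        _ ≤ _ := by gcongr
    have h2 : ((2 * ∑ f ∈ E.erase d, z n f : ℕ) : ℝ) ≤ n := by
      push_cast at h1 ⊢
      linarith
    exact_mod_cast h2
  have hyz : ∀ n, ∀ e ∈ E.erase d, y n e = z n e := fun n e he => by
    simp [y, Finset.mem_of_mem_erase he, Finset.ne_of_mem_erase he]
  have hyd : ∀ n, y n d = n - (r - k) - ∑ f ∈ E.erase d, z n f := fun n => by simp [y, hd]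
  have hyE : ∀ e, e ∉ E → ∀ n, y n e = (hist s).1 e := fun e he n => by simp [y, he]
  have hylim : ∀ e ∈ E, Tendsto (fun n => (y n e : ℝ) / n) atTop (𝓝 (α e)) := by
    intro e he
    by_cases hed : e = d
    · subst hed
      have h1 : Tendsto (fun n : ℕ => 1 - ((r - k : ℕ) : ℝ) / n - ∑ f ∈ E.erase e, (z n f : ℝ) / n)
          atTop (𝓝 (1 - 0 - ∑ f ∈ E.erase e, α f)) :=
        (tendsto_const_nhds.sub (tendsto_const_div_atTop_nhds_zero_nat _)).sub
          (tendsto_finsetSum _ fun f hf => hz f (Finset.mem_of_mem_erase hf))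
      have h2 : 1 - 0 - ∑ f ∈ E.erase e, α f = α e := by
        have := Finset.add_sum_erase E α he
        linarith
      rw [h2] at h1
      refine h1.congr' ?_
      filter_upwards [eventually_gt_atTop (4 * r)] with n hn
      have hn0 : (n : ℝ) ≠ 0 := by
        have : n ≠ 0 := by omega
        exact_mod_cast this
      have h3 := hzsum n
      have h4 : y n e + (r - k) + ∑ f ∈ E.erase e, z n f = n := by rw [hyd]; omega
      have h5 : (y n e : ℝ) + ((r - k : ℕ) : ℝ) + ∑ f ∈ E.erase e, (z n f : ℝ) = n := by
        exact_mod_cast h4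
      rw [← Finset.sum_div, eq_div_iff hn0, sub_mul, sub_mul, div_mul_cancel₀ _ hn0,
        div_mul_cancel₀ _ hn0]
      linarith
    · refine (hz e he).congr fun n => ?_
      rw [hyz n e (Finset.mem_erase.2 ⟨hed, he⟩)]
  have hlim := tendsto_density (hasSupport_sym R) hr hk hyE hylim
  obtain ⟨N, hN⟩ := Metric.tendsto_atTop.1 hlim η hη
  refine ⟨max N (4 * r), fun n hn T V hV => ?_⟩
  have hnN : N ≤ n := (le_max_left _ _).trans hn
  have hnr : 4 * r ≤ n := (le_max_right _ _).trans hn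
  have h3 := hzsum n
  obtain ⟨ψ, h1, h2, hcount⟩ := exists_compatible_colorCount hd T V (y := z n) (by omega)
  refine ⟨ψ, h1, h2, ?_⟩
  have hall : ∀ e, colorCount ψ e = y n e := by
    intro e
    by_cases he : e ∈ E
    · by_cases hed : e = d
      · subst hed
        have h4 := sum_colorCount ψ
        rw [← Finset.sum_add_sum_compl E, ← Finset.add_sum_erase E _ hd,
          Finset.sum_congr (g := fun f => z n f) rfl hcount, Finset.sum_congr rfl fun e he =>
          h1.colorCount_eq (Finset.mem_compl.1 he)] at h4
        have h5 := hist_sum_add_compl (hist s) E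
        rw [hr.sum_eq, hk] at h5
        rw [hyd]
        omega
      · rw [hcount e (Finset.mem_erase.2 ⟨hed, he⟩), hyz n e (Finset.mem_erase.2 ⟨hed, he⟩)]
    · rw [h1.colorCount_eq he, hyE e he]
  have h6 := hN n hnN
  rw [Real.dist_eq] at h6
  rw [density_eq, total_eq_sum]
  simp only [hall]
  exact h6.le

/-- There are few small sets of variables. -/
theorem card_filter_card_le_le {x : ℝ} (hx : 0 < x) (hx1 : x ≤ 1) {β : ℝ} (n : ℕ) :
    ((Finset.univ.filter fun V : Finset (Fin n) => (V.card : ℝ) ≤ β * n).card : ℝ) ≤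
      Real.exp (x * n) * Real.exp (β * n * -Real.log x) := by
  have h1 : ∑ V : Finset (Fin n), x ^ V.card = (x + 1) ^ n := by
    simpa using Fintype.sum_pow_mul_eq_add_pow (Fin n) x 1
  have h2 : (x + 1) ^ n ≤ Real.exp (x * n) := by
    rw [mul_comm, Real.exp_nat_mul]
    exact pow_le_pow_left₀ (by positivity) (Real.add_one_le_exp x) n
  have h3 : ((Finset.univ.filter fun V : Finset (Fin n) => (V.card : ℝ) ≤ β * n).card : ℝ) *
      Real.exp (β * n * Real.log x) ≤ Real.exp (x * n) := by
    refine le_trans ?_ (h1.trans_le h2)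
    rw [← nsmul_eq_mul, ← Finset.sum_const]
    refine (Finset.sum_le_sum fun V hV => ?_).trans (Finset.sum_le_sum_of_subset_of_nonneg
      (Finset.filter_subset _ _) fun _ _ _ => by positivity)
    have h4 := (Finset.mem_filter.1 hV).2
    rw [← Real.rpow_natCast, Real.rpow_def_of_pos hx, Real.exp_le_exp, mul_comm (Real.log x)]
    exact mul_le_mul_of_nonpos_right h4 (Real.log_nonpos hx.le hx1)
  rwa [mul_neg, Real.exp_neg, ← div_eq_mul_inv, le_div_iff₀ (Real.exp_pos _)]

/-- If a sparsifier is small, then it touches few variables around some core. -/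
theorem exists_card_touched_le {ι : Type*} [Fintype ι] {q : ℕ} (hι : Fintype.card ι = q)
    (hn : 2 * q ≤ n) (hn0 : 0 < n) {β : ℝ} (hβ : 0 < β) (C : Instance r n)
    (hC : (C.size : ℝ) < β / (2 ^ q * (r + 1) ^ (q + 1)) * n ^ (q + 1)) :
    ∃ T : ι ↪ Fin n, ((touched C T).card : ℝ) ≤ β * n := by
  by_contra! hall
  have h1 : (n.descFactorial q : ℝ) * (β * n) ≤ ∑ T : ι ↪ Fin n, ((touched C T).card : ℝ) := by
    have : Fintype.card (ι ↪ Fin n) = n.descFactorial q := by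
      rw [Fintype.card_embedding_eq, Fintype.card_fin, hι]
    rw [← this, ← nsmul_eq_mul, ← Finset.card_univ, ← Finset.sum_const]
    exact Finset.sum_le_sum fun T _ => (hall T).le
  have h2 : (∑ T : ι ↪ Fin n, ((touched C T).card : ℝ)) ≤ r ^ q * r * C.size := by
    rw [← hι]
    exact_mod_cast sum_card_touched_le (ι := ι) C
  have h3 : (n : ℝ) ^ q ≤ 2 ^ q * n.descFactorial q := by
    exact_mod_cast pow_le_two_pow_mul_descFactorial hn
  have hn1 : (0 : ℝ) < n := by exact_mod_cast hn0
  have h4 : (r : ℝ) ^ q * r * C.size ≤ (r + 1) ^ (q + 1) * C.size := by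
    rw [← pow_succ]
    gcongr
    linarith
  rw [div_mul_eq_mul_div, lt_div_iff₀ (by positivity)] at hC
  have h5 : β * (n : ℝ) ^ (q + 1) ≤ 2 ^ q * (n.descFactorial q * (β * n)) := by
    calc β * (n : ℝ) ^ (q + 1) = n ^ q * (β * n) := by ring
      _ ≤ 2 ^ q * n.descFactorial q * (β * n) := by gcongr
      _ = _ := by ring
  have h6 : (2 : ℝ) ^ q * (n.descFactorial q * (β * n)) ≤
      2 ^ q * ((r + 1) ^ (q + 1) * C.size) := by
    exact mul_le_mul_of_nonneg_left (h1.trans (h2.trans h4)) (by positivity)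
  linarith

/-- A sparsifier cannot fail to distinguish two assignments of different values. -/
theorem not_isSparsifier_of_gap {C C' : Instance r n} {ε M Φ Φ' : ℝ} {ψ ψ' : Fin n → D}
    (hM : 0 < M) (hΦ : 0 ≤ Φ) (hΦ' : 0 ≤ Φ') (hgap : Φ ≠ Φ') (hε : 0 < ε)
    (hε1 : ε ≤ |Φ - Φ'| / (8 * (Φ + Φ' + |Φ - Φ'|)))
    (h : |sat R C ψ - M * Φ| ≤ M * |Φ - Φ'| / 4) (h' : |sat R C ψ' - M * Φ'| ≤ M * |Φ - Φ'| / 4)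
    (heq : sat R C' ψ = sat R C' ψ') : ¬ IsSparsifier R ε C C' := by
  intro hC
  set γ := |Φ - Φ'| with hγ
  have hγ0 : 0 < γ := abs_pos.2 (sub_ne_zero.2 hgap)
  rw [le_div_iff₀ (by positivity)] at hε1
  have h1 := hC ψ
  have h2 := hC ψ'
  rw [← heq] at h2
  rw [abs_le] at h h'
  have h3 : ε * (sat R C ψ + sat R C ψ') ≤ M * γ / 4 := by
    have h4 : sat R C ψ + sat R C ψ' ≤ M * (Φ + Φ' + γ) := by
      have : 0 < M * γ := by positivity
      nlinarith [h.2, h'.2]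
    calc _ ≤ ε * (M * (Φ + Φ' + γ)) := by gcongr
      _ = M * (ε * (8 * (Φ + Φ' + γ))) / 8 := by ring
      _ ≤ M * γ / 8 := by gcongr
      _ ≤ _ := by nlinarith [mul_pos hM hγ0]
  have h5 : 0 < M * γ := by positivity
  rcases abs_cases (Φ - Φ') with ⟨h6, -⟩ | ⟨h6, -⟩
  · have h7 : M * γ = M * Φ - M * Φ' := by rw [hγ, h6]; ring
    linarith [h1.1, h1.2, h2.1, h2.2, h.1, h.2, h'.1, h'.2]
  · have h7 : M * γ = M * Φ' - M * Φ := by rw [hγ, h6]; ring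
    linarith [h1.1, h1.2, h2.1, h2.2, h.1, h.2, h'.1, h'.2]

end Dense

section DenseLower

open Filter Topology
open Classical

variable {D : Type*} [Fintype D] [DecidableEq D] {r : ℕ} {k : ℕ}

/-- Constants for which the bound of `card_filter_card_le_le` is at most `exp (τ n / 2)`. -/
theorem exists_entropy_le {τ : ℝ} (hτ : 0 < τ) :
    ∃ x β : ℝ, 0 < x ∧ x ≤ 1 ∧ 0 < β ∧ 4 * β ≤ 1 ∧ x + β * -Real.log x ≤ τ / 2 := by
  set x := min 1 (τ / 4)
  have hx : 0 < x := lt_min one_pos (by positivity)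
  have hx1 : x ≤ 1 := min_le_left _ _
  have hL : 0 ≤ -Real.log x := neg_nonneg.2 (Real.log_nonpos hx.le hx1)
  refine ⟨x, min (1 / 4) (τ / (4 * (1 + -Real.log x))), hx, hx1,
    lt_min (by norm_num) (by positivity), ?_, ?_⟩
  · linarith [min_le_left (1 / 4) (τ / (4 * (1 + -Real.log x)))]
  · have h1 : min (1 / 4) (τ / (4 * (1 + -Real.log x))) * -Real.log x ≤ τ / 4 := by
      calc _ ≤ τ / (4 * (1 + -Real.log x)) * (1 + -Real.log x) :=
            mul_le_mul (min_le_right _ _) (by linarith) hL (by positivity)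
        _ = τ / 4 := by field_simp
    linarith [min_le_right 1 (τ / 4)]

theorem exists_natCast_forall_pow_mul_exp_le (q : ℕ) {τ : ℝ} (hτ : 0 < τ) {δ : ℝ} (hδ : 0 < δ) :
    ∃ N : ℕ, ∀ n : ℕ, N ≤ n → 4 * ((n : ℝ) ^ q * Real.exp (-τ * n)) ≤ δ := by
  have h := ((tendsto_rpow_mul_exp_neg_mul_atTop_nhds_zero q τ hτ).comp
    tendsto_natCast_atTop_atTop).const_mul 4
  rw [mul_zero] at h
  obtain ⟨N, hN⟩ := eventually_atTop.1 (h.eventually_le_const hδ)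
  exact ⟨N, fun n hn => by simpa using hN n hn⟩

/-- The union bound over `A` cores and `B` sets of variables. -/
theorem mul_mul_exp_le {n q A B : ℕ} {x y β τ : ℝ} (hA : (A : ℝ) ≤ (n : ℝ) ^ q)
    (hB : (B : ℝ) ≤ Real.exp (x * n) * Real.exp (β * n * y)) (h : x + β * y ≤ τ / 2) :
    (A : ℝ) * B * (4 * Real.exp (-τ * n)) ≤ 4 * ((n : ℝ) ^ q * Real.exp (-(τ / 2) * n)) := by
  have h1 : Real.exp (x * n) * Real.exp (β * n * y) * Real.exp (-τ * n) ≤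
      Real.exp (-(τ / 2) * n) := by
    rw [← Real.exp_add, ← Real.exp_add, Real.exp_le_exp]
    have := mul_le_mul_of_nonneg_right h (Nat.cast_nonneg (α := ℝ) n)
    linarith
  calc (A : ℝ) * B * (4 * Real.exp (-τ * n)) ≤
        (n : ℝ) ^ q * (Real.exp (x * n) * Real.exp (β * n * y)) * (4 * Real.exp (-τ * n)) := by
        gcongr
    _ = 4 * ((n : ℝ) ^ q * (Real.exp (x * n) * Real.exp (β * n * y) * Real.exp (-τ * n))) := by
        ring
    _ ≤ _ := by gcongr

/-- Concentration for an assignment whose density, in units of `n ^ (-q)`, is close to `Φ`. Here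
`M` stands for `m / n ^ q`. -/
theorem freq_not_abs_sat_sub_le (R : ValuedRel D r) (hR1 : ∀ u, R u ≤ 1) {n m q : ℕ} (hrn : r ≤ n)
    (hn0 : 0 < n) {κ γ W Φ : ℝ} (hκ : 0 < κ) (hγ : 0 < γ) (hW : Φ + γ ≤ W) (hγW : γ ≤ W)
    (hm : (n : ℝ) ^ (q + 1) / κ ≤ m) {χ : Fin n → D}
    (hχ : |density R χ * (n : ℝ) ^ q - Φ| ≤ γ / 8) :
    freq (fun U : Fin m → (Fin r ↪ Fin n) =>
      ¬ |sat R (Instance.ofScopes U) χ - m / n ^ q * Φ| ≤ m / n ^ q * γ / 4) ≤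
      2 * Real.exp (-((γ / (8 * W)) ^ 2 * W / (4 * κ)) * n) := by
  have hn1 : (0 : ℝ) < n := by exact_mod_cast hn0
  have hW0 : 0 < W := hγ.trans_le hγW
  set η := γ / (8 * W) with hη
  have hη1 : η ≤ 1 := by
    rw [hη, div_le_one (by positivity)]
    linarith
  set M : ℝ := m / n ^ q with hM
  have hM0 : 0 ≤ M := by positivity
  have hMn : n / κ ≤ M := by
    rw [hM, le_div_iff₀ (by positivity)]
    refine le_trans (le_of_eq ?_) hm
    rw [pow_succ]
    ring
  have h1 := abs_le.1 hχ
  have h2 : density R χ ≤ W / n ^ q := by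
    rw [le_div_iff₀ (by positivity)]
    linarith
  have h3 : m * density R χ = M * (density R χ * n ^ q) := by
    rw [hM]
    field_simp
  have h4 : (m : ℝ) * (W / n ^ q) = M * W := by rw [hM]; ring
  have h5 := freq_sat_sub_gt_le R χ hrn one_pos (fun t => by exact_mod_cast hR1 t) h2
    (by positivity : 0 ≤ η) hη1 m
  rw [h3, h4] at h5
  refine (freq_mono fun U hU => ?_).trans (h5.trans ?_)
  · by_contra! h6
    refine hU ?_
    have h7 : |M * (density R χ * n ^ q) - M * Φ| ≤ M * (γ / 8) := by
      rw [← mul_sub, abs_mul, abs_of_nonneg hM0]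
      exact mul_le_mul_of_nonneg_left hχ hM0
    have h8 : η * (M * W) = M * (γ / 8) := by rw [hη]; field_simp
    have h9 := abs_sub_le (sat R (Instance.ofScopes U) χ) (M * (density R χ * n ^ q)) (M * Φ)
    linarith
  · refine mul_le_mul_of_nonneg_left (Real.exp_le_exp.2 ?_) zero_le_two
    have h6 : η ^ 2 * W / (4 * κ) * n = η ^ 2 * (n / κ * W) / (4 * 1) := by field_simp
    rw [neg_mul, neg_le_neg_iff, h6]
    gcongr

/-- If the symmetrization is not marginally uniform, then there are compatible assignments with
different limit densities, and a random instance with at least order `n ^ (r - k + 1)` constraints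
is concentrated on two of them for each core and each small set of variables where they have to
agree. A sparsifier with few constraints does not distinguish the two for some core and its touched
variables. -/
theorem whp_requires_of_sym_not_uniform_of_le (R : ValuedRel D r) (hR1 : ∀ u, R u ≤ 1)
    (hR : ¬ R.Sym.MarginallyUniform k) {κ : ℝ} (hκ : 0 < κ) :
    ∃ ε₀ c : ℝ, 0 < ε₀ ∧ 0 < c ∧
      WHP r (fun n m ε => 0 < ε ∧ ε ≤ ε₀ ∧ (n : ℝ) ^ (r - k + 1) / κ ≤ (m : ℝ))
        (fun n _ ε => SparsifierRequires R ε (c * (n : ℝ) ^ (r - k + 1))) := by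
  simp only [marginallyUniform_iff, not_forall] at hR
  obtain ⟨d, h, E, ht, hr, H, hH, hne⟩ := hR
  obtain ⟨s, rfl⟩ := exists_hist_eq h
  have hd := hr.2.1
  have hk := ht.2.2
  have hcard := hr.card_core hk
  obtain ⟨α, hα, hα1, hα2, hgap⟩ := exists_limitDensity_ne hr hk hH hne
  set α' : D → ℝ := fun e => if e = d then 1 else 0 with hα'
  have hα'0 : ∀ e ∈ E, 0 ≤ α' e := fun e _ => by simp only [hα']; split_ifs <;> norm_num
  have hα'1 : ∑ e ∈ E, α' e = 1 := by simp [hα', hd]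
  have hα'2 : ∑ e ∈ E.erase d, α' e ≤ 1 / 2 := by
    rw [Finset.sum_eq_zero fun e he => if_neg (Finset.ne_of_mem_erase he)]
    norm_num
  set Φ := limitDensity R E (hist s) α
  set Φ' := limitDensity R E (hist s) α'
  have hΦ : 0 ≤ Φ := limitDensity_nonneg _ hα
  have hΦ' : 0 ≤ Φ' := limitDensity_nonneg _ hα'0
  set γ := |Φ - Φ'| with hγ
  have hγ0 : 0 < γ := abs_pos.2 (sub_ne_zero.2 hgap)
  set W := Φ + Φ' + γ with hW
  have hW0 : 0 < W := by positivity
  set η := γ / (8 * W) with hη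
  have hη0 : 0 < η := by positivity
  set τ := η ^ 2 * W / (4 * κ) with hτ
  have hτ0 : 0 < τ := by positivity
  obtain ⟨x, β, hx, hx1, hβ, hβ1, hent⟩ := exists_entropy_le hτ0
  refine ⟨η, β / (2 ^ (r - k) * (r + 1) ^ (r - k + 1)), hη0, by positivity, fun δ hδ => ?_⟩
  obtain ⟨N₁, hN₁⟩ := exists_natCast_forall_exists_density_near hr hk hα hα1 hα2
    (show 0 < γ / 8 by positivity)
  obtain ⟨N₂, hN₂⟩ := exists_natCast_forall_exists_density_near hr hk hα'0 hα'1 hα'2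
    (show 0 < γ / 8 by positivity)
  obtain ⟨N₃, hN₃⟩ := exists_natCast_forall_pow_mul_exp_le (r - k) (half_pos hτ0) hδ
  refine ⟨max (max N₁ N₂) (max N₃ (2 * r + 1)), fun n hn m ε ⟨hε, hε1, hm⟩ => ?_⟩
  simp only [max_le_iff] at hn
  obtain ⟨⟨hn1, hn2⟩, hn3, hn4⟩ := hn
  have hrn : r ≤ n := by omega
  have := nonempty_scopes hrn
  have hn0' : 0 < n := by omega
  have hn0 : (0 : ℝ) < n := by exact_mod_cast hn0'
  have hm0 : (0 : ℝ) < m := lt_of_lt_of_le (by positivity) hm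
  set M : ℝ := m / n ^ (r - k) with hM
  have hM0 : 0 < M := by positivity
  have : Nonempty (Fin n → D) := ⟨fun _ => d⟩
  choose! ψ hψc hψV hψΦ using hN₁ n hn1
  choose! ψ' hψc' hψV' hψΦ' using hN₂ n hn2
  let small := Finset.univ.filter fun V : Finset (Fin n) => (V.card : ℝ) ≤ β * n
  have hsmall : ∀ V ∈ small, 4 * V.card ≤ n := fun V hV => by
    have h1 := (Finset.mem_filter.1 hV).2
    have h2 : 4 * (V.card : ℝ) ≤ n := by nlinarith
    exact_mod_cast h2
  rw [randomProb_eq_freq]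
  refine one_sub_le_freq ((freq_le_sum ((Finset.univ : Finset ({i // s i ∉ E} ↪ Fin n)) ×ˢ small)
    (q := fun p U => ¬ (|sat R (Instance.ofScopes U) (ψ p.1 p.2) - M * Φ| ≤ M * γ / 4 ∧
      |sat R (Instance.ofScopes U) (ψ' p.1 p.2) - M * Φ'| ≤ M * γ / 4)) fun U hU => ?_).trans ?_)
  · by_contra! hgood
    refine hU fun C' hC' => ?_
    by_contra! hsize
    obtain ⟨T, hT⟩ := exists_card_touched_le hcard (by omega) (by omega) hβ C' hsize
    have hTs : touched C' T ∈ small := Finset.mem_filter.2 ⟨Finset.mem_univ _, hT⟩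
    obtain ⟨h1, h2⟩ := hgood (T, touched C' T)
      (Finset.mem_product.2 ⟨Finset.mem_univ _, hTs⟩)
    have hV := hsmall _ hTs
    refine not_isSparsifier_of_gap hM0 hΦ hΦ' hgap hε hε1 h1 h2 ?_ hC'
    refine sat_eq_of_touched (hasSupport_sym R) hr (hψc T _ hV) (hψc' T _ hV) C' fun v hv => ?_
    have hvT := (mem_touched.1 hv).1
    rw [hψV T _ hV v hv hvT, hψV' T _ hV v hv hvT]
  · have hterm : ∀ p ∈ (Finset.univ : Finset ({i // s i ∉ E} ↪ Fin n)) ×ˢ small,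
        freq (fun U : Fin m → (Fin r ↪ Fin n) =>
          ¬ (|sat R (Instance.ofScopes U) (ψ p.1 p.2) - M * Φ| ≤ M * γ / 4 ∧
          |sat R (Instance.ofScopes U) (ψ' p.1 p.2) - M * Φ'| ≤ M * γ / 4)) ≤
        4 * Real.exp (-τ * n) := by
      intro p hp
      have hV := hsmall _ (Finset.mem_product.1 hp).2
      have h1 := freq_not_abs_sat_sub_le R hR1 hrn hn0' hκ hγ0 (by linarith : Φ + γ ≤ W)
        (by linarith) hm (hψΦ p.1 p.2 hV)
      have h2 := freq_not_abs_sat_sub_le R hR1 hrn hn0' hκ hγ0 (by linarith : Φ' + γ ≤ W)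
        (by linarith) hm (hψΦ' p.1 p.2 hV)
      refine (freq_or_le fun U hU => not_and_or.1 hU).trans ((add_le_add h1 h2).trans ?_)
      linarith
    have hcardT : ((Finset.univ : Finset ({i // s i ∉ E} ↪ Fin n)).card : ℝ) ≤ n ^ (r - k) := by
      rw [Finset.card_univ, Fintype.card_embedding_eq, Fintype.card_fin, hcard]
      exact_mod_cast Nat.descFactorial_le_pow n (r - k)
    calc _ ≤ ∑ p ∈ (Finset.univ : Finset ({i // s i ∉ E} ↪ Fin n)) ×ˢ small,
          4 * Real.exp (-τ * n) := Finset.sum_le_sum hterm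
      _ = ((Finset.univ : Finset ({i // s i ∉ E} ↪ Fin n)).card : ℝ) * small.card *
          (4 * Real.exp (-τ * n)) := by
          rw [Finset.sum_const, Finset.card_product, nsmul_eq_mul, Nat.cast_mul]
      _ ≤ 4 * (n ^ (r - k) * Real.exp (-(τ / 2) * n)) :=
          mul_mul_exp_le hcardT (card_filter_card_le_le hx hx1 n) hent
      _ ≤ δ := hN₃ n hn3

/-- If the symmetrization is not marginally uniform, then a sparsifier has order
`min m (n ^ (r - k + 1))` constraints. -/
theorem whp_requires_of_sym_not_uniform (R : ValuedRel D r) (hR1 : ∀ u, R u ≤ 1)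
    (hR : ¬ R.Sym.MarginallyUniform k) :
    ∃ ε₀ c : ℝ, 0 < ε₀ ∧ 0 < c ∧ WHP r (fun _ _ ε => 0 < ε ∧ ε ≤ ε₀) (fun n m ε =>
      SparsifierRequires R ε (c * min (m : ℝ) ((n : ℝ) ^ (r - k + 1)))) := by
  obtain ⟨κ, ε₁, c₁, hκ, hε₁, hc₁, h₁⟩ := whp_requires_of_not_uniform (k := k) R hR1
    fun h => hR (sym_marginallyUniform h)
  obtain ⟨ε₂, c₂, hε₂, hc₂, h₂⟩ := whp_requires_of_sym_not_uniform_of_le R hR1 hR hκ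
  refine ⟨min ε₁ ε₂, min c₁ c₂, lt_min hε₁ hε₂, lt_min hc₁ hc₂, fun δ hδ => ?_⟩
  obtain ⟨N₁, hN₁⟩ := h₁ δ hδ
  obtain ⟨N₂, hN₂⟩ := h₂ δ hδ
  refine ⟨max N₁ (max N₂ r), fun n hn m ε ⟨hε, hεle⟩ => ?_⟩
  simp only [max_le_iff] at hn
  have := nonempty_scopes hn.2.2
  rw [le_min_iff] at hεle
  rcases le_total (m : ℝ) ((n : ℝ) ^ (r - k + 1) / κ) with hm | hm
  · refine (hN₁ n hn.1 m ε ⟨hε, hεle.1, hm⟩).trans ?_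
    rw [randomProb_eq_freq, randomProb_eq_freq]
    refine freq_mono fun U hU C' hC' => le_trans ?_ (hU C' hC')
    exact mul_le_mul (min_le_left _ _) (min_le_left _ _) (by positivity) hc₁.le
  · refine (hN₂ n hn.2.1 m ε ⟨hε, hεle.2, hm⟩).trans ?_
    rw [randomProb_eq_freq, randomProb_eq_freq]
    refine freq_mono fun U hU C' hC' => le_trans ?_ (hU C' hC')
    exact mul_le_mul (min_le_right _ _) (min_le_right _ _) (by positivity) hc₂.le

end DenseLower

end RandomCSP

theorem theorem8p1 {D : Type*} [Fintype D] [DecidableEq D] (r k : ℕ) (R : Set (Fin r → D))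
    (hk : (ofRelation R).PreciselyPlentiful k) :
    -- Case 1: the symmetrization is not marginally uniform.
    (¬ (ofRelation R).Sym.MarginallyUniform k →
      (∃ (A : ℝ) (b : ℕ), 0 < A ∧
        WHP r (fun _ _ ε => 0 < ε ∧ ε < 1) (fun n m ε =>
          SparsifiableTo (ofRelation R) ε
            (softO A b (min (m : ℝ) ((n : ℝ) ^ (r - k + 1) / ε ^ 2))))) ∧
      (∃ ε₀ c : ℝ, 0 < ε₀ ∧ 0 < c ∧
        WHP r (fun _ _ ε => 0 < ε ∧ ε ≤ ε₀) (fun n m ε =>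
          SparsifierRequires (ofRelation R) ε (c * min (m : ℝ) ((n : ℝ) ^ (r - k + 1)))))) ∧
    -- Case 2: the relation is marginally uniform.
    ((ofRelation R).MarginallyUniform k →
      (∃ (A : ℝ) (b : ℕ), 0 < A ∧
        WHP r (fun _ _ ε => 0 < ε ∧ ε < 1) (fun n m ε =>
          SparsifiableTo (ofRelation R) ε
            (softO A b (min (m : ℝ) ((n : ℝ) ^ (r - k) / ε ^ 3))))) ∧
      (∃ ε₀ c : ℝ, 0 < ε₀ ∧ 0 < c ∧
        WHP r (fun _ _ ε => 0 < ε ∧ ε ≤ ε₀) (fun n m ε =>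
          SparsifierRequires (ofRelation R) ε (c * min (m : ℝ) ((n : ℝ) ^ (r - k)))))) ∧
    -- Case 3: the symmetrization is marginally uniform, but the relation is not.
    ((ofRelation R).Sym.MarginallyUniform k → ¬ (ofRelation R).MarginallyUniform k →
      (∃ (κ A : ℝ) (b : ℕ), 0 < κ ∧ 0 < A ∧
        WHP r (fun n m ε => 0 < ε ∧ ε < 1 ∧ κ * (n : ℝ) ^ (r - k + 1) / ε ^ 2 ≤ (m : ℝ))
          (fun n _ ε =>
            SparsifiableTo (ofRelation R) ε (softO A b ((n : ℝ) ^ (r - k) / ε ^ 3)))) ∧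
      (∃ κ' ε₀ c : ℝ, 0 < κ' ∧ 0 < ε₀ ∧ 0 < c ∧
        WHP r (fun n m ε => 0 < ε ∧ ε ≤ ε₀ ∧ (m : ℝ) ≤ (n : ℝ) ^ (r - k + 1) / κ')
          (fun _ m ε => SparsifierRequires (ofRelation R) ε (c * (m : ℝ))))) := by
  obtain ⟨d, h, ht⟩ := exists_tight hk
  have : Nonempty D := ⟨d⟩
  have hkr : k ≤ r := SVR.PreciselyPlentiful.le hk
  have hne : ∃ h, (ofRelation R).Sym h ≠ 0 := ⟨h, ht.1⟩
  have hPS := hasSupport_sym (ofRelation R)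
  have hR1 : ∀ u, ofRelation R u ≤ 1 := fun u =>
    Set.indicator_le_self' (s := R) (f := fun _ => 1) (fun _ _ => zero_le_one) u
  refine ⟨fun hS => ⟨?_, whp_requires_of_sym_not_uniform _ hR1 hS⟩,
    fun hR => ⟨?_, whp_requires_of_preciselyPlentiful _ hk⟩,
    fun hS hR => ⟨whp_sparsifiable_of_sym hk.1 hne hkr hS, whp_requires_of_not_uniform _ hR1 hR⟩⟩
  · obtain ⟨A, hA, h⟩ := approximatesBeyond_of_plentiful hPS hk.1 hkr
    exact ⟨2 * A, 0, by positivity, h.whp_sparsifiable hA⟩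
  · obtain ⟨A, hA, h⟩ := approximatesBeyond_of_uniform hPS hk.1 hne hkr hR
    exact ⟨2 * A, 1, by positivity, h.whp_sparsifiable hA⟩
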